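/- For a bounded open set $\Omega\subset\mathbb R^n$ with smooth boundary, let $$T(\Omega)=\inf\Big\{\tfrac12\int_\Omega|\nabla u|^2\,dx-\int_\Omega u\,dx\;:\;u\in H^1(\Omega),\ \int_{\partial\Omega}u\,d\sigma=0\Big\},$$ where the boundary values of $u$ are taken in the sense of traces. Call $\Omega$ a stationary shape of $T$ if $\frac{d}{dt}\big|_{t=0}T(F_t(\Omega))$ exists and equals $0$ for every flow map $F_t$ ($\partial_tF_t=\eta\circ F_t$, $F_0=\mathrm{id}$) of a vector field $\eta\in C_c^\infty(\mathbb R^n,\mathbb R^n)$ such that $|F_t(\Omega)|=|\Omega|$ for all $t$. Let $n\ge 2$. 1. No annulus is a stationary shape of $T$: for all $x_0\in\mathbb R^n$ and $0<a<b$, the set $\{x\in\mathbb R^n: a<|x-x_0|<b\}$ is not stationary. In particular, $\{1<|x|<b\}$ is not stationary for any $b>1$. 2. Let $b>1$ and $\Omega=\{x\in\mathbb R^n:1<|x|<b\}$, let $\nu$ be the outward unit normal of $\partial\Omega$ and $H$ the mean curvature of $\partial\Omega$ with respect to $\nu$ (the sum of the principal curvatures, positive for spheres bounding balls). The Neumann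 problem $$-\Delta u=1\ \text{ in }\Omega,\qquad \frac{\partial u}{\partial\nu}=c\ \text{ on }\partial\Omega,\qquad \int_{\partial\Omega}u\,d\sigma=0,\qquad c\in\mathbb R\text{ a constant},$$ has a solution $u\in C^2(\Omega)\cap C^1(\overline\Omega)$ for some $c$; every such solution (for any $c$) is radial, and for no such solution is the function $\tfrac12|\nabla u|^2-cHu-u$ constant on $\partial\Omega$. -/

import Mathlib

open MeasureTheory Filter Topology
open scoped ContDiff Gradient InnerProductSpace

noncomputable section

namespace NeumannTorsion

/-- `ℝⁿ` with its Euclidean norm. -/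
abbrev Space (n : ℕ) : Type := EuclideanSpace ℝ (Fin n)

variable {n : ℕ}

/-- The open annulus (spherical shell) `{x : a < |x - x₀| < b}`. -/
def annulus (x₀ : Space n) (a b : ℝ) : Set (Space n) :=
  {x | a < ‖x - x₀‖ ∧ ‖x - x₀‖ < b}

/-- The surface measure `dσ` of `∂Ω`: the `(n-1)`-dimensional Hausdorff measure (normalised as
`(n-1)`-dimensional volume) restricted to the topological boundary. -/
def surfaceMeasure (Ω : Set (Space n)) : Measure (Space n) :=
  (μHE[n - 1]).restrict (frontier Ω)

/-! ### The Sobolev space `H¹(Ω)` and boundary traces -/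

/-- `G` is the weak (distributional) gradient of `u` in the open set `Ω`. -/
def IsWeakGradient (Ω : Set (Space n)) (u : Space n → ℝ) (G : Space n → Space n) : Prop :=
  ∀ φ : Space n → ℝ, ContDiff ℝ ∞ φ → HasCompactSupport φ → tsupport φ ⊆ Ω →
    ∀ v : Space n, ∫ x in Ω, u x * fderiv ℝ φ x v = -∫ x in Ω, ⟪G x, v⟫_ℝ * φ x

/-- `u ∈ H¹(Ω)`, with weak gradient `G`. -/
structure MemH1 (Ω : Set (Space n)) (u : Space n → ℝ) (G : Space n → Space n) : Prop where
  memLp : MemLp u 2 (volume.restrict Ω)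
  memLp_grad : MemLp G 2 (volume.restrict Ω)
  isWeakGradient : IsWeakGradient Ω u G

/-- `g ∈ L²(∂Ω)` is the trace on `∂Ω` of `u ∈ H¹(Ω)` (with weak gradient `G`). The trace operator
is the continuous extension to `H¹(Ω)` of the restriction `φ ↦ φ|_{∂Ω}` of smooth functions, so
this says that some `φ k ∈ C_c^∞(ℝⁿ)` converge to `u` in `H¹(Ω)` and to `g` in `L²(∂Ω)`. -/
def IsTrace (Ω : Set (Space n)) (u : Space n → ℝ) (G : Space n → Space n)
    (g : Space n → ℝ) : Prop :=
  MemLp g 2 (surfaceMeasure Ω) ∧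
  ∃ φ : ℕ → Space n → ℝ,
    (∀ k, ContDiff ℝ ∞ (φ k)) ∧ (∀ k, HasCompactSupport (φ k)) ∧
    Tendsto (fun k => eLpNorm (fun x => φ k x - u x) 2 (volume.restrict Ω)) atTop (𝓝 0) ∧
    Tendsto (fun k => eLpNorm (fun x => ∇ (φ k) x - G x) 2 (volume.restrict Ω)) atTop (𝓝 0) ∧
    Tendsto (fun k => eLpNorm (fun x => φ k x - g x) 2 (surfaceMeasure Ω)) atTop (𝓝 0)

/-! ### The shape functional `T` and its stationary shapes -/

/-- The values of `½ ∫_Ω |∇u|² - ∫_Ω u` over all `u ∈ H¹(Ω)` with `∫_{∂Ω} u dσ = 0`. -/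
def energyValues (Ω : Set (Space n)) : Set ℝ :=
  {e | ∃ (u : Space n → ℝ) (G : Space n → Space n) (g : Space n → ℝ),
    MemH1 Ω u G ∧ IsTrace Ω u G g ∧ ∫ x, g x ∂(surfaceMeasure Ω) = 0 ∧
    e = (1 / 2) * (∫ x in Ω, ‖G x‖ ^ 2) - ∫ x in Ω, u x}

/-- `T(Ω) = inf {½ ∫_Ω |∇u|² - ∫_Ω u : u ∈ H¹(Ω), ∫_{∂Ω} u dσ = 0}`. -/
def T (Ω : Set (Space n)) : ℝ := sInf (energyValues Ω)

/-- `F` is the flow map of the vector field `η`: `∂ₜ F(t, x) = η (F(t, x))`, `F(0, x) = x`. -/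
def IsFlowMap (η : Space n → Space n) (F : ℝ → Space n → Space n) : Prop :=
  (∀ x, F 0 x = x) ∧ ∀ t x, HasDerivAt (fun s => F s x) (η (F t x)) t

/-- `Ω` is a stationary shape of `T`: for every `η ∈ C_c^∞(ℝⁿ, ℝⁿ)` whose flow preserves the volume
of `Ω`, the derivative of `t ↦ T(F_t(Ω))` at `t = 0` exists and vanishes. -/
def IsStationaryShape (Ω : Set (Space n)) : Prop :=
  ∀ (η : Space n → Space n) (F : ℝ → Space n → Space n),
    ContDiff ℝ ∞ η → HasCompactSupport η → IsFlowMap η F →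
    (∀ t, volume (F t '' Ω) = volume Ω) →
    HasDerivAt (fun t => T (F t '' Ω)) 0 0

/-! ### The overdetermined boundary value problem -/

/-- The signed distance to `∂Ω`, negative inside `Ω` and positive outside. -/
def signedDistance (Ω : Set (Space n)) (x : Space n) : ℝ :=
  Metric.infDist x Ω - Metric.infDist x Ωᶜ

/-- The outward unit normal of `∂Ω` (for `Ω` with smooth boundary): the gradient of the signed
distance. -/
def outerNormal (Ω : Set (Space n)) (p : Space n) : Space n :=
  ∇ (signedDistance Ω) p

/-- The mean curvature (sum of the principal curvatures) of `∂Ω` with respect to the outward normal,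
for `Ω` with smooth boundary: the divergence of the normal field `∇ d`, i.e. the Laplacian of the
signed distance `d`. It equals `(n - 1) / R` on the boundary of a ball of radius `R`. -/
def meanCurvature (Ω : Set (Space n)) (p : Space n) : ℝ :=
  Laplacian.laplacian (signedDistance Ω) p

/-- `u ∈ C²(Ω) ∩ C¹(closure Ω)` is a classical solution of `-Δu = 1` in `Ω`, `∂u/∂ν = c` on `∂Ω`,
`∫_{∂Ω} u dσ = 0`. Here `Du` is the continuous extension of `∇u` to `closure Ω`. -/
structure IsNeumannSolution (Ω : Set (Space n)) (u : Space n → ℝ) (Du : Space n → Space n)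
    (c : ℝ) : Prop where
  contDiffOn : ContDiffOn ℝ 2 u Ω
  continuousOn : ContinuousOn u (closure Ω)
  gradient_eq : ∀ x ∈ Ω, Du x = ∇ u x
  continuousOn_gradient : ContinuousOn Du (closure Ω)
  neg_laplacian : ∀ x ∈ Ω, -Laplacian.laplacian u x = 1
  normal_derivative : ∀ p ∈ frontier Ω, ⟪Du p, outerNormal Ω p⟫_ℝ = c
  boundary_mean : ∫ x, u x ∂(surfaceMeasure Ω) = 0

/-- The extra stationarity condition: `½ |∇u|² - c H u - u` is constant on `∂Ω`. -/
def StationarityCondition (Ω : Set (Space n)) (u : Space n → ℝ) (Du : Space n → Space n)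
    (c : ℝ) : Prop :=
  ∃ K : ℝ, ∀ p ∈ frontier Ω,
    (1 / 2) * ‖Du p‖ ^ 2 - c * meanCurvature Ω p * u p - u p = K

end NeumannTorsion

end

/-! Everything rests on one radial function. On `{a < |x - x₀| < b}` put `s(r) = (K / r^(n-1) - r) /
n` and choose `K = (a + b) / (A + B)`, where `A = a^-(n-1)` and `B = b^-(n-1)`, so that `s(a) =
-s(b)`. The radial field `V` with slope `s` then has divergence `-1` and the same outward normal
component `c = s(b)` on both boundary spheres. Green's formula (`green_slopeField`) therefore gives
`∫ ⟪V, ∇u⟫ = ∫ u` whenever the trace of `u` has mean zero. Completing the square yields `T = -½ ∫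
|V|²`, attained at a radial primitive of `V` (`isLeast_energyValues_annulus`, `T_annulus`).

Non-stationarity: let the two radii move so that `α^n` and `β^n` grow at the same constant rate to
first order, with their difference exactly constant. This is realised by a smooth compactly
supported radial field (`exists_volumePreserving_profile`). With `L = ∫_a^b r^-(n-1) dr`, the
derivative of `∫ r^(n-1) s²` is `2 K' (K L - (b² - a²)/2) / n²`. Here `K' > 0`, and the bracket is
negative because the trapezoidal rule strictly overestimates the integral of the strictly convex
function `r^-(n-1)`, that is, `L < (b - a)(A + B)/2` (`slopeConst_mul_integral_lt`). So the
derivative of `T` is nonzero.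

The overdetermined problem: the radial primitive of `V` with boundary mean zero is a Neumann
solution. It is the only one, even with `c` left free, because a difference `v` of two solutions is
harmonic with constant normal derivative `δ`, so that formally `∫ |∇v|² = δ ∫_∂Ω v = 0`
(`eq_zero_of_harmonic_neumann`). The same trapezoidal inequality says that the solution is smaller
on the outer sphere than on the inner one. With the zero boundary mean it is then negative outside
and positive inside, and a comparison of signs excludes equality of `½|∇u|² - cHu - u` on the two
spheres.

Hausdorff measure on spheres is handled by invariance: it is a positive multiple `κ` of the
polar-coordinate measure, since both give equal mass to balls of equal radius. The value of `κ`
never matters, because surface measure enters only through vanishing means. -/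

noncomputable section

namespace NeumannTorsion

/-! ### Uniqueness of uniformly distributed measures -/

/-- Two finite measures for which the measure of a ball depends only on its radius are
proportional. -/
theorem uniformlyDistributed_integral_eq {X : Type*} [MetricSpace X] [CompactSpace X]
    [SecondCountableTopology X] [MeasurableSpace X] [BorelSpace X] (μ ν : Measure X)
    [IsFiniteMeasure μ] [IsFiniteMeasure ν] (hμ0 : μ ≠ 0)
    (hμ : ∀ x y r, μ (Metric.ball x r) = μ (Metric.ball y r))
    (hν : ∀ x y r, ν (Metric.ball x r) = ν (Metric.ball y r))
    {f : X → ℝ} (hf : Continuous f) :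
    μ.real Set.univ * ∫ x, f x ∂ν = ν.real Set.univ * ∫ x, f x ∂μ := by
  obtain ⟨x₀⟩ : Nonempty X := by
    by_contra h
    rw [not_nonempty_iff] at h
    exact hμ0 (Measure.eq_zero_of_isEmpty μ)
  have hM : 0 < μ.real Set.univ := by
    simp [measureReal_def, ENNReal.toReal_pos_iff, hμ0, pos_iff_ne_zero, measure_lt_top]
  have hball : ∀ r, 0 < r → 0 < μ.real (Metric.ball x₀ r) := by
    intro r hr
    rw [measureReal_def, ENNReal.toReal_pos_iff]
    refine ⟨?_, measure_lt_top _ _⟩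
    rw [pos_iff_ne_zero]
    intro h0
    apply hμ0
    rw [← Measure.measure_univ_eq_zero]
    obtain ⟨t, ht⟩ := isCompact_univ.elim_finite_subcover (fun x : X => Metric.ball x r)
      (fun _ => Metric.isOpen_ball) (fun x _ => Set.mem_iUnion.2 ⟨x, Metric.mem_ball_self hr⟩)
    refine measure_mono_null ht ?_
    refine (measure_biUnion_null_iff t.countable_toSet).2 ?_
    intro x _
    rw [hμ x x₀, h0]
  -- Fubini on the set of pairs at distance less than `r`: integrating out either variable leaves a
  -- ball measure, which does not depend on the centre.
  have key : ∀ r, ∀ g : X → ℝ, Continuous g →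
      Integrable (Set.indicator {p : X × X | dist p.1 p.2 < r} (fun p => g p.1)) (μ.prod ν) ∧
      Integrable (Set.indicator {p : X × X | dist p.1 p.2 < r} (fun p => g p.2)) (μ.prod ν) ∧
      ∫ p, Set.indicator {p : X × X | dist p.1 p.2 < r} (fun p => g p.1) p ∂(μ.prod ν)
        = ν.real (Metric.ball x₀ r) * ∫ x, g x ∂μ ∧
      ∫ p, Set.indicator {p : X × X | dist p.1 p.2 < r} (fun p => g p.2) p ∂(μ.prod ν)
        = μ.real (Metric.ball x₀ r) * ∫ x, g x ∂ν := by
    intro r g hg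
    have hS : MeasurableSet {p : X × X | dist p.1 p.2 < r} :=
      (isOpen_lt (by fun_prop) (by fun_prop)).measurableSet
    have hc : ∀ h : X × X → ℝ, Continuous h → Integrable h (μ.prod ν) := fun h hh =>
      hh.integrable_of_hasCompactSupport (HasCompactSupport.of_compactSpace h)
    have i1 := (hc (fun p => g p.1) (by fun_prop)).indicator hS
    have i2 := (hc (fun p => g p.2) (by fun_prop)).indicator hS
    refine ⟨i1, i2, ?_, ?_⟩
    · rw [integral_prod _ i1, ← integral_const_mul]
      congr 1 with x
      have : (fun y => Set.indicator {p : X × X | dist p.1 p.2 < r} (fun p => g p.1) (x, y))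
          = Set.indicator (Metric.ball x r) (fun _ => g x) := by
        ext y
        simp [Set.indicator, dist_comm x y]
      rw [this, integral_indicator Metric.isOpen_ball.measurableSet]
      simp [measureReal_def, hν x x₀]
    · rw [integral_prod_symm _ i2, ← integral_const_mul]
      congr 1 with y
      have : (fun x => Set.indicator {p : X × X | dist p.1 p.2 < r} (fun p => g p.2) (x, y))
          = Set.indicator (Metric.ball y r) (fun _ => g y) := by
        ext x
        simp [Set.indicator]
      rw [this, integral_indicator Metric.isOpen_ball.measurableSet]
      simp [measureReal_def, hμ y x₀]
  have hratio : ∀ r, ν.real (Metric.ball x₀ r) * μ.real Set.univ =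
      μ.real (Metric.ball x₀ r) * ν.real Set.univ := by
    intro r
    obtain ⟨-, -, h1, h2⟩ := key r (fun _ => 1) continuous_const
    rw [h1] at h2
    simpa using h2
  -- For `r` small, `f p.1` and `f p.2` differ by less than `ε` on these pairs. The ratio of ball
  -- measures is the ratio of total masses, so the positive ball measure cancels and leaves a bound
  -- free of `r`.
  have hest : ∀ ε > 0, |ν.real Set.univ * ∫ x, f x ∂μ - μ.real Set.univ * ∫ x, f x ∂ν| ≤
      ε * (μ.real Set.univ * ν.real Set.univ) := by
    intro ε hε
    obtain ⟨r, hr, hfr⟩ := Metric.uniformContinuous_iff.1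
      (CompactSpace.uniformContinuous_of_continuous hf) ε hε
    obtain ⟨i1, i2, h1, h2⟩ := key r f hf
    obtain ⟨i3, -, h3, -⟩ := key r (fun _ => ε) continuous_const
    have hsub : |ν.real (Metric.ball x₀ r) * ∫ x, f x ∂μ - μ.real (Metric.ball x₀ r) * ∫ x, f x ∂ν|
        ≤ ε * (μ.real (Metric.ball x₀ r) * ν.real Set.univ) := by
      rw [← h1, ← h2, ← integral_sub i1 i2]
      refine (abs_integral_le_integral_abs).trans ?_
      have : ε * (μ.real (Metric.ball x₀ r) * ν.real Set.univ) =
          ν.real (Metric.ball x₀ r) * ∫ x : X, ε ∂μ := by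
        simp only [integral_const, smul_eq_mul]
        linear_combination -ε * hratio r
      rw [this, ← h3]
      refine integral_mono (i1.sub i2).abs i3 fun p => ?_
      by_cases hp : dist p.1 p.2 < r
      · simp only [Set.indicator, Set.mem_ofPred_eq, hp, if_true]
        simpa [Real.dist_eq] using (hfr hp).le
      · simp [Set.indicator, hp]
    have hg := hball r hr
    set G := μ.real (Metric.ball x₀ r)
    set H := ν.real (Metric.ball x₀ r)
    set A := ∫ x, f x ∂μ
    set B := ∫ x, f x ∂ν
    set M := μ.real Set.univ
    set N := ν.real Set.univ
    have e : G * (N * A - M * B) = M * (H * A - G * B) := by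
      linear_combination -A * hratio r
    have : G * |N * A - M * B| ≤ G * (ε * (M * N)) := by
      calc G * |N * A - M * B| = |G * (N * A - M * B)| := by rw [abs_mul, abs_of_pos hg]
        _ = M * |H * A - G * B| := by rw [e, abs_mul, abs_of_pos hM]
        _ ≤ M * (ε * (G * N)) := by gcongr
        _ = _ := by ring
    exact le_of_mul_le_mul_left this hg
  by_contra hne
  have hpos : 0 < |ν.real Set.univ * ∫ x, f x ∂μ - μ.real Set.univ * ∫ x, f x ∂ν| :=
    abs_pos.2 (sub_ne_zero.2 (Ne.symm hne))
  set Q := |ν.real Set.univ * ∫ x, f x ∂μ - μ.real Set.univ * ∫ x, f x ∂ν|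
  have hMN : 0 ≤ μ.real Set.univ * ν.real Set.univ := by positivity
  have := hest (Q / (2 * (μ.real Set.univ * ν.real Set.univ + 1))) (by positivity)
  have h2 : Q / (2 * (μ.real Set.univ * ν.real Set.univ + 1)) *
      (μ.real Set.univ * ν.real Set.univ) < Q := by
    rw [div_mul_eq_mul_div, div_lt_iff₀ (by positivity)]
    nlinarith
  linarith

theorem uniformlyDistributed_eq_smul {X : Type*} [MetricSpace X] [CompactSpace X]
    [SecondCountableTopology X] [MeasurableSpace X] [BorelSpace X] (μ ν : Measure X)
    [IsFiniteMeasure μ] [IsFiniteMeasure ν] (hμ0 : μ ≠ 0)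
    (hμ : ∀ x y r, μ (Metric.ball x r) = μ (Metric.ball y r))
    (hν : ∀ x y r, ν (Metric.ball x r) = ν (Metric.ball y r)) :
    ν = ENNReal.ofReal (ν.real Set.univ / μ.real Set.univ) • μ := by
  have hM : 0 < μ.real Set.univ := by
    simp [measureReal_def, ENNReal.toReal_pos_iff, hμ0, pos_iff_ne_zero, measure_lt_top]
  have : IsFiniteMeasure (ENNReal.ofReal (ν.real Set.univ / μ.real Set.univ) • μ) :=
    Measure.smul_finite μ ENNReal.ofReal_ne_top
  refine ext_of_forall_integral_eq_of_IsFiniteMeasure fun f => ?_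
  rw [integral_smul_measure, ENNReal.toReal_ofReal (by positivity), smul_eq_mul]
  have := uniformlyDistributed_integral_eq μ ν hμ0 hμ hν f.continuous
  field_simp
  linarith

/-! ### Hausdorff measure of Euclidean spheres -/

/-- Two hemispheres, about `v` and `-v`, cover the sphere. Each lies in the image of a disc of
radius 2 in a hyperplane under inverse stereographic projection, which is smooth and hence Lipschitz
on that compact disc. -/
theorem hausdorffMeasure_unitSphere_lt_top {n : ℕ} (hn : 1 ≤ n) :
    (μHE[n - 1] : Measure (Space n)) (Metric.sphere 0 1) < ⊤ := by
  have hcap : ∀ v : Space n, ‖v‖ = 1 → (μHE[n - 1] : Measure (Space n))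
      (stereoInvFunAux v '' (Subtype.val '' Metric.closedBall (0 : (ℝ ∙ v)ᗮ) 2)) < ⊤ := by
    intro v hv
    have hcp : IsCompact (Subtype.val '' Metric.closedBall (0 : (ℝ ∙ v)ᗮ) 2 : Set (Space n)) :=
      (isCompact_closedBall _ _).image continuous_subtype_val
    have hlip : LocallyLipschitzOn (Subtype.val '' Metric.closedBall (0 : (ℝ ∙ v)ᗮ) 2)
        (stereoInvFunAux v) :=
      (contDiff_stereoInvFunAux (m := 1)).locallyLipschitz.locallyLipschitzOn
    obtain ⟨K, hK⟩ := hlip.exists_lipschitzOnWith_of_compact hcp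
    have hfin : Module.finrank ℝ (ℝ ∙ v)ᗮ = n - 1 := by
      have h1 := Submodule.finrank_add_finrank_orthogonal (K := (ℝ ∙ v))
      rw [finrank_span_singleton (by rintro rfl; simp at hv), finrank_euclideanSpace_fin] at h1
      omega
    have h2 : (μHE[n - 1] : Measure (Space n))
        (Subtype.val '' Metric.closedBall (0 : (ℝ ∙ v)ᗮ) 2) < ⊤ := by
      rw [isometry_subtype_coe.euclideanHausdorffMeasure_image, ← hfin]
      exact (isCompact_closedBall _ _).measure_lt_top
    have h3 := hK.hausdorffMeasure_image_le (d := ((n - 1 : ℕ) : ℝ)) (by positivity)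
    -- `μHE` is a nonzero multiple of `μH`; the Lipschitz estimate is applied to the latter after
    -- the factor is stripped.
    have h4 : (0 : NNReal) < Measure.addHaarScalarFactor
        (volume : Measure (EuclideanSpace ℝ (Fin (n - 1)))) μH[(n - 1 : ℕ)] :=
      pos_iff_ne_zero.2 (Measure.addHaarScalarFactor_volume_hausdorffMeasure_ne_zero (n - 1))
    rw [Measure.euclideanHausdorffMeasure_def, Measure.smul_apply, ENNReal.smul_def,
      smul_eq_mul] at h2 ⊢
    refine ENNReal.mul_lt_top ENNReal.coe_lt_top (h3.trans_lt (ENNReal.mul_lt_top (by simp) ?_))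
    rw [ENNReal.mul_lt_top_iff] at h2
    rcases h2 with h2 | h2 | h2
    · exact h2.2
    · simp at h2; simp [h2] at h4
    · rw [h2]; exact ENNReal.zero_lt_top
  obtain ⟨v, hv⟩ : ∃ v : Space n, ‖v‖ = 1 :=
    ⟨EuclideanSpace.single ⟨0, hn⟩ 1, by simp⟩
  refine lt_of_le_of_lt (measure_mono ?_) ((measure_union_le _ _).trans_lt
    (ENNReal.add_lt_top.2 ⟨hcap v hv, hcap (-v) (by simpa using hv)⟩))
  have hhalf : ∀ v : Space n, ‖v‖ = 1 → ∀ x ∈ Metric.sphere (0 : Space n) 1, ⟪v, x⟫_ℝ ≤ 0 →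
      x ∈ stereoInvFunAux v '' (Subtype.val '' Metric.closedBall (0 : (ℝ ∙ v)ᗮ) 2) := by
    intro v hv x hx hvx
    have hxv : x ≠ v := by
      rintro rfl
      rw [real_inner_self_eq_norm_sq, hv] at hvx
      norm_num at hvx
    refine ⟨_, ⟨stereoToFun v x, ?_, rfl⟩,
      congrArg Subtype.val (stereo_left_inv hv (x := ⟨x, hx⟩) hxv)⟩
    rw [mem_closedBall_zero_iff, stereoToFun_apply, norm_smul, innerSL_apply_apply,
      Real.norm_eq_abs, abs_of_nonneg (by apply div_nonneg <;> linarith)]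
    have h5 : ‖(ℝ ∙ v)ᗮ.orthogonalProjectionOnto x‖ ≤ 1 := by
      refine (Submodule.norm_orthogonalProjectionOnto_apply_le _ _).trans ?_
      simpa using hx.le
    have h6 : 2 / (1 - ⟪v, x⟫_ℝ) ≤ 2 := by
      rw [div_le_iff₀ (by linarith)]
      linarith
    calc _ ≤ 2 * (1 : ℝ) := by gcongr
      _ = 2 := by norm_num
  intro x hx
  rcases le_total ⟪v, x⟫_ℝ 0 with h | h
  · exact Or.inl (hhalf v hv x hx h)
  · exact Or.inr (hhalf (-v) (by simpa using hv) x hx (by simpa using h))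

/-- Orthogonal projection onto a hyperplane is 1-Lipschitz and its image of the sphere contains the
open unit ball of the hyperplane, which has positive measure. -/
theorem hausdorffMeasure_unitSphere_ne_zero {n : ℕ} (hn : 1 ≤ n) :
    (μHE[n - 1] : Measure (Space n)) (Metric.sphere 0 1) ≠ 0 := by
  obtain ⟨v, hv⟩ : ∃ v : Space n, ‖v‖ = 1 :=
    ⟨EuclideanSpace.single ⟨0, hn⟩ 1, by simp⟩
  have hfin : Module.finrank ℝ (ℝ ∙ v)ᗮ = n - 1 := by
    have h1 := Submodule.finrank_add_finrank_orthogonal (K := (ℝ ∙ v))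
    rw [finrank_span_singleton (by rintro rfl; simp at hv), finrank_euclideanSpace_fin] at h1
    omega
  have hpos : (μHE[n - 1] : Measure (ℝ ∙ v)ᗮ) (Metric.ball 0 1) ≠ 0 := by
    rw [← hfin]
    exact (Metric.isOpen_ball.measure_pos _ ⟨0, by simp⟩).ne'
  have hlip : LipschitzWith 1 ((ℝ ∙ v)ᗮ.orthogonalProjectionOnto) :=
    LipschitzWith.of_dist_le_mul fun x y => by
      rw [dist_eq_norm, ← map_sub, NNReal.coe_one, one_mul, dist_eq_norm]
      exact Submodule.norm_orthogonalProjectionOnto_apply_le _ _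
  have himg : Metric.ball (0 : (ℝ ∙ v)ᗮ) 1 ⊆
      (ℝ ∙ v)ᗮ.orthogonalProjectionOnto '' Metric.sphere (0 : Space n) 1 := by
    intro w hw
    rw [mem_ball_zero_iff] at hw
    refine ⟨(w : Space n) + Real.sqrt (1 - ‖w‖ ^ 2) • v, ?_, ?_⟩
    · have hwv : ⟪(w : Space n), v⟫_ℝ = 0 :=
        (Submodule.mem_orthogonal_singleton_iff_inner_left).1 w.2
      rw [mem_sphere_zero_iff_norm, ← sq_eq_sq₀ (norm_nonneg _) zero_le_one,
        norm_add_sq_real, inner_smul_right, hwv, norm_smul, hv, mul_one, Real.norm_eq_abs,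
        sq_abs, Real.sq_sqrt (by nlinarith [norm_nonneg w])]
      simp
    · rw [map_add, map_smul, Submodule.orthogonalProjectionOnto_orthogonalComplement_singleton_eq_zero,
        Submodule.orthogonalProjectionOnto_mem_subspace_eq_self]
      simp
  intro h0
  apply hpos
  refine measure_mono_null himg ?_
  have h4 : Measure.addHaarScalarFactor
      (volume : Measure (EuclideanSpace ℝ (Fin (n - 1)))) μH[(n - 1 : ℕ)] ≠ 0 :=
    Measure.addHaarScalarFactor_volume_hausdorffMeasure_ne_zero (n - 1)
  rw [Measure.euclideanHausdorffMeasure_def, Measure.smul_apply, ENNReal.smul_def,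
    smul_eq_mul, mul_eq_zero] at h0 ⊢
  right
  have h0' := h0.resolve_left (by simpa using h4)
  have := hlip.hausdorffMeasure_image_le (d := ((n - 1 : ℕ) : ℝ)) (by positivity)
    (Metric.sphere (0 : Space n) 1)
  rw [h0', mul_zero] at this
  exact le_antisymm this zero_le

/-- The rotation-invariant measure on the unit sphere induced by Lebesgue measure through polar
coordinates. -/
abbrev sphereMeasure (n : ℕ) : Measure (Metric.sphere (0 : Space n) 1) :=
  (volume : Measure (Space n)).toSphere

/-- The reflection exchanging `x` and `y` preserves the sphere; one reflection serves all radii. -/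
theorem exists_isometry_unitSphere {n : ℕ} (x y : Metric.sphere (0 : Space n) 1) :
    ∃ R : Space n ≃ₗᵢ[ℝ] Space n, ∀ r : ℝ, (Subtype.val '' Metric.ball y r : Set (Space n)) =
      R '' (Subtype.val '' Metric.ball x r) := by
  have hxy : ‖(x : Space n)‖ = ‖(y : Space n)‖ := by simp
  set R := (ℝ ∙ ((x : Space n) - y))ᗮ.reflection
  have hR : R x = y := Submodule.reflection_sub hxy
  have hRy : R y = x := by rw [← hR]; exact Submodule.reflection_reflection _ _
  refine ⟨R, fun r => ?_⟩
  ext z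
  simp only [Set.mem_image, Metric.mem_ball, Subtype.exists, exists_and_right, exists_eq_right,
    Subtype.dist_eq]
  constructor
  · rintro ⟨hz, hzr⟩
    refine ⟨R z, ⟨by simpa using hz, ?_⟩, Submodule.reflection_reflection _ _⟩
    rw [← hRy, R.dist_map]
    exact hzr
  · rintro ⟨w, ⟨hw, hwr⟩, rfl⟩
    refine ⟨by simpa using hw, ?_⟩
    rw [← hR, R.dist_map]
    exact hwr

-- `toSphere` measures a set by the volume of the cone over it, and a linear isometry commutes with
-- forming cones and preserves volume.
open scoped Pointwise in
theorem sphereMeasure_ball (n : ℕ) (x y : Metric.sphere (0 : Space n) 1) (r : ℝ) :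
    sphereMeasure n (Metric.ball x r) = sphereMeasure n (Metric.ball y r) := by
  obtain ⟨R, hR⟩ := exists_isometry_unitSphere x y
  rw [Measure.toSphere_apply' _ Metric.isOpen_ball.measurableSet,
    Measure.toSphere_apply' _ Metric.isOpen_ball.measurableSet, hR r]
  have himg : Set.Ioo (0 : ℝ) 1 • (R '' (Subtype.val '' Metric.ball x r)) =
      R '' (Set.Ioo (0 : ℝ) 1 • (Subtype.val '' Metric.ball x r)) := by
    rw [← Set.image2_smul, ← Set.image2_smul, Set.image2_image_right,
      Set.image_image2]
    simp only [map_smul]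
  rw [himg, ← LinearIsometryEquiv.coe_toLinearEquiv, LinearEquiv.image_eq_preimage_symm]
  congr 1
  exact (R.symm.measurePreserving.measure_preimage_emb
    R.symm.toHomeomorph.measurableEmbedding _).symm

theorem hausdorffMeasure_sphere_ball {n : ℕ} (x y : Metric.sphere (0 : Space n) 1) (r : ℝ) :
    (μHE[n - 1] : Measure (Metric.sphere (0 : Space n) 1)) (Metric.ball x r) =
      μHE[n - 1] (Metric.ball y r) := by
  obtain ⟨R, hR⟩ := exists_isometry_unitSphere x y
  rw [← isometry_subtype_coe.euclideanHausdorffMeasure_image,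
    ← isometry_subtype_coe.euclideanHausdorffMeasure_image (Metric.ball y r), hR r,
    R.isometry.euclideanHausdorffMeasure_image]

/-- On every sphere of radius `r` the Hausdorff measure is `κ r ^ (n - 1)` times the image of the
measure `sphereMeasure n`. -/
theorem exists_hausdorffMeasure_restrict_sphere {n : ℕ} (hn : 2 ≤ n) :
    ∃ κ : ℝ, 0 < κ ∧ ∀ (x₀ : Space n) (r : ℝ), 0 < r →
      (μHE[n - 1] : Measure (Space n)).restrict (Metric.sphere x₀ r) =
        ENNReal.ofReal (κ * r ^ (n - 1)) •
          (sphereMeasure n).map (fun θ : Metric.sphere (0 : Space n) 1 => x₀ + r • (θ : Space n)) := by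
  have : Nontrivial (Fin n) := Fin.nontrivial_iff_two_le.2 hn
  have : Nonempty (Fin n) := ⟨⟨0, by omega⟩⟩
  set ν : Measure (Metric.sphere (0 : Space n) 1) := μHE[n - 1] with hν
  have hνu : ν Set.univ = (μHE[n - 1] : Measure (Space n)) (Metric.sphere 0 1) := by
    rw [hν, ← isometry_subtype_coe.euclideanHausdorffMeasure_image, Set.image_univ,
      Subtype.range_coe]
  have : IsFiniteMeasure ν := ⟨by rw [hνu]; exact hausdorffMeasure_unitSphere_lt_top (by omega)⟩
  have hν0 : ν Set.univ ≠ 0 := by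
    rw [hνu]; exact hausdorffMeasure_unitSphere_ne_zero (by omega)
  have hτ0 : sphereMeasure n ≠ 0 := Measure.toSphere_ne_zero _
  have heq := uniformlyDistributed_eq_smul (sphereMeasure n) ν hτ0
    (fun x y r => sphereMeasure_ball n x y r) (fun x y r => hausdorffMeasure_sphere_ball x y r)
  set κ := ν.real Set.univ / (sphereMeasure n).real Set.univ with hκ
  have hκ0 : 0 < κ := by
    apply div_pos
    · exact ENNReal.toReal_pos hν0 (measure_ne_top _ _)
    · exact ENNReal.toReal_pos (Measure.measure_univ_ne_zero.2 hτ0) (measure_ne_top _ _)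
  refine ⟨κ, hκ0, fun x₀ r hr => ?_⟩
  have hmeas : Measurable (fun θ : Metric.sphere (0 : Space n) 1 => x₀ + r • (θ : Space n)) := by
    fun_prop
  ext s hs
  rw [Measure.restrict_apply hs, Measure.smul_apply, Measure.map_apply hmeas hs]
  -- Written as a homothety of a translate of a subset of the unit sphere, the set has its Hausdorff
  -- measure scaled by exactly `r ^ (n - 1)`.
  have himg : s ∩ Metric.sphere x₀ r = AffineMap.homothety x₀ r ''
      ((fun y => x₀ + y) '' (Subtype.val ''
        ((fun θ : Metric.sphere (0 : Space n) 1 => x₀ + r • (θ : Space n)) ⁻¹' s))) := by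
    ext z
    simp only [Set.mem_inter_iff, mem_sphere_iff_norm, Set.mem_image, Set.mem_preimage,
      Subtype.exists, exists_and_right, exists_eq_right, exists_exists_and_eq_and,
      AffineMap.homothety_apply, vsub_eq_sub, vadd_eq_add, add_sub_cancel_left]
    constructor
    · rintro ⟨hz, hzr⟩
      have e : r • r⁻¹ • (z - x₀) = z - x₀ := by rw [smul_smul, mul_inv_cancel₀ hr.ne', one_smul]
      refine ⟨r⁻¹ • (z - x₀), ⟨?_, ?_⟩, ?_⟩
      · rw [sub_zero, norm_smul, hzr, Real.norm_eq_abs, abs_of_pos (by positivity),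
          inv_mul_cancel₀ hr.ne']
      · rw [e]; simpa using hz
      · rw [e]; simp
    · rintro ⟨w, ⟨hw, hws⟩, rfl⟩
      rw [sub_zero] at hw
      refine ⟨by rwa [add_comm], ?_⟩
      rw [add_sub_cancel_right, norm_smul, hw, Real.norm_eq_abs, abs_of_pos hr, mul_one]
  rw [himg, euclideanHausdorffMeasure_homothety_image _ _ hr.ne',
    (isometry_add_left x₀).euclideanHausdorffMeasure_image,
    isometry_subtype_coe.euclideanHausdorffMeasure_image, ← hν, heq, Measure.smul_apply,
    ENNReal.smul_def, smul_eq_mul, smul_eq_mul, smul_eq_mul, ← mul_assoc]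
  congr 1
  rw [mul_comm κ, ENNReal.ofReal_mul (by positivity)]
  congr 1
  rw [ENNReal.ofReal_pow hr.le, ENNReal.coe_pow]
  congr 1
  rw [ENNReal.ofReal, ENNReal.coe_inj, ← NNReal.coe_inj, coe_nnnorm, Real.norm_eq_abs,
    abs_of_pos hr, Real.coe_toNNReal r hr.le]

/-! ### Annuli: topology, polar coordinates and surface measure -/

theorem isOpen_annulus {n : ℕ} (x₀ : Space n) (a b : ℝ) : IsOpen (annulus x₀ a b) :=
  (isOpen_lt (continuous_const (y := a)) (by fun_prop : Continuous fun x : Space n => ‖x - x₀‖)).inter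
    (isOpen_lt (by fun_prop) (continuous_const (y := b)))

theorem closure_annulus {n : ℕ} (x₀ : Space n) {a b : ℝ} (ha : 0 < a) (hab : a < b) :
    closure (annulus x₀ a b) = {x | a ≤ ‖x - x₀‖ ∧ ‖x - x₀‖ ≤ b} := by
  apply Set.Subset.antisymm
  · refine closure_minimal (fun x hx => ⟨hx.1.le, hx.2.le⟩) ?_
    exact (isClosed_le (continuous_const (y := a))
      (by fun_prop : Continuous fun x : Space n => ‖x - x₀‖)).inter
      (isClosed_le (by fun_prop) (continuous_const (y := b)))
  · rintro x ⟨h1, h2⟩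
    have hy : 0 < ‖x - x₀‖ := ha.trans_le h1
    -- A boundary point is approached along its own ray, moving its radius towards the middle
    -- radius.
    set c := (a + b) / 2 with hc
    have hlim : Tendsto (fun t : ℝ => x₀ + ((1 - t) + t * (c / ‖x - x₀‖)) • (x - x₀)) (𝓝[>] 0)
        (𝓝 x) := by
      have : ContinuousAt (fun t : ℝ => x₀ + ((1 - t) + t * (c / ‖x - x₀‖)) • (x - x₀)) 0 := by
        fun_prop
      have h := this.tendsto.mono_left (nhdsWithin_le_nhds (s := Set.Ioi 0))
      simpa using h
    refine mem_closure_of_tendsto hlim ?_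
    have h01 : Set.Ioo (0 : ℝ) 1 ∈ 𝓝[>] (0 : ℝ) := Ioo_mem_nhdsGT one_pos
    filter_upwards [h01] with t ht
    have hnn : 0 ≤ (1 - t) + t * (c / ‖x - x₀‖) := by
      have : 0 ≤ c / ‖x - x₀‖ := by apply div_nonneg <;> linarith
      nlinarith [ht.1, ht.2]
    have hnorm : ‖x₀ + ((1 - t) + t * (c / ‖x - x₀‖)) • (x - x₀) - x₀‖ =
        (1 - t) * ‖x - x₀‖ + t * c := by
      rw [add_sub_cancel_left, norm_smul, Real.norm_eq_abs, abs_of_nonneg hnn]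
      field_simp
    constructor
    · rw [hnorm]; nlinarith [ht.1, ht.2]
    · rw [hnorm]; nlinarith [ht.1, ht.2]

theorem frontier_annulus {n : ℕ} (x₀ : Space n) {a b : ℝ} (ha : 0 < a) (hab : a < b) :
    frontier (annulus x₀ a b) = Metric.sphere x₀ a ∪ Metric.sphere x₀ b := by
  rw [(isOpen_annulus x₀ a b).frontier_eq, closure_annulus x₀ ha hab]
  ext x
  simp only [annulus, Set.mem_sdiff, Set.mem_ofPred_eq, not_and, not_lt, Set.mem_union,
    mem_sphere_iff_norm]
  constructor
  · rintro ⟨⟨h1, h2⟩, h3⟩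
    rcases h1.eq_or_lt with h | h
    · exact Or.inl h.symm
    · exact Or.inr (le_antisymm h2 (h3 h))
  · rintro (h | h)
    · rw [h]; exact ⟨⟨le_rfl, hab.le⟩, fun h => absurd h (lt_irrefl _)⟩
    · rw [h]; exact ⟨⟨hab.le, le_rfl⟩, fun _ => le_rfl⟩

theorem annulus_subset_closedBall {n : ℕ} (x₀ : Space n) (a b : ℝ) :
    annulus x₀ a b ⊆ Metric.closedBall x₀ b := fun _ hx =>
  mem_closedBall_iff_norm.2 hx.2.le

theorem volume_annulus_lt_top {n : ℕ} (x₀ : Space n) (a b : ℝ) :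
    volume (annulus x₀ a b) < ⊤ :=
  (measure_mono (annulus_subset_closedBall x₀ a b)).trans_lt measure_closedBall_lt_top

theorem isCompact_closure_annulus {n : ℕ} (x₀ : Space n) (a b : ℝ) :
    IsCompact (closure (annulus x₀ a b)) :=
  (isCompact_closedBall x₀ b).of_isClosed_subset isClosed_closure
    (closure_minimal (annulus_subset_closedBall x₀ a b) Metric.isClosed_closedBall)

theorem integrableOn_annulus {n : ℕ} {x₀ : Space n} {a b : ℝ} {F : Type*} [NormedAddCommGroup F]
    {f : Space n → F} (hf : ContinuousOn f (closure (annulus x₀ a b))) :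
    IntegrableOn f (annulus x₀ a b) :=
  (hf.integrableOn_compact (isCompact_closure_annulus x₀ a b)).mono_set subset_closure

theorem norm_smul_sphere {n : ℕ} {r : ℝ} (hr : 0 ≤ r) (θ : Metric.sphere (0 : Space n) 1) :
    ‖r • (θ : Space n)‖ = r := by
  rw [norm_smul, Real.norm_eq_abs, abs_of_nonneg hr]; simp

theorem add_smul_mem_annulus {n : ℕ} (x₀ : Space n) {a b r : ℝ} (ha : 0 < a)
    (hr : r ∈ Set.Ioo a b) (θ : Metric.sphere (0 : Space n) 1) :
    x₀ + r • (θ : Space n) ∈ annulus x₀ a b := by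
  simp only [annulus, Set.mem_ofPred_eq, add_sub_cancel_left,
    norm_smul_sphere (ha.trans hr.1).le]
  exact hr

theorem add_smul_mem_closure_annulus {n : ℕ} (x₀ : Space n) {a b r : ℝ} (ha : 0 < a) (hab : a < b)
    (hr : r ∈ Set.Icc a b) (θ : Metric.sphere (0 : Space n) 1) :
    x₀ + r • (θ : Space n) ∈ closure (annulus x₀ a b) := by
  rw [closure_annulus x₀ ha hab]
  simp only [Set.mem_ofPred_eq, add_sub_cancel_left, norm_smul_sphere (ha.le.trans hr.1)]
  exact hr

/-- Integration in polar coordinates over an annulus. -/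
theorem setIntegral_annulus {n : ℕ} (hn : 1 ≤ n) (x₀ : Space n) {a b : ℝ} (ha : 0 < a)
    (f : Space n → ℝ) :
    ∫ x in annulus x₀ a b, f x = ∫ p : Metric.sphere (0 : Space n) 1 × ℝ,
      p.2 ^ (n - 1) * f (x₀ + p.2 • (p.1 : Space n))
        ∂((sphereMeasure n).prod (volume.restrict (Set.Ioo a b))) := by
  have : Nonempty (Fin n) := ⟨⟨0, hn⟩⟩
  have : SigmaFinite ((volume : Measure ℝ).comap (Subtype.val : Set.Ioi (0 : ℝ) → ℝ)) :=
    SigmaFinite.of_map _ measurable_subtype_coe.aemeasurable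
      (by rw [map_comap_subtype_coe measurableSet_Ioi]; infer_instance)
  set g : Space n → ℝ := (annulus x₀ a b).indicator f with hg
  have hpol := (volume : Measure (Space n)).measurePreserving_homeomorphUnitSphereProd.integral_comp
    (Homeomorph.measurableEmbedding _)
    (fun p : Metric.sphere (0 : Space n) 1 × Set.Ioi (0 : ℝ) => g (x₀ + (p.2 : ℝ) • (p.1 : Space n)))
  have hleft : ∫ x in annulus x₀ a b, f x =
      ∫ x : ({0}ᶜ : Set (Space n)), g (x₀ + ((homeomorphUnitSphereProd (Space n) x).2 : ℝ) •
        ((homeomorphUnitSphereProd (Space n) x).1 : Space n)) 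
          ∂((volume : Measure (Space n)).comap (Subtype.val : ({0}ᶜ : Set (Space n)) → Space n)) := by
    have : ∀ x : ({0}ᶜ : Set (Space n)), g (x₀ + ((homeomorphUnitSphereProd (Space n) x).2 : ℝ) •
        ((homeomorphUnitSphereProd (Space n) x).1 : Space n)) = g (x₀ + x) := by
      intro x
      have h0 : ‖(x : Space n)‖ ≠ 0 := norm_ne_zero_iff.2 x.2
      simp [smul_smul, h0]
    simp_rw [this]
    rw [integral_subtype_comap (measurableSet_singleton _).compl fun x => g (x₀ + x),
      restrict_compl_singleton, integral_add_left_eq_self,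
      integral_indicator (isOpen_annulus x₀ a b).measurableSet]
  rw [hleft, hpol, finrank_euclideanSpace_fin, Measure.volumeIoiPow]
  -- Exposes the density as a coercion from `NNReal`, the form in which it can be moved into the
  -- integrand.
  simp only [ENNReal.ofReal]
  rw [prod_withDensity_right (by fun_prop), integral_withDensity_eq_integral_smul (by fun_prop)]
  have hemb : MeasurableEmbedding (Prod.map id Subtype.val :
      Metric.sphere (0 : Space n) 1 × Set.Ioi (0 : ℝ) → Metric.sphere (0 : Space n) 1 × ℝ) :=
    MeasurableEmbedding.id.prodMap (MeasurableEmbedding.subtype_coe measurableSet_Ioi)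
  have hmap : ((sphereMeasure n).prod ((volume : Measure ℝ).comap (Subtype.val : Set.Ioi (0:ℝ) → ℝ))).map
      (Prod.map id Subtype.val) = (sphereMeasure n).prod (volume.restrict (Set.Ioi 0)) := by
    rw [← Measure.map_prod_map _ _ measurable_id measurable_subtype_coe, Measure.map_id,
      map_comap_subtype_coe measurableSet_Ioi]
  have hind : ∀ p : Metric.sphere (0 : Space n) 1 × Set.Ioi (0 : ℝ),
      ((p.2 : ℝ) ^ (n - 1)).toNNReal • g (x₀ + (p.2 : ℝ) • (p.1 : Space n)) =
      (Set.indicator (Set.univ ×ˢ Set.Ioo a b) fun p : Metric.sphere (0 : Space n) 1 × ℝ =>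
        p.2 ^ (n - 1) * f (x₀ + p.2 • (p.1 : Space n))) (Prod.map id Subtype.val p) := by
    rintro ⟨θ, r, hr⟩
    have hr' : (0 : ℝ) < r := hr
    have hmem : x₀ + r • (θ : Space n) ∈ annulus x₀ a b ↔ r ∈ Set.Ioo a b := by
      simp only [annulus, Set.mem_ofPred_eq, add_sub_cancel_left,
        norm_smul_sphere hr'.le, Set.mem_Ioo]
    rw [NNReal.smul_def, Real.coe_toNNReal _ (by positivity), smul_eq_mul]
    by_cases h : r ∈ Set.Ioo a b
    · have h' := hmem.2 h
      simp [hg, Set.indicator, h', h.1, h.2]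
    · have h' := mt hmem.1 h
      have h'' : ¬ (a < r ∧ r < b) := h
      simp [hg, Set.indicator, h', h'']
  simp_rw [hind]
  rw [← hemb.integral_map, hmap, integral_indicator (MeasurableSet.univ.prod measurableSet_Ioo),
    ← Measure.prod_restrict, Measure.restrict_univ, Measure.restrict_restrict measurableSet_Ioo,
    Set.inter_eq_left.2 (fun r (hr : r ∈ Set.Ioo a b) => Set.mem_Ioi.2 (ha.trans hr.1))]

theorem isFiniteMeasure_surfaceMeasure_annulus {n : ℕ} (hn : 2 ≤ n) (x₀ : Space n) {a b : ℝ}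
    (ha : 0 < a) (hab : a < b) : IsFiniteMeasure (surfaceMeasure (annulus x₀ a b)) := by
  obtain ⟨κ, hκ, h⟩ := exists_hausdorffMeasure_restrict_sphere hn
  have hs : ∀ r, 0 < r → (μHE[n - 1] : Measure (Space n)) (Metric.sphere x₀ r) < ⊤ := by
    intro r hr
    rw [← Measure.restrict_apply_univ, h x₀ r hr, Measure.smul_apply, smul_eq_mul]
    have hmeas : Measurable (fun θ : Metric.sphere (0 : Space n) 1 => x₀ + r • (θ : Space n)) := by
      fun_prop
    rw [Measure.map_apply hmeas MeasurableSet.univ]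
    exact ENNReal.mul_lt_top ENNReal.ofReal_lt_top (measure_lt_top _ _)
  constructor
  rw [surfaceMeasure, Measure.restrict_apply_univ, frontier_annulus x₀ ha hab]
  exact (measure_union_le _ _).trans_lt
    (ENNReal.add_lt_top.2 ⟨hs a ha, hs b (ha.trans hab)⟩)

/-- The same `κ` serves both spheres and all annuli, so a vanishing surface mean is equivalent to a
vanishing polar bracket. -/
theorem exists_integral_surfaceMeasure_annulus {n : ℕ} (hn : 2 ≤ n) :
    ∃ κ : ℝ, 0 < κ ∧ ∀ (x₀ : Space n) (a b : ℝ), 0 < a → a < b → ∀ f : Space n → ℝ,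
      ContinuousOn f (closure (annulus x₀ a b)) →
      ∫ x, f x ∂(surfaceMeasure (annulus x₀ a b)) =
        κ * (a ^ (n - 1) * ∫ θ, f (x₀ + a • (θ : Space n)) ∂(sphereMeasure n) +
          b ^ (n - 1) * ∫ θ, f (x₀ + b • (θ : Space n)) ∂(sphereMeasure n)) := by
  obtain ⟨κ, hκ, h⟩ := exists_hausdorffMeasure_restrict_sphere hn
  refine ⟨κ, hκ, fun x₀ a b ha hab f hf => ?_⟩
  have hcont : ∀ r ∈ Set.Icc a b, Continuous
      (fun θ : Metric.sphere (0 : Space n) 1 => f (x₀ + r • (θ : Space n))) := fun r hr =>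
    hf.comp_continuous (by fun_prop) (add_smul_mem_closure_annulus x₀ ha hab hr)
  have hemb : ∀ r : ℝ, 0 < r → MeasurableEmbedding
      (fun θ : Metric.sphere (0 : Space n) 1 => x₀ + r • (θ : Space n)) := fun r hr =>
    ((Homeomorph.addLeft x₀).measurableEmbedding.comp
      (Homeomorph.smulOfNeZero (G₀ := ℝ) (α := Space n) r hr.ne').measurableEmbedding).comp
      (MeasurableEmbedding.subtype_coe (Metric.isClosed_sphere.measurableSet))
  have hint : ∀ r ∈ Set.Icc a b, Integrable f
      ((μHE[n - 1] : Measure (Space n)).restrict (Metric.sphere x₀ r)) := by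
    intro r hr
    have hr0 := ha.trans_le hr.1
    rw [h x₀ r hr0]
    refine Integrable.smul_measure ?_ ENNReal.ofReal_ne_top
    rw [(hemb r hr0).integrable_map_iff]
    exact (hcont r hr).integrable_of_hasCompactSupport (HasCompactSupport.of_compactSpace _)
  have hval : ∀ r ∈ Set.Icc a b, ∫ x, f x ∂((μHE[n - 1] : Measure (Space n)).restrict
      (Metric.sphere x₀ r)) = κ * (r ^ (n - 1) *
        ∫ θ, f (x₀ + r • (θ : Space n)) ∂(sphereMeasure n)) := by
    intro r hr
    have hr0 := ha.trans_le hr.1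
    rw [h x₀ r hr0, integral_smul_measure, (hemb r hr0).integral_map,
      ENNReal.toReal_ofReal (by positivity), smul_eq_mul, mul_assoc]
  have hdisj : Disjoint (Metric.sphere x₀ a) (Metric.sphere x₀ b) := by
    rw [Set.disjoint_left]
    intro x hx hx'
    exact hab.ne (hx.symm.trans hx')
  rw [surfaceMeasure, frontier_annulus x₀ ha hab,
    Measure.restrict_union hdisj Metric.isClosed_sphere.measurableSet,
    integral_add_measure (hint a ⟨le_rfl, hab.le⟩) (hint b ⟨hab.le, le_rfl⟩),
    hval a ⟨le_rfl, hab.le⟩, hval b ⟨hab.le, le_rfl⟩]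
  ring

/-! ### Radial functions -/

/-- The norm is smooth away from the centre, and near the centre the function vanishes identically.
-/
theorem contDiff_radial {n : ℕ} (x₀ : Space n) {ρ : ℝ → ℝ} (hρ : ContDiff ℝ ∞ ρ)
    (hsupp : (0 : ℝ) ∉ tsupport ρ) : ContDiff ℝ ∞ (fun x : Space n => ρ ‖x - x₀‖) := by
  rw [contDiff_iff_contDiffAt]
  intro x
  by_cases hx : x = x₀
  · have hev : ∀ᶠ r in 𝓝 (0 : ℝ), ρ r = 0 := notMem_tsupport_iff_eventuallyEq.1 hsupp
    have hlim : Tendsto (fun x : Space n => ‖x - x₀‖) (𝓝 x) (𝓝 0) := by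
      have : Continuous (fun x : Space n => ‖x - x₀‖) := by fun_prop
      simpa [hx] using this.tendsto x
    exact contDiffAt_const.congr_of_eventuallyEq (hlim.eventually hev)
  · exact hρ.contDiffAt.comp x ((contDiffAt_id.sub contDiffAt_const).norm ℝ (sub_ne_zero.2 hx))

theorem tsupport_radial_subset {n : ℕ} (x₀ : Space n) (ρ : ℝ → ℝ) :
    tsupport (fun x : Space n => ρ ‖x - x₀‖) ⊆ (fun x => ‖x - x₀‖) ⁻¹' tsupport ρ := by
  refine closure_minimal (fun x hx => subset_tsupport ρ hx) ?_
  exact (isClosed_tsupport ρ).preimage (by fun_prop)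

theorem hasCompactSupport_radial {n : ℕ} (x₀ : Space n) {ρ : ℝ → ℝ} (hρ : HasCompactSupport ρ) :
    HasCompactSupport (fun x : Space n => ρ ‖x - x₀‖) := by
  obtain ⟨R, hR⟩ := hρ.isCompact.isBounded.subset_closedBall 0
  refine HasCompactSupport.of_support_subset_isCompact (isCompact_closedBall x₀ R) fun x hx => ?_
  have := hR (subset_tsupport ρ hx)
  rw [mem_closedBall_zero_iff, Real.norm_eq_abs, abs_of_nonneg (norm_nonneg _)] at this
  exact mem_closedBall_iff_norm.2 this

theorem hasGradientAt_norm_sub {n : ℕ} {x₀ x : Space n} (hx : x ≠ x₀) :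
    HasGradientAt (fun x : Space n => ‖x - x₀‖) (‖x - x₀‖⁻¹ • (x - x₀)) x := by
  have h0 : ‖x - x₀‖ ≠ 0 := norm_ne_zero_iff.2 (sub_ne_zero.2 hx)
  have h1 : HasFDerivAt (fun x : Space n => ‖x - x₀‖ ^ 2) (2 • innerSL ℝ (x - x₀)) x := by
    simpa using ((hasFDerivAt_id x).sub_const x₀).norm_sq
  have h2 := h1.sqrt (pow_ne_zero 2 h0)
  rw [hasGradientAt_iff_hasFDerivAt]
  simp only [Real.sqrt_sq (norm_nonneg _)] at h2
  refine h2.congr_fderiv ?_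
  ext v
  simp only [InnerProductSpace.toDual_apply_apply, inner_smul_left, smul_apply,
    innerSL_apply_apply, smul_eq_mul, nsmul_eq_mul, conj_trivial]
  field_simp
  simp

theorem hasGradientAt_radial {n : ℕ} {x₀ x : Space n} (hx : x ≠ x₀) {ρ : ℝ → ℝ} {d : ℝ}
    (hρ : HasDerivAt ρ d ‖x - x₀‖) :
    HasGradientAt (fun x : Space n => ρ ‖x - x₀‖) ((d / ‖x - x₀‖) • (x - x₀)) x := by
  have h := hρ.comp_hasFDerivAt x (hasGradientAt_norm_sub hx).hasFDerivAt
  rw [hasGradientAt_iff_hasFDerivAt]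
  refine h.congr_fderiv ?_
  ext v
  simp only [InnerProductSpace.toDual_apply_apply, inner_smul_left, smul_apply,
    smul_eq_mul, conj_trivial]
  ring

/-! ### The radial profile of the minimiser -/

/-- The constant `K` such that `r ↦ (K / r ^ (n - 1) - r) / n` takes opposite values at the two
boundary radii. -/
def slopeConst (n : ℕ) (a b : ℝ) : ℝ := (a + b) / ((a ^ (n - 1))⁻¹ + (b ^ (n - 1))⁻¹)

/-- The radial derivative of the minimiser on the annulus. -/
def slope (n : ℕ) (a b r : ℝ) : ℝ := (slopeConst n a b / r ^ (n - 1) - r) / n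

/-- The gradient of the minimiser on the annulus. -/
def slopeField (n : ℕ) (x₀ : Space n) (a b : ℝ) (x : Space n) : Space n :=
  (slope n a b ‖x - x₀‖ / ‖x - x₀‖) • (x - x₀)

theorem slopeConst_mul_add {n : ℕ} {a b : ℝ} (ha : 0 < a) (hab : a < b) :
    slopeConst n a b * ((a ^ (n - 1))⁻¹ + (b ^ (n - 1))⁻¹) = a + b := by
  have hb := ha.trans hab
  have h : (0 : ℝ) < (a ^ (n - 1))⁻¹ + (b ^ (n - 1))⁻¹ := by positivity
  exact div_mul_cancel₀ _ h.ne'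

/-- The outward normal points inwards along the ray at radius `a`, so opposite slopes mean equal
normal derivatives. This is the condition that fixes `slopeConst`. -/
theorem slope_left (n : ℕ) {a b : ℝ} (ha : 0 < a) (hab : a < b) :
    slope n a b a = -slope n a b b := by
  have hK := slopeConst_mul_add (n := n) ha hab
  simp only [slope, div_eq_mul_inv]
  linear_combination (n : ℝ)⁻¹ * hK

theorem slope_right_neg {n : ℕ} (hn : 1 ≤ n) {a b : ℝ} (ha : 0 < a) (hab : a < b) :
    slope n a b b < 0 := by
  have hb := ha.trans hab
  have hn' : (0 : ℝ) < n := by exact_mod_cast hn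
  have hA : 0 < a ^ (n - 1) := by positivity
  have hB : 0 < b ^ (n - 1) := by positivity
  have hAB : a ^ (n - 1) ≤ b ^ (n - 1) := pow_le_pow_left₀ ha.le hab.le _
  rw [slope]
  apply div_neg_of_neg_of_pos _ hn'
  rw [sub_neg, slopeConst, div_div, div_lt_iff₀ (by positivity), add_mul,
    inv_mul_cancel₀ hB.ne']
  have h1 : 1 ≤ (a ^ (n - 1))⁻¹ * b ^ (n - 1) := by
    rw [inv_mul_eq_div, le_div_iff₀ hA]; linarith
  nlinarith

/-- The flux through the sphere of radius `r`, up to a constant, has derivative `-r ^ (n - 1)`: the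
radial field has divergence `-1`. -/
theorem pow_mul_slope {n : ℕ} (hn : 1 ≤ n) (a b : ℝ) {r : ℝ} (hr : 0 < r) :
    r ^ (n - 1) * slope n a b r = (slopeConst n a b - r ^ n) / n := by
  obtain ⟨m, rfl⟩ : ∃ m, n = m + 1 := ⟨n - 1, by omega⟩
  simp only [slope, Nat.add_sub_cancel]
  field_simp
  ring

theorem contDiffOn_slope (n : ℕ) (a b : ℝ) : ContDiffOn ℝ ∞ (slope n a b) (Set.Ioi 0) := by
  unfold slope
  refine ContDiffOn.div_const (ContDiffOn.sub (contDiffOn_const.div (by fun_prop) ?_)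
    contDiffOn_id) _
  intro r hr
  exact pow_ne_zero _ (ne_of_gt hr)

theorem norm_slopeField {n : ℕ} {x₀ x : Space n} (a b : ℝ) (hx : x ≠ x₀) :
    ‖slopeField n x₀ a b x‖ = |slope n a b ‖x - x₀‖| := by
  have h0 : 0 < ‖x - x₀‖ := norm_pos_iff.2 (sub_ne_zero.2 hx)
  rw [slopeField, norm_smul, Real.norm_eq_abs, abs_div, abs_of_pos h0, div_mul_cancel₀ _ h0.ne']

theorem continuousOn_slopeField {n : ℕ} (x₀ : Space n) {a b : ℝ} (ha : 0 < a) (hab : a < b) :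
    ContinuousOn (slopeField n x₀ a b) (closure (annulus x₀ a b)) := by
  have hmaps : Set.MapsTo (fun x : Space n => ‖x - x₀‖) (closure (annulus x₀ a b)) (Set.Ioi 0) := by
    rw [closure_annulus x₀ ha hab]
    exact fun x hx => ha.trans_le hx.1
  unfold slopeField
  refine ContinuousOn.smul (ContinuousOn.div
    ((contDiffOn_slope n a b).continuousOn.comp (by fun_prop) hmaps) (by fun_prop) ?_) (by fun_prop)
  intro x hx
  exact ne_of_gt (hmaps hx)

/-- A primitive of the slope, cut off away from `[a, b]`. The cut-off makes the radial extension a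
test function on the whole space, so it can serve as its own approximating sequence in the
definition of trace. -/
theorem exists_profile {n : ℕ} {a b : ℝ} (ha : 0 < a) (hab : a < b) :
    ∃ ρ : ℝ → ℝ, ContDiff ℝ ∞ ρ ∧ HasCompactSupport ρ ∧ (0 : ℝ) ∉ tsupport ρ ∧
      (∀ r ∈ Set.Icc a b, HasDerivAt ρ (slope n a b r) r) ∧
      a ^ (n - 1) * ρ a + b ^ (n - 1) * ρ b = 0 := by
  have hb := ha.trans hab
  set w : ℝ → ℝ := fun r => ∫ s in a..r, slope n a b s with hw
  -- The additive constant that makes the boundary mean vanish; `w a = 0` by the choice of base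
  -- point.
  set C : ℝ := -(b ^ (n - 1) * w b) / (a ^ (n - 1) + b ^ (n - 1)) with hC
  have hwd : ∀ r ∈ Set.Ioi (0 : ℝ), HasDerivAt w (slope n a b r) r := by
    intro r hr
    have hsub : Set.uIcc a r ⊆ Set.Ioi 0 := fun s hs =>
      (lt_min ha hr).trans_le hs.1
    refine intervalIntegral.integral_hasDerivAt_right
      (((contDiffOn_slope n a b).continuousOn.mono hsub).intervalIntegrable)
      ((contDiffOn_slope n a b).continuousOn.stronglyMeasurableAtFilter isOpen_Ioi r hr)
      ((contDiffOn_slope n a b).continuousOn.continuousAt (isOpen_Ioi.mem_nhds hr))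
  have hwc : ContDiffOn ℝ ∞ w (Set.Ioi 0) := by
    rw [contDiffOn_infty_iff_deriv_of_isOpen isOpen_Ioi]
    refine ⟨fun r hr => (hwd r hr).differentiableAt.differentiableWithinAt, ?_⟩
    exact (contDiffOn_slope n a b).congr fun r hr => (hwd r hr).deriv
  -- The bump is 1 on `[2a/3, b + a/3]`, a neighbourhood of `[a, b]`, and its support starts at `a/3
  -- > 0`.
  let ζ : ContDiffBump ((a + b) / 2) :=
    ⟨(b - a) / 2 + a / 3, (b - a) / 2 + 2 * a / 3, by linarith, by linarith⟩
  have hζsupp : tsupport ζ ⊆ Set.Ioi 0 := by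
    rw [ζ.tsupport_eq]
    intro r hr
    rw [Real.closedBall_eq_Icc] at hr
    have := hr.1
    simp only [ζ] at this
    exact lt_of_lt_of_le (by linarith) this
  have hsub : tsupport (fun r => ζ r * (C + w r)) ⊆ tsupport ζ := tsupport_mul_subset_left
  refine ⟨fun r => ζ r * (C + w r), ?_, ?_,
    fun h => lt_irrefl (0 : ℝ) (hζsupp (hsub h)), ?_, ?_⟩
  · rw [contDiff_iff_contDiffAt]
    intro r
    by_cases hr : r ∉ tsupport (fun r => ζ r * (C + w r))
    · exact contDiffAt_const.congr_of_eventuallyEq (notMem_tsupport_iff_eventuallyEq.1 hr)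
    have hr0 := hζsupp (hsub (not_not.1 hr))
    exact ζ.contDiff.contDiffAt.mul (contDiffAt_const.add (hwc.contDiffAt (isOpen_Ioi.mem_nhds hr0)))
  · exact ζ.hasCompactSupport.mul_right
  · intro r hr
    have hone : (fun r => ζ r * (C + w r)) =ᶠ[𝓝 r] fun r => C + w r := by
      have : Metric.ball ((a + b) / 2) ((b - a) / 2 + a / 3) ∈ 𝓝 r := by
        refine Metric.isOpen_ball.mem_nhds ?_
        rw [Real.ball_eq_Ioo]
        exact ⟨by linarith [hr.1], by linarith [hr.2]⟩
      filter_upwards [this] with s hs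
      rw [ζ.one_of_mem_closedBall (Metric.ball_subset_closedBall hs), one_mul]
    exact ((hwd r (ha.trans_le hr.1)).const_add C).congr_of_eventuallyEq hone
  · have h1 : ζ a = 1 := ζ.one_of_mem_closedBall (by
      rw [Real.closedBall_eq_Icc]; simp only [ζ]; constructor <;> linarith)
    have h2 : ζ b = 1 := ζ.one_of_mem_closedBall (by
      rw [Real.closedBall_eq_Icc]; simp only [ζ]; constructor <;> linarith)
    have hwa : w a = 0 := by simp [hw]
    have hden : a ^ (n - 1) + b ^ (n - 1) ≠ 0 := by positivity
    have : C * (a ^ (n - 1) + b ^ (n - 1)) = -(b ^ (n - 1) * w b) := div_mul_cancel₀ _ hden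
    simp only [h1, h2, hwa]
    linarith

/-! ### Green's formula on the annulus -/

theorem integrable_polar {n : ℕ} {x₀ : Space n} {a b : ℝ} (ha : 0 < a) (hab : a < b)
    {f : Space n → ℝ} (hf : ContinuousOn f (closure (annulus x₀ a b))) :
    Integrable (fun p : Metric.sphere (0 : Space n) 1 × ℝ =>
      p.2 ^ (n - 1) * f (x₀ + p.2 • (p.1 : Space n)))
        ((sphereMeasure n).prod (volume.restrict (Set.Ioo a b))) := by
  have hc : ContinuousOn (fun p : Metric.sphere (0 : Space n) 1 × ℝ =>
      p.2 ^ (n - 1) * f (x₀ + p.2 • (p.1 : Space n))) (Set.univ ×ˢ Set.Icc a b) := by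
    refine ContinuousOn.mul (by fun_prop) (hf.comp (by fun_prop) ?_)
    exact fun p hp => add_smul_mem_closure_annulus x₀ ha hab hp.2 p.1
  have hi : IntegrableOn (fun p : Metric.sphere (0 : Space n) 1 × ℝ =>
      p.2 ^ (n - 1) * f (x₀ + p.2 • (p.1 : Space n))) (Set.univ ×ˢ Set.Icc a b)
      ((sphereMeasure n).prod volume) :=
    hc.integrableOn_compact (isCompact_univ.prod isCompact_Icc)
  have := hi.mono_set (Set.prod_mono_right Set.Ioo_subset_Icc_self)
  rwa [IntegrableOn, ← Measure.prod_restrict, Measure.restrict_univ] at this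

theorem inner_gradient {n : ℕ} {φ : Space n → ℝ} {x : Space n} (v : Space n) :
    ⟪v, ∇ φ x⟫_ℝ = fderiv ℝ φ x v := by
  rw [← toDual_gradient, InnerProductSpace.toDual_apply_apply, real_inner_comm]

theorem continuous_gradient {n : ℕ} {φ : Space n → ℝ} (hφ : ContDiff ℝ 1 φ) :
    Continuous (∇ φ) :=
  (InnerProductSpace.toDual ℝ (Space n)).symm.continuous.comp (hφ.continuous_fderiv one_ne_zero)

/-- For a radial field the divergence theorem is the fundamental theorem of calculus on each ray: `r
^ (n - 1) (⟪V, ∇φ⟫ - φ)` is the derivative of `(K - r ^ n) / n` times `φ`. The endpoint terms share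
the factor `slope n a b b` by `slope_left`. -/
theorem green_slopeField {n : ℕ} (hn : 1 ≤ n) (x₀ : Space n) {a b : ℝ} (ha : 0 < a) (hab : a < b)
    {φ : Space n → ℝ} (hφ : ContDiff ℝ 1 φ) :
    ∫ x in annulus x₀ a b, ⟪slopeField n x₀ a b x, ∇ φ x⟫_ℝ =
      (∫ x in annulus x₀ a b, φ x) + slope n a b b *
        (a ^ (n - 1) * ∫ θ, φ (x₀ + a • (θ : Space n)) ∂(sphereMeasure n) +
          b ^ (n - 1) * ∫ θ, φ (x₀ + b • (θ : Space n)) ∂(sphereMeasure n)) := by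
  have hφc := hφ.continuous
  have hgc := continuous_gradient hφ
  have hVc : ContinuousOn (fun x => ⟪slopeField n x₀ a b x, ∇ φ x⟫_ℝ)
      (closure (annulus x₀ a b)) :=
    (continuousOn_slopeField x₀ ha hab).inner hgc.continuousOn
  have hVφ : ContinuousOn (fun x => ⟪slopeField n x₀ a b x, ∇ φ x⟫_ℝ - φ x)
      (closure (annulus x₀ a b)) := hVc.sub hφc.continuousOn
  have hsph : ∀ r : ℝ, Integrable (fun θ : Metric.sphere (0 : Space n) 1 =>
      φ (x₀ + r • (θ : Space n))) (sphereMeasure n) := fun r =>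
    (by fun_prop : Continuous fun θ : Metric.sphere (0 : Space n) 1 =>
      φ (x₀ + r • (θ : Space n))).integrable_of_hasCompactSupport
        (HasCompactSupport.of_compactSpace _)
  rw [← sub_eq_iff_eq_add', ← integral_sub (integrableOn_annulus hVc)
    (integrableOn_annulus hφc.continuousOn), setIntegral_annulus hn x₀ ha,
    integral_prod _ (integrable_polar ha hab hVφ)]
  have hin : ∀ θ : Metric.sphere (0 : Space n) 1, ∫ r in Set.Ioo a b, r ^ (n - 1) *
      (⟪slopeField n x₀ a b (x₀ + r • (θ : Space n)), ∇ φ (x₀ + r • (θ : Space n))⟫_ℝ -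
        φ (x₀ + r • (θ : Space n))) =
      (slope n a b b * b ^ (n - 1)) * φ (x₀ + b • (θ : Space n)) +
        (slope n a b b * a ^ (n - 1)) * φ (x₀ + a • (θ : Space n)) := by
    intro θ
    have hn0 : (n : ℝ) ≠ 0 := by positivity
    have hderiv : ∀ r ∈ Set.uIcc a b, HasDerivAt
        (fun r : ℝ => (slopeConst n a b - r ^ n) / n * φ (x₀ + r • (θ : Space n)))
        (r ^ (n - 1) * (⟪slopeField n x₀ a b (x₀ + r • (θ : Space n)),
          ∇ φ (x₀ + r • (θ : Space n))⟫_ℝ - φ (x₀ + r • (θ : Space n)))) r := by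
      intro r hr
      rw [Set.uIcc_of_le hab.le] at hr
      have hr0 := ha.trans_le hr.1
      have h1 : HasDerivAt (fun r : ℝ => x₀ + r • (θ : Space n)) (θ : Space n) r := by
        simpa using ((hasDerivAt_id r).smul_const (θ : Space n)).const_add x₀
      have h2 := ((hφ.differentiable one_ne_zero) (x₀ + r • (θ : Space n))).hasFDerivAt.comp_hasDerivAt
        r h1
      have h3 : HasDerivAt (fun r : ℝ => (slopeConst n a b - r ^ n) / n) (-r ^ (n - 1)) r := by
        have := ((hasDerivAt_pow n r).const_sub (slopeConst n a b)).div_const (n : ℝ)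
        exact this.congr_deriv (by field_simp)
      refine (h3.mul h2).congr_deriv ?_
      rw [inner_gradient, slopeField, add_sub_cancel_left, norm_smul_sphere hr0.le, smul_smul,
        div_mul_cancel₀ _ hr0.ne', map_smul, ← pow_mul_slope hn a b hr0, smul_eq_mul,
        Function.comp_apply]
      ring
    have hci : IntervalIntegrable (fun r : ℝ => r ^ (n - 1) *
        (⟪slopeField n x₀ a b (x₀ + r • (θ : Space n)), ∇ φ (x₀ + r • (θ : Space n))⟫_ℝ -
          φ (x₀ + r • (θ : Space n)))) volume a b := by
      apply ContinuousOn.intervalIntegrable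
      rw [Set.uIcc_of_le hab.le]
      refine ContinuousOn.mul (by fun_prop) (hVφ.comp (by fun_prop) ?_)
      exact fun r hr => add_smul_mem_closure_annulus x₀ ha hab hr θ
    rw [← integral_Ioc_eq_integral_Ioo, ← intervalIntegral.integral_of_le hab.le,
      intervalIntegral.integral_eq_sub_of_hasDerivAt hderiv hci, ← pow_mul_slope hn a b ha,
      ← pow_mul_slope hn a b (ha.trans hab), slope_left n ha hab]
    ring
  simp_rw [hin]
  rw [integral_add ((hsph b).const_mul _) ((hsph a).const_mul _), integral_const_mul,
    integral_const_mul]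
  ring

/-! ### The value of `T` on an annulus -/

theorem tendsto_integral_of_tendsto_eLpNorm_two {α : Type*} [MeasurableSpace α] {μ : Measure α}
    [IsFiniteMeasure μ] {f : ℕ → α → ℝ} {g : α → ℝ} (hf : ∀ k, MemLp (f k) 2 μ)
    (hg : MemLp g 2 μ) (h : Tendsto (fun k => eLpNorm (fun x => f k x - g x) 2 μ) atTop (𝓝 0)) :
    Tendsto (fun k => ∫ x, f k x ∂μ) atTop (𝓝 (∫ x, g x ∂μ)) := by
  refine tendsto_integral_of_L1' g hg.aestronglyMeasurable
    (Eventually.of_forall fun k => (hf k).integrable one_le_two) ?_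
  have hlim : Tendsto (fun k => eLpNorm (fun x => f k x - g x) 2 μ *
      μ Set.univ ^ (1 / (1 : ENNReal).toReal - 1 / (2 : ENNReal).toReal)) atTop (𝓝 0) := by
    have := ENNReal.Tendsto.mul_const (b := μ Set.univ ^
      (1 / (1 : ENNReal).toReal - 1 / (2 : ENNReal).toReal)) h
      (Or.inr (ENNReal.rpow_ne_top_of_nonneg (by norm_num) (measure_ne_top _ _)))
    simpa using this
  refine tendsto_of_tendsto_of_tendsto_of_le_of_le tendsto_const_nhds hlim (fun k => zero_le)
    fun k => ?_
  exact eLpNorm_le_eLpNorm_mul_rpow_measure_univ one_le_two ((hf k).sub hg).aestronglyMeasurable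

/-- A function in `H¹` of the annulus whose trace has mean zero satisfies the weak form of the
boundary value problem. -/
theorem integral_inner_slopeField {n : ℕ} (hn : 2 ≤ n) (x₀ : Space n) {a b : ℝ} (ha : 0 < a)
    (hab : a < b) {u : Space n → ℝ} {G : Space n → Space n} {g : Space n → ℝ}
    (hu : MemH1 (annulus x₀ a b) u G) (hg : IsTrace (annulus x₀ a b) u G g)
    (hg0 : ∫ x, g x ∂(surfaceMeasure (annulus x₀ a b)) = 0) :
    ∫ x in annulus x₀ a b, ⟪slopeField n x₀ a b x, G x⟫_ℝ = ∫ x in annulus x₀ a b, u x := by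
  obtain ⟨hgm, φ, hφ, hφs, hφu, hφG, hφg⟩ := hg
  obtain ⟨κ, hκ, hσ⟩ := exists_integral_surfaceMeasure_annulus hn
  have := isFiniteMeasure_surfaceMeasure_annulus hn x₀ ha hab
  have : IsFiniteMeasure ((volume : Measure (Space n)).restrict (annulus x₀ a b)) :=
    ⟨by rw [Measure.restrict_apply_univ]; exact volume_annulus_lt_top x₀ a b⟩
  have hmeas := (isOpen_annulus x₀ a b).measurableSet
  have hVc := continuousOn_slopeField x₀ ha hab
  obtain ⟨C, hC⟩ := (isCompact_closure_annulus x₀ a b).exists_bound_of_continuousOn hVc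
  have hVm : AEStronglyMeasurable (slopeField n x₀ a b) (volume.restrict (annulus x₀ a b)) :=
    (hVc.mono subset_closure).aestronglyMeasurable hmeas
  have hVb : ∀ᵐ x ∂((volume : Measure (Space n)).restrict (annulus x₀ a b)),
      ‖slopeField n x₀ a b x‖ ≤ C := by
    filter_upwards [ae_restrict_mem hmeas] with x hx using hC x (subset_closure hx)
  have hinner : ∀ W : Space n → Space n, MemLp W 2 (volume.restrict (annulus x₀ a b)) →
      MemLp (fun x => ⟪slopeField n x₀ a b x, W x⟫_ℝ) 2 (volume.restrict (annulus x₀ a b)) := by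
    intro W hW
    refine hW.of_le_mul (c := C) (hVm.inner hW.aestronglyMeasurable) ?_
    filter_upwards [hVb] with x hx
    exact (norm_inner_le_norm _ _).trans (by gcongr)
  have hφ1 : ∀ k, ContDiff ℝ 1 (φ k) := fun k => (hφ k).of_le (by exact_mod_cast le_top)
  have hgrad : ∀ k, MemLp (∇ (φ k)) 2 (volume.restrict (annulus x₀ a b)) := by
    intro k
    refine (continuous_gradient (hφ1 k)).memLp_of_hasCompactSupport ?_
    exact (hφs k).fderiv (𝕜 := ℝ) |>.comp_left (map_zero _)
  have hφm : ∀ k, MemLp (φ k) 2 (volume.restrict (annulus x₀ a b)) := fun k =>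
    (hφ1 k).continuous.memLp_of_hasCompactSupport (hφs k)
  have t1 := tendsto_integral_of_tendsto_eLpNorm_two hφm hu.memLp hφu
  have t2 := tendsto_integral_of_tendsto_eLpNorm_two
    (fun k => (hφ1 k).continuous.memLp_of_hasCompactSupport (hφs k)) hgm hφg
  have t3 : Tendsto (fun k => ∫ x in annulus x₀ a b, ⟪slopeField n x₀ a b x, ∇ (φ k) x⟫_ℝ) atTop
      (𝓝 (∫ x in annulus x₀ a b, ⟪slopeField n x₀ a b x, G x⟫_ℝ)) := by
    refine tendsto_integral_of_tendsto_eLpNorm_two (fun k => hinner _ (hgrad k))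
      (hinner _ hu.memLp_grad) ?_
    have hlim : Tendsto (fun k => ENNReal.ofReal C *
        eLpNorm (fun x => ∇ (φ k) x - G x) 2 (volume.restrict (annulus x₀ a b))) atTop (𝓝 0) := by
      simpa using ENNReal.Tendsto.const_mul hφG (Or.inr ENNReal.ofReal_ne_top)
    refine tendsto_of_tendsto_of_tendsto_of_le_of_le tendsto_const_nhds hlim (fun k => zero_le)
      fun k => eLpNorm_le_mul_eLpNorm_of_ae_le_mul ?_ _
    filter_upwards [hVb] with x hx
    rw [← inner_sub_right]
    exact (norm_inner_le_norm _ _).trans (by gcongr)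
  -- The boundary term of Green's formula for `φ k` tends to a multiple of the mean of the trace,
  -- which is zero.
  have t4 : Tendsto (fun k => (∫ x in annulus x₀ a b, φ k x) + slope n a b b / κ *
      ∫ x, φ k x ∂(surfaceMeasure (annulus x₀ a b))) atTop
      (𝓝 (∫ x in annulus x₀ a b, u x)) := by
    have := t1.add (t2.const_mul (slope n a b b / κ))
    rwa [hg0, mul_zero, add_zero] at this
  refine tendsto_nhds_unique t3 (t4.congr fun k => ?_)
  rw [green_slopeField (by omega) x₀ ha hab (hφ1 k),
    hσ x₀ a b ha hab _ (hφ1 k).continuous.continuousOn]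
  field_simp

theorem hasCompactSupport_gradient {n : ℕ} {w : Space n → ℝ} (hw : HasCompactSupport w) :
    HasCompactSupport (∇ w) :=
  (hw.fderiv (𝕜 := ℝ)).comp_left (map_zero _)

theorem isWeakGradient_gradient {n : ℕ} {Ω : Set (Space n)} {w : Space n → ℝ}
    (hw : ContDiff ℝ 1 w) (hws : HasCompactSupport w) : IsWeakGradient Ω w (∇ w) := by
  intro φ hφ hφs hφΩ v
  have hφ1 : ContDiff ℝ 1 φ := hφ.of_le (by exact_mod_cast le_top)
  have hwd := hw.differentiable one_ne_zero
  have hφd := hφ1.differentiable one_ne_zero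
  have hwc := hw.continuous
  have hφc := hφ1.continuous
  have hwc' : Continuous fun x => fderiv ℝ w x v :=
    (hw.continuous_fderiv one_ne_zero).clm_apply continuous_const
  have hφc' : Continuous fun x => fderiv ℝ φ x v :=
    (hφ1.continuous_fderiv one_ne_zero).clm_apply continuous_const
  rw [setIntegral_eq_integral_of_forall_compl_eq_zero, setIntegral_eq_integral_of_forall_compl_eq_zero,
    integral_mul_fderiv_eq_neg_fderiv_mul_of_integrable]
  · congr 2 with x
    rw [real_inner_comm, inner_gradient]
  · exact (hwc'.mul hφc).integrable_of_hasCompactSupport hφs.mul_left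
  · exact (hwc.mul hφc').integrable_of_hasCompactSupport hws.mul_right
  · exact (hwc.mul hφc).integrable_of_hasCompactSupport hφs.mul_left
  · exact fun x _ => hwd x
  · exact fun x _ => hφd x
  · intro x hx
    rw [image_eq_zero_of_notMem_tsupport (fun h => hx (hφΩ h)), mul_zero]
  · intro x hx
    have : fderiv ℝ φ x = 0 :=
      image_eq_zero_of_notMem_tsupport fun h => hx (hφΩ (tsupport_fderiv_subset ℝ h))
    rw [this]
    simp

theorem gradient_profile {n : ℕ} {x₀ : Space n} {a b : ℝ} (ha : 0 < a) (hab : a < b) {ρ : ℝ → ℝ}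
    (hρ : ∀ r ∈ Set.Icc a b, HasDerivAt ρ (slope n a b r) r) {x : Space n}
    (hx : x ∈ closure (annulus x₀ a b)) :
    ∇ (fun x : Space n => ρ ‖x - x₀‖) x = slopeField n x₀ a b x := by
  rw [closure_annulus x₀ ha hab] at hx
  have hx0 : x ≠ x₀ := by
    rintro rfl
    have := hx.1
    simp at this
    linarith
  exact (hasGradientAt_radial hx0 (hρ _ hx)).gradient

theorem integral_profile_surfaceMeasure {n : ℕ} (hn : 2 ≤ n) (x₀ : Space n) {a b : ℝ} (ha : 0 < a)
    (hab : a < b) {ρ : ℝ → ℝ} (hρc : Continuous ρ)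
    (hρ : a ^ (n - 1) * ρ a + b ^ (n - 1) * ρ b = 0) :
    ∫ x, ρ ‖x - x₀‖ ∂(surfaceMeasure (annulus x₀ a b)) = 0 := by
  obtain ⟨κ, hκ, hσ⟩ := exists_integral_surfaceMeasure_annulus hn
  rw [hσ x₀ a b ha hab _ (by fun_prop)]
  simp only [add_sub_cancel_left, norm_smul_sphere ha.le, norm_smul_sphere (ha.trans hab).le,
    integral_const, smul_eq_mul]
  linear_combination κ * (sphereMeasure n).real Set.univ * hρ

/-- Completing the square: since `∫ ⟪V, G⟫ = ∫ u` for every competitor, its energy is `½ ∫ |G - V|²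
- ½ ∫ |V|²`. The profile has `G = V` on the annulus and attains the bound. -/
theorem isLeast_energyValues_annulus {n : ℕ} (hn : 2 ≤ n) (x₀ : Space n) {a b : ℝ} (ha : 0 < a)
    (hab : a < b) : IsLeast (energyValues (annulus x₀ a b))
      (-(1 / 2) * ∫ x in annulus x₀ a b, ‖slopeField n x₀ a b x‖ ^ 2) := by
  have hVc := continuousOn_slopeField x₀ ha hab
  have hmeas := (isOpen_annulus x₀ a b).measurableSet
  have hfin : IsFiniteMeasure ((volume : Measure (Space n)).restrict (annulus x₀ a b)) :=
    ⟨by rw [Measure.restrict_apply_univ]; exact volume_annulus_lt_top x₀ a b⟩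
  have hfin' := isFiniteMeasure_surfaceMeasure_annulus hn x₀ ha hab
  constructor
  · obtain ⟨ρ, hρ, hρs, hρ0, hρd, hρm⟩ := exists_profile (n := n) ha hab
    set w : Space n → ℝ := fun x => ρ ‖x - x₀‖ with hw
    have hwc : ContDiff ℝ ∞ w := contDiff_radial x₀ hρ hρ0
    have hws : HasCompactSupport w := hasCompactSupport_radial x₀ hρs
    have hwc1 : ContDiff ℝ 1 w := hwc.of_le (by exact_mod_cast le_top)
    have hH1 : MemH1 (annulus x₀ a b) w (∇ w) :=
      ⟨hwc.continuous.memLp_of_hasCompactSupport hws,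
        (continuous_gradient hwc1).memLp_of_hasCompactSupport (hasCompactSupport_gradient hws),
        isWeakGradient_gradient hwc1 hws⟩
    have htr : IsTrace (annulus x₀ a b) w (∇ w) w :=
      ⟨hwc.continuous.memLp_of_hasCompactSupport hws, fun _ => w, fun _ => hwc, fun _ => hws,
        by simp, by simp, by simp⟩
    have hmean := integral_profile_surfaceMeasure hn x₀ ha hab hρ.continuous hρm
    refine ⟨w, ∇ w, w, hH1, htr, hmean, ?_⟩
    have hgrad : ∀ x ∈ annulus x₀ a b, ∇ w x = slopeField n x₀ a b x := fun x hx =>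
      gradient_profile ha hab hρd (subset_closure hx)
    rw [← integral_inner_slopeField hn x₀ ha hab hH1 htr hmean,
      setIntegral_congr_fun hmeas (fun x hx => by simp only [hgrad x hx] :
        Set.EqOn (fun x => ‖∇ w x‖ ^ 2) (fun x => ‖slopeField n x₀ a b x‖ ^ 2) (annulus x₀ a b)),
      setIntegral_congr_fun hmeas (fun x hx => by
        simp only [hgrad x hx, real_inner_self_eq_norm_sq] :
        Set.EqOn (fun x => ⟪slopeField n x₀ a b x, ∇ w x⟫_ℝ)
          (fun x => ‖slopeField n x₀ a b x‖ ^ 2) (annulus x₀ a b))]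
    ring
  · rintro e ⟨u, G, g, hu, hg, hg0, rfl⟩
    rw [← integral_inner_slopeField hn x₀ ha hab hu hg hg0]
    have hVm : MemLp (slopeField n x₀ a b) 2 (volume.restrict (annulus x₀ a b)) := by
      obtain ⟨C, hC⟩ := (isCompact_closure_annulus x₀ a b).exists_bound_of_continuousOn hVc
      refine MemLp.of_bound ((hVc.mono subset_closure).aestronglyMeasurable hmeas) C ?_
      filter_upwards [ae_restrict_mem hmeas] with x hx using hC x (subset_closure hx)
    have i1 := (memLp_two_iff_integrable_sq_norm hVm.aestronglyMeasurable).1 hVm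
    have i2 := (memLp_two_iff_integrable_sq_norm hu.memLp_grad.aestronglyMeasurable).1 hu.memLp_grad
    have i4 := (memLp_two_iff_integrable_sq_norm (hVm.sub hu.memLp_grad).aestronglyMeasurable).1
      (hVm.sub hu.memLp_grad)
    have hexp : ∀ x, ‖(slopeField n x₀ a b - G) x‖ ^ 2 = ‖slopeField n x₀ a b x‖ ^ 2 -
        2 * ⟪slopeField n x₀ a b x, G x⟫_ℝ + ‖G x‖ ^ 2 := fun x => norm_sub_sq_real _ _
    -- By polarisation from the three squared norms.
    have i3 : Integrable (fun x => ⟪slopeField n x₀ a b x, G x⟫_ℝ)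
        (volume.restrict (annulus x₀ a b)) := by
      refine (((i1.add i2).sub i4).const_mul (1 / 2)).congr (Eventually.of_forall fun x => ?_)
      simp only [Pi.add_apply, Pi.sub_apply]
      rw [norm_sub_sq_real]
      ring
    have hpos : 0 ≤ ∫ x in annulus x₀ a b, ‖(slopeField n x₀ a b - G) x‖ ^ 2 :=
      integral_nonneg fun x => by positivity
    simp_rw [hexp] at hpos
    have i5 : Integrable (fun x => ‖slopeField n x₀ a b x‖ ^ 2 -
        2 * ⟪slopeField n x₀ a b x, G x⟫_ℝ) (volume.restrict (annulus x₀ a b)) :=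
      i1.sub (i3.const_mul 2)
    rw [integral_add i5 i2, integral_sub i1 (i3.const_mul 2),
      integral_const_mul] at hpos
    linarith

/-- The value of `T` on an annulus, as a one-dimensional integral. -/
theorem T_annulus {n : ℕ} (hn : 2 ≤ n) (x₀ : Space n) {a b : ℝ} (ha : 0 < a) (hab : a < b) :
    T (annulus x₀ a b) = -(1 / 2) * ((sphereMeasure n).real Set.univ *
      ∫ r in a..b, r ^ (n - 1) * slope n a b r ^ 2) := by
  rw [T, (isLeast_energyValues_annulus hn x₀ ha hab).csInf_eq,
    setIntegral_annulus (by omega) x₀ ha]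
  congr 1
  have : ∫ p : Metric.sphere (0 : Space n) 1 × ℝ, p.2 ^ (n - 1) *
      ‖slopeField n x₀ a b (x₀ + p.2 • (p.1 : Space n))‖ ^ 2
        ∂((sphereMeasure n).prod (volume.restrict (Set.Ioo a b))) =
      ∫ p : Metric.sphere (0 : Space n) 1 × ℝ, p.2 ^ (n - 1) * slope n a b p.2 ^ 2
        ∂((sphereMeasure n).prod (volume.restrict (Set.Ioo a b))) := by
    refine integral_congr_ae ?_
    have hae : ∀ᵐ p ∂((sphereMeasure n).prod ((volume : Measure ℝ).restrict (Set.Ioo a b))),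
        p ∈ (Set.univ : Set (Metric.sphere (0 : Space n) 1)) ×ˢ Set.Ioo a b := by
      rw [← (sphereMeasure n).restrict_univ, Measure.prod_restrict]
      exact ae_restrict_mem (MeasurableSet.univ.prod measurableSet_Ioo)
    filter_upwards [hae] with p hp
    have hp0 : 0 < p.2 := ha.trans hp.2.1
    have hne : x₀ + p.2 • (p.1 : Space n) ≠ x₀ := by
      intro h
      have h1 := norm_smul_sphere hp0.le p.1
      rw [add_eq_left.1 h, norm_zero] at h1
      linarith
    rw [norm_slopeField a b hne, add_sub_cancel_left, norm_smul_sphere hp0.le, sq_abs]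
  rw [this, integral_fun_snd (fun r => r ^ (n - 1) * slope n a b r ^ 2), smul_eq_mul,
    ← integral_Ioc_eq_integral_Ioo, ← intervalIntegral.integral_of_le hab.le]

/-! ### First variation of the energy under volume-preserving radial motions -/

/-- A strictly convex function lies strictly below its chord inside the interval. Strictness needs
`n ≥ 2`, since for `n = 1` the integrand is constant. -/
theorem integral_inv_pow_lt_trapezoid {n : ℕ} (hn : 2 ≤ n) {a b : ℝ} (ha : 0 < a) (hab : a < b) :
    ∫ r in a..b, (r ^ (n - 1))⁻¹ < (b - a) * ((a ^ (n - 1))⁻¹ + (b ^ (n - 1))⁻¹) / 2 := by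
  set A := (a ^ (n - 1))⁻¹
  set B := (b ^ (n - 1))⁻¹
  have hba : 0 < b - a := sub_pos.2 hab
  have hconv : StrictConvexOn ℝ (Set.Ioi 0) (fun r : ℝ => (r ^ (n - 1))⁻¹) := by
    have h := strictConvexOn_zpow (m := -((n - 1 : ℕ) : ℤ)) (by omega) (by omega)
    simpa [zpow_neg, zpow_natCast] using h
  have hcomb : ∀ r, r = (b - r) / (b - a) * a + (r - a) / (b - a) * b := by
    intro r; field_simp; ring
  have hsum : ∀ r, (b - r) / (b - a) + (r - a) / (b - a) = 1 := by
    intro r; field_simp; ring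
  have hchord : ∀ r, (b - r) / (b - a) * A + (r - a) / (b - a) * B =
      A + (r - a) * ((B - A) / (b - a)) := by
    intro r; field_simp; ring
  have hle : ∀ r ∈ Set.Ioo a b, (r ^ (n - 1))⁻¹ < A + (r - a) * ((B - A) / (b - a)) := by
    intro r hr
    have := hconv.2 ha (ha.trans hab) hab.ne (div_pos (sub_pos.2 hr.2) hba)
      (div_pos (sub_pos.2 hr.1) hba) (hsum r)
    simp only [smul_eq_mul, ← hcomb r] at this
    rwa [← hchord r]
  have hcont : ContinuousOn (fun r : ℝ => (r ^ (n - 1))⁻¹) (Set.Icc a b) :=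
    ContinuousOn.inv₀ (by fun_prop) fun r hr => pow_ne_zero _ (ha.trans_le hr.1).ne'
  have hchordint : ∫ r in a..b, (A + (r - a) * ((B - A) / (b - a))) = (b - a) * (A + B) / 2 := by
    rw [intervalIntegral.integral_add (by simp) (by apply Continuous.intervalIntegrable; fun_prop),
      intervalIntegral.integral_mul_const, intervalIntegral.integral_sub (by simp) (by simp)]
    simp
    field_simp
    ring
  rw [← hchordint]
  refine intervalIntegral.integral_lt_integral_of_continuousOn_of_le_of_exists_lt hab hcont
    (by fun_prop) (fun r hr => ?_) ⟨(a + b) / 2, ⟨by linarith, by linarith⟩, hle _ ⟨by linarith, by linarith⟩⟩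
  rcases hr.2.eq_or_lt with h | h
  · rw [h, mul_div_cancel₀ _ hba.ne']
    simp [B]
  · exact (hle r ⟨hr.1, h⟩).le

/-- The decisive inequality, used for both claims: it says that the integral of `slope n a b` over
`[a, b]` is negative, so the minimiser is smaller on the outer sphere. -/
theorem slopeConst_mul_integral_lt {n : ℕ} (hn : 2 ≤ n) {a b : ℝ} (ha : 0 < a) (hab : a < b) :
    slopeConst n a b * ∫ r in a..b, (r ^ (n - 1))⁻¹ < (b ^ 2 - a ^ 2) / 2 := by
  have hb := ha.trans hab
  have h : (0 : ℝ) < (a ^ (n - 1))⁻¹ + (b ^ (n - 1))⁻¹ := by positivity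
  have hK := slopeConst_mul_add (n := n) ha hab
  have hK0 : 0 < slopeConst n a b := div_pos (by linarith) h
  have := mul_lt_mul_of_pos_left (integral_inv_pow_lt_trapezoid hn ha hab) hK0
  calc _ < _ := this
    _ = _ := by linear_combination (b - a) / 2 * hK

theorem intervalIntegrable_inv_pow (m : ℕ) {a b : ℝ} (ha : 0 < a) (hb : 0 < b) :
    IntervalIntegrable (fun r : ℝ => (r ^ m)⁻¹) volume a b := by
  refine ContinuousOn.intervalIntegrable (ContinuousOn.inv₀ (by fun_prop) fun r hr => ?_)
  exact pow_ne_zero _ ((lt_min ha hb).trans_le hr.1).ne'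

theorem integral_pow_mul_slope_sq {n : ℕ} (hn : 1 ≤ n) {a b : ℝ} (ha : 0 < a) (hab : a < b) :
    ∫ r in a..b, r ^ (n - 1) * slope n a b r ^ 2 =
      ((b ^ (n + 2) - a ^ (n + 2)) / (n + 2) - slopeConst n a b * (b ^ 2 - a ^ 2) +
        slopeConst n a b ^ 2 * ∫ r in a..b, (r ^ (n - 1))⁻¹) / n ^ 2 := by
  set K := slopeConst n a b with hK
  have hn0 : (n : ℝ) ≠ 0 := by positivity
  have hpt : Set.EqOn (fun r => r ^ (n - 1) * slope n a b r ^ 2)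
      (fun r => (r ^ (n + 1) - 2 * K * r + K ^ 2 * (r ^ (n - 1))⁻¹) / n ^ 2) (Set.uIcc a b) := by
    intro r hr
    rw [Set.uIcc_of_le hab.le] at hr
    have hr0 : r ≠ 0 := (ha.trans_le hr.1).ne'
    obtain ⟨m, rfl⟩ : ∃ m, n = m + 1 := ⟨n - 1, by omega⟩
    simp only [slope, Nat.add_sub_cancel, ← hK]
    field_simp
    ring
  rw [intervalIntegral.integral_congr hpt, intervalIntegral.integral_div,
    intervalIntegral.integral_add (by apply Continuous.intervalIntegrable; fun_prop)
      ((intervalIntegrable_inv_pow _ ha (ha.trans hab)).const_mul _),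
    intervalIntegral.integral_sub (by apply Continuous.intervalIntegrable; fun_prop)
      (by apply Continuous.intervalIntegrable; fun_prop),
    intervalIntegral.integral_const_mul, intervalIntegral.integral_const_mul, integral_pow,
    integral_id]
  push_cast
  ring_nf

/-- The integral is `(b^(n+2) - a^(n+2))/(n+2) - K (b² - a²) + K² L`, over `n²`. With `a' = A` and
`b' = B`, the terms without `K'` add up to `(b - K B)² - (a - K A)²`, which is zero because the
slopes at `a` and `b` are opposite. What remains is `K'` times a negative number. -/
theorem exists_hasDerivAt_integral_slope_sq {n : ℕ} (hn : 2 ≤ n) {α β : ℝ → ℝ}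
    (hα : HasDerivAt α (α 0 ^ (n - 1))⁻¹ 0) (hβ : HasDerivAt β (β 0 ^ (n - 1))⁻¹ 0)
    (hpos : ∀ t, 0 < α t) (hlt : ∀ t, α t < β t) :
    ∃ d < 0, HasDerivAt
      (fun t => ∫ r in α t..β t, r ^ (n - 1) * slope n (α t) (β t) r ^ 2) d 0 := by
  have hβpos : ∀ t, 0 < β t := fun t => (hpos t).trans (hlt t)
  have hn0 : (0 : ℝ) < n := by positivity
  set a := α 0 with ha
  set b := β 0 with hb
  have ha0 : 0 < a := hpos 0
  have hb0 : 0 < b := hβpos 0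
  have hab : a < b := hlt 0
  set A := (a ^ (n - 1))⁻¹ with hA
  set B := (b ^ (n - 1))⁻¹ with hB
  have hA0 : 0 < A := by positivity
  have hB0 : 0 < B := by positivity
  have haA : a ^ (n + 1) * A = a ^ 2 := by
    rw [hA, show n + 1 = 2 + (n - 1) by omega, pow_add, mul_assoc,
      mul_inv_cancel₀ (by positivity), mul_one]
  have hbB : b ^ (n + 1) * B = b ^ 2 := by
    rw [hB, show n + 1 = 2 + (n - 1) by omega, pow_add, mul_assoc,
      mul_inv_cancel₀ (by positivity), mul_one]
  have dA := (hα.pow (n - 1)).inv (pow_ne_zero _ (hpos 0).ne')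
  have dB := (hβ.pow (n - 1)).inv (pow_ne_zero _ (hβpos 0).ne')
  set A' := -(((n - 1 : ℕ) : ℝ) * α 0 ^ (n - 1 - 1) * A) / (α 0 ^ (n - 1)) ^ 2 with hA'
  set B' := -(((n - 1 : ℕ) : ℝ) * β 0 ^ (n - 1 - 1) * B) / (β 0 ^ (n - 1)) ^ 2 with hB'
  have hA'0 : A' ≤ 0 := by
    rw [hA', neg_div, neg_nonpos, ← ha]; positivity
  have hB'0 : B' ≤ 0 := by
    rw [hB', neg_div, neg_nonpos, ← hb]; positivity
  have dK : HasDerivAt (fun t => slopeConst n (α t) (β t))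
      (((A + B) * (A + B) - (a + b) * (A' + B')) / (A + B) ^ 2) 0 :=
    (hα.add hβ).div (dA.add dB) (by
      change A + B ≠ 0
      positivity)
  set K := slopeConst n a b with hK
  set K' := ((A + B) * (A + B) - (a + b) * (A' + B')) / (A + B) ^ 2 with hK'
  -- `K = (a + b) / (A + B)`: the numerator grows at the positive rate `A + B`, and the denominator
  -- does not grow.
  have hK'0 : 0 < K' := by
    apply div_pos _ (by positivity)
    have h1 : 0 ≤ (a + b) * (-(A' + B')) := mul_nonneg (by linarith) (by linarith)
    nlinarith [mul_pos (add_pos hA0 hB0) (add_pos hA0 hB0)]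
  -- A fixed primitive, so that both moving endpoints are differentiated by the chain rule; any
  -- positive base point would do.
  set P : ℝ → ℝ := fun x => ∫ r in (1 : ℝ)..x, (r ^ (n - 1))⁻¹ with hP
  have hPd : ∀ x, 0 < x → HasDerivAt P (x ^ (n - 1))⁻¹ x := by
    intro x hx
    have hc : ContinuousOn (fun r : ℝ => (r ^ (n - 1))⁻¹) (Set.Ioi 0) :=
      ContinuousOn.inv₀ (by fun_prop) fun r hr => pow_ne_zero _ (ne_of_gt hr)
    exact intervalIntegral.integral_hasDerivAt_right
      (intervalIntegrable_inv_pow _ one_pos hx)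
      (hc.stronglyMeasurableAtFilter isOpen_Ioi x hx) (hc.continuousAt (isOpen_Ioi.mem_nhds hx))
  have hPsub : ∀ t, ∫ r in α t..β t, (r ^ (n - 1))⁻¹ = P (β t) - P (α t) := fun t =>
    (intervalIntegral.integral_interval_sub_left
      (intervalIntegrable_inv_pow _ one_pos (hβpos t))
      (intervalIntegrable_inv_pow _ one_pos (hpos t))).symm
  have dL : HasDerivAt (fun t => P (β t) - P (α t)) (B * B - A * A) 0 :=
    ((hPd _ (hβpos 0)).comp 0 hβ).sub ((hPd _ (hpos 0)).comp 0 hα)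
  have hKAB : K * (A + B) = a + b := slopeConst_mul_add ha0 hab
  have hKL : K * (P b - P a) < (b ^ 2 - a ^ 2) / 2 := by
    have := slopeConst_mul_integral_lt hn ha0 hab
    rwa [hPsub 0] at this
  refine ⟨(2 * K' * (K * (P b - P a) - (b ^ 2 - a ^ 2) / 2)) / n ^ 2, ?_, ?_⟩
  · apply div_neg_of_neg_of_pos _ (by positivity)
    exact mul_neg_of_pos_of_neg (by positivity) (by linarith)
  have heq : (fun t => ∫ r in α t..β t, r ^ (n - 1) * slope n (α t) (β t) r ^ 2) =
      fun t => ((β t ^ (n + 2) - α t ^ (n + 2)) / (n + 2) -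
        slopeConst n (α t) (β t) * (β t ^ 2 - α t ^ 2) +
        slopeConst n (α t) (β t) ^ 2 * (P (β t) - P (α t))) / n ^ 2 := by
    ext t
    rw [integral_pow_mul_slope_sq (by omega) (hpos t) (hlt t), hPsub t]
  rw [heq]
  have hd := ((((hβ.pow (n + 2)).sub (hα.pow (n + 2))).div_const ((n : ℝ) + 2)).sub
    (dK.mul ((hβ.pow 2).sub (hα.pow 2)))).add ((dK.pow 2).mul dL) |>.div_const ((n : ℝ) ^ 2)
  refine hd.congr_deriv ?_
  congr 1
  simp only [Pi.pow_apply, Pi.sub_apply, Nat.cast_ofNat, ← ha, ← hb, ← hK]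
  have e : ((((n + 2 : ℕ) : ℝ) * b ^ (n + 2 - 1) * B - ((n + 2 : ℕ) : ℝ) * a ^ (n + 2 - 1) * A) /
      ((n : ℝ) + 2)) = b ^ 2 - a ^ 2 := by
    rw [show n + 2 - 1 = n + 1 by omega, mul_assoc, mul_assoc, haA, hbB]
    push_cast
    field_simp
  rw [e]
  -- The difference of squares above, factored; the factor `K (A + B) - (a + b)` vanishes.
  linear_combination (K * (B - A) - (b - a)) * hKAB

/-! ### Flows of bounded Lipschitz vector fields on the line -/

/-- A bounded field cannot escape in finite time: up to time `N + 1` the solution stays within `M (N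
+ 1)` of `x`, so Picard–Lindelöf applies on each such interval, and uniqueness glues the pieces. -/
theorem exists_forall_hasDerivAt {f : ℝ → ℝ} {K M : NNReal} (hf : LipschitzWith K f)
    (hM : ∀ x, ‖f x‖ ≤ M) (x : ℝ) :
    ∃ γ : ℝ → ℝ, γ 0 = x ∧ ∀ t, HasDerivAt γ (f (γ t)) t := by
  have hloc : ∀ N : ℕ, ∃ γ : ℝ → ℝ, γ 0 = x ∧
      ∀ t ∈ Set.Ioo (-(N + 1 : ℝ)) (N + 1), HasDerivAt γ (f (γ t)) t := by
    intro N
    have h0 : (0 : ℝ) ∈ Set.Icc (-(N + 1 : ℝ)) (N + 1) := ⟨by linarith [N.cast_nonneg (α := ℝ)],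
      by positivity⟩
    have hPL : IsPicardLindelof (fun _ => f) (tmin := -(N + 1 : ℝ)) (tmax := N + 1) ⟨0, h0⟩ x
        (M * (N + 1)) 0 M K := by
      refine IsPicardLindelof.of_time_independent (fun y _ => hM y) hf.lipschitzOnWith ?_
      simp
    obtain ⟨γ, h1, h2⟩ := hPL.exists_eq_forall_mem_Icc_hasDerivWithinAt₀
    exact ⟨γ, h1, fun t ht => (h2 t (Set.Ioo_subset_Icc_self ht)).hasDerivAt
      (Icc_mem_nhds ht.1 ht.2)⟩
  choose γ hγ0 hγ using hloc
  have hagree : ∀ N₁ N₂ : ℕ, N₁ ≤ N₂ → ∀ t ∈ Set.Ioo (-(N₁ + 1 : ℝ)) (N₁ + 1),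
      γ N₁ t = γ N₂ t := by
    intro N₁ N₂ h
    have hc : (N₁ : ℝ) ≤ N₂ := by exact_mod_cast h
    refine ODE_solution_unique_of_mem_Ioo (v := fun _ => f) (s := fun _ => Set.univ) (t₀ := 0)
      (fun t _ => hf.lipschitzOnWith) ⟨by linarith [N₁.cast_nonneg (α := ℝ)], by positivity⟩
      (fun t ht => ⟨hγ N₁ t ht, trivial⟩)
      (fun t ht => ⟨hγ N₂ t ⟨by linarith [ht.1], by linarith [ht.2]⟩, trivial⟩)
      (by rw [hγ0, hγ0])
  have hmem : ∀ t : ℝ, t ∈ Set.Ioo (-((⌈|t|⌉₊ : ℕ) + 1 : ℝ)) ((⌈|t|⌉₊ : ℕ) + 1) := by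
    intro t
    have := Nat.le_ceil |t|
    exact abs_lt.1 (by linarith)
  have hval : ∀ (N : ℕ) (t : ℝ), t ∈ Set.Ioo (-(N + 1 : ℝ)) (N + 1) →
      γ ⌈|t|⌉₊ t = γ N t := by
    intro N t ht
    rcases le_total ⌈|t|⌉₊ N with h | h
    · exact hagree _ _ h t (hmem t)
    · exact (hagree _ _ h t ht).symm
  -- The extra 1 in the half-length makes the interval of index `⌈|t|⌉₊` a neighbourhood of `t`.
  refine ⟨fun t => γ ⌈|t|⌉₊ t, hγ0 _, fun t => ?_⟩
  have hev : (fun s => γ ⌈|s|⌉₊ s) =ᶠ[𝓝 t] γ ⌈|t|⌉₊ := by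
    filter_upwards [isOpen_Ioo.mem_nhds (hmem t)] with s hs using hval _ s hs
  exact (hγ _ t (hmem t)).congr_of_eventuallyEq hev

theorem solution_unique {f : ℝ → ℝ} {K : NNReal} (hf : LipschitzWith K f) {γ₁ γ₂ : ℝ → ℝ}
    (h₁ : ∀ t, HasDerivAt γ₁ (f (γ₁ t)) t) (h₂ : ∀ t, HasDerivAt γ₂ (f (γ₂ t)) t) {t₀ : ℝ}
    (h : γ₁ t₀ = γ₂ t₀) : γ₁ = γ₂ :=
  ODE_solution_unique_univ (v := fun _ => f) (s := fun _ => Set.univ)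
    (fun _ => hf.lipschitzOnWith) (fun t => ⟨h₁ t, trivial⟩) (fun t => ⟨h₂ t, trivial⟩) h

/-- To change order, two solutions would have to meet, by the intermediate value theorem, and
solutions that meet coincide. -/
theorem solution_lt {f : ℝ → ℝ} {K : NNReal} (hf : LipschitzWith K f) {γ₁ γ₂ : ℝ → ℝ}
    (h₁ : ∀ t, HasDerivAt γ₁ (f (γ₁ t)) t) (h₂ : ∀ t, HasDerivAt γ₂ (f (γ₂ t)) t)
    (h : γ₁ 0 < γ₂ 0) (t : ℝ) : γ₁ t < γ₂ t := by
  by_contra hlt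
  have hc₁ : Continuous γ₁ := continuous_iff_continuousAt.2 fun s => (h₁ s).continuousAt
  have hc₂ : Continuous γ₂ := continuous_iff_continuousAt.2 fun s => (h₂ s).continuousAt
  have hc : Continuous (γ₂ - γ₁) := hc₂.sub hc₁
  obtain ⟨s, hs⟩ : (0 : ℝ) ∈ Set.range (γ₂ - γ₁) :=
    mem_range_of_exists_le_of_exists_ge hc ⟨t, by simpa using not_lt.1 hlt⟩
      ⟨0, by simpa using h.le⟩
  have := solution_unique hf h₁ h₂ (t₀ := s) (sub_eq_zero.1 hs).symm
  rw [this] at h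
  exact lt_irrefl _ h

/-- `Φ` is the flow of the vector field `f` on the line. -/
structure IsLineFlow (f : ℝ → ℝ) (Φ : ℝ → ℝ → ℝ) : Prop where
  zero : ∀ r, Φ 0 r = r
  hasDerivAt : ∀ t r, HasDerivAt (fun t => Φ t r) (f (Φ t r)) t

theorem exists_isLineFlow {f : ℝ → ℝ} (hf : ContDiff ℝ 1 f) (hs : HasCompactSupport f) :
    ∃ Φ, IsLineFlow f Φ := by
  obtain ⟨K, hK⟩ := hf.lipschitzWith_of_hasCompactSupport hs one_ne_zero
  obtain ⟨M, hM⟩ := hf.continuous.bounded_above_of_compact_support hs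
  choose Φ h1 h2 using exists_forall_hasDerivAt hK (M := M.toNNReal)
    (fun x => (hM x).trans M.le_coe_toNNReal)
  exact ⟨fun t r => Φ r t, h1, fun t r => h2 r t⟩

namespace IsLineFlow

variable {f : ℝ → ℝ} {Φ : ℝ → ℝ → ℝ} {K : NNReal}

theorem lt (hΦ : IsLineFlow f Φ) (hf : LipschitzWith K f) {r s : ℝ} (h : r < s) (t : ℝ) :
    Φ t r < Φ t s :=
  solution_lt hf (fun t => hΦ.hasDerivAt t r) (fun t => hΦ.hasDerivAt t s)
    (by simpa [hΦ.zero] using h) t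

theorem apply_neg (hΦ : IsLineFlow f Φ) (hf : LipschitzWith K f) (t r : ℝ) :
    Φ t (Φ (-t) r) = r := by
  have h1 : ∀ s, HasDerivAt (fun s => Φ (s - t) r) (f (Φ (s - t) r)) s := fun s =>
    (hΦ.hasDerivAt (s - t) r).comp_sub_const s t
  have := solution_unique hf (fun s => hΦ.hasDerivAt s (Φ (-t) r)) h1 (t₀ := 0)
    (by simp [hΦ.zero])
  simpa [hΦ.zero] using congrFun this t

theorem apply_eq_self (hΦ : IsLineFlow f Φ) (hf : LipschitzWith K f) {r : ℝ} (h : f r = 0)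
    (t : ℝ) : Φ t r = r := by
  have h1 : ∀ s, HasDerivAt (fun _ : ℝ => r) (f r) s := fun s => by
    rw [h]; exact hasDerivAt_const s r
  exact congrFun (solution_unique hf (fun s => hΦ.hasDerivAt s r) h1 (t₀ := 0) (hΦ.zero r)) t

end IsLineFlow

/-! ### Radial flows -/

/-- The radial map of `ℝⁿ` which sends a point at distance `r` from `x₀` to distance `Φ t r`. -/
def radialFlow {n : ℕ} (x₀ : Space n) (Φ : ℝ → ℝ → ℝ) (t : ℝ) (x : Space n) : Space n :=
  x₀ + (Φ t ‖x - x₀‖ / ‖x - x₀‖) • (x - x₀)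

section RadialFlow

variable {n : ℕ} {x₀ : Space n} {q : ℝ → ℝ} {Φ : ℝ → ℝ → ℝ} {K : NNReal}

theorem radialFlow_pos (hΦ : IsLineFlow (fun r => q r * r) Φ)
    (hf : LipschitzWith K fun r => q r * r) {r : ℝ} (hr : 0 < r) (t : ℝ) : 0 < Φ t r := by
  have := hΦ.lt hf hr t
  rwa [hΦ.apply_eq_self hf (by simp)] at this

theorem norm_radialFlow_sub (hΦ : IsLineFlow (fun r => q r * r) Φ)
    (hf : LipschitzWith K fun r => q r * r) {x : Space n} (hx : x ≠ x₀) (t : ℝ) :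
    ‖radialFlow x₀ Φ t x - x₀‖ = Φ t ‖x - x₀‖ := by
  have h0 : 0 < ‖x - x₀‖ := norm_pos_iff.2 (sub_ne_zero.2 hx)
  rw [radialFlow, add_sub_cancel_left, norm_smul, Real.norm_eq_abs,
    abs_of_pos (div_pos (radialFlow_pos hΦ hf h0 t) h0), div_mul_cancel₀ _ h0.ne']

/-- Off the centre, directions are kept and radii follow the line flow. At the centre the factor `x
- x₀` vanishes, whatever the value of the quotient, and so does the field. -/
theorem isFlowMap_radialFlow (hΦ : IsLineFlow (fun r => q r * r) Φ)
    (hf : LipschitzWith K fun r => q r * r) :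
    IsFlowMap (fun x => q ‖x - x₀‖ • (x - x₀)) (radialFlow x₀ Φ) := by
  constructor
  · intro x
    by_cases hx : x = x₀
    · simp [radialFlow, hx]
    · have h0 : ‖x - x₀‖ ≠ 0 := norm_ne_zero_iff.2 (sub_ne_zero.2 hx)
      simp [radialFlow, hΦ.zero, h0]
  · intro t x
    by_cases hx : x = x₀
    · simpa [radialFlow, hx] using hasDerivAt_const t x₀
    · have h := (((hΦ.hasDerivAt t ‖x - x₀‖).div_const ‖x - x₀‖).smul_const (x - x₀)).const_add x₀
      refine h.congr_deriv ?_
      change _ = q ‖radialFlow x₀ Φ t x - x₀‖ • (radialFlow x₀ Φ t x - x₀)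
      rw [norm_radialFlow_sub hΦ hf hx, radialFlow, add_sub_cancel_left, smul_smul, mul_div_assoc]

theorem image_radialFlow_annulus (hΦ : IsLineFlow (fun r => q r * r) Φ)
    (hf : LipschitzWith K fun r => q r * r) {a b : ℝ} (ha : 0 < a) (t : ℝ) :
    radialFlow x₀ Φ t '' annulus x₀ a b = annulus x₀ (Φ t a) (Φ t b) := by
  have hne : ∀ c, 0 < c → ∀ d, ∀ x ∈ annulus x₀ c d, x ≠ x₀ := by
    rintro c hc d x hx rfl
    have := hx.1
    simp at this
    linarith
  ext z
  constructor
  · rintro ⟨x, hx, rfl⟩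
    simp only [annulus, Set.mem_ofPred_eq, norm_radialFlow_sub hΦ hf (hne a ha b x hx)]
    exact ⟨hΦ.lt hf hx.1 t, hΦ.lt hf hx.2 t⟩
  · intro hz
    have hz0 : 0 < ‖z - x₀‖ := (radialFlow_pos hΦ hf ha t).trans hz.1
    have hinv : ∀ r, Φ (-t) (Φ t r) = r := fun r => by
      simpa using hΦ.apply_neg hf (-t) r
    have h1 := hΦ.lt hf hz.1 (-t)
    have h2 := hΦ.lt hf hz.2 (-t)
    rw [hinv] at h1 h2
    have hr0 : 0 < Φ (-t) ‖z - x₀‖ := ha.trans h1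
    have hnorm : ‖radialFlow x₀ Φ (-t) z - x₀‖ = Φ (-t) ‖z - x₀‖ :=
      norm_radialFlow_sub hΦ hf (sub_ne_zero.1 (norm_pos_iff.1 hz0)) (-t)
    refine ⟨radialFlow x₀ Φ (-t) z, ⟨by rwa [hnorm], by rwa [hnorm]⟩, ?_⟩
    rw [radialFlow, hnorm, hΦ.apply_neg hf, radialFlow, add_sub_cancel_left, smul_smul,
      div_mul_div_comm, mul_comm, div_self (by positivity), one_smul, add_sub_cancel]

end RadialFlow

theorem volume_annulus {n : ℕ} (hn : 1 ≤ n) (x₀ : Space n) {a b : ℝ} (ha : 0 < a) (hab : a < b) :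
    volume (annulus x₀ a b) =
      ENNReal.ofReal ((sphereMeasure n).real Set.univ * ((b ^ n - a ^ n) / n)) := by
  have h := setIntegral_annulus hn x₀ (b := b) ha (fun _ => 1)
  simp only [mul_one] at h
  rw [integral_fun_snd (fun r => r ^ (n - 1)), smul_eq_mul, ← integral_Ioc_eq_integral_Ioo,
    ← intervalIntegral.integral_of_le hab.le, integral_pow, Nat.sub_add_cancel hn,
    setIntegral_const, smul_eq_mul, mul_one, Nat.cast_sub hn, Nat.cast_one, sub_add_cancel] at h
  rw [← h, measureReal_def, ENNReal.ofReal_toReal (volume_annulus_lt_top x₀ a b).ne]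

/-! ### A volume-preserving radial flow and non-stationarity of annuli -/

theorem lipschitz_of_contDiff_of_hasCompactSupport {f : ℝ → ℝ} (hf : ContDiff ℝ ∞ f)
    (hs : HasCompactSupport f) : ∃ K, LipschitzWith K f :=
  (hf.of_le (by exact_mod_cast le_top) : ContDiff ℝ 1 f).lipschitzWith_of_hasCompactSupport hs
    one_ne_zero

/-- A radial profile `q` such that the flow of `r' = q r * r` moves the two radii `a < b` with
`r ^ n` increasing at the same rate. -/
theorem exists_volumePreserving_profile {n : ℕ} (hn : 1 ≤ n) {a b : ℝ} (ha : 0 < a)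
    (hab : a < b) :
    ∃ q : ℝ → ℝ, ContDiff ℝ ∞ q ∧ HasCompactSupport q ∧ (0 : ℝ) ∉ tsupport q ∧
      q a * a = (a ^ (n - 1))⁻¹ ∧ q b * b = (b ^ (n - 1))⁻¹ ∧
      ∀ Φ, IsLineFlow (fun r => q r * r) Φ → ∀ t, Φ t b ^ n - Φ t a ^ n = b ^ n - a ^ n := by
  have hb := ha.trans hab
  have hn0 : n ≠ 0 := by omega
  have hnR : (n : ℝ) ≠ 0 := by exact_mod_cast hn0
  set d := b ^ n - a ^ n with hd
  have hd0 : 0 < d := sub_pos.2 (pow_lt_pow_left₀ hab ha.le hn0)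
  have han : 0 < a ^ n := by positivity
  -- Bumps of radius `ε` about `a ^ n` and `b ^ n` stay away from 0, and each vanishes within
  -- distance `ε` of the other's centre.
  set ε := min (a ^ n) d / 2 with hε
  have hε0 : 0 < ε := by positivity
  have hεa : ε ≤ a ^ n / 2 := div_le_div_of_nonneg_right (min_le_left _ _) (by norm_num)
  have hεd : ε ≤ d / 2 := div_le_div_of_nonneg_right (min_le_right _ _) (by norm_num)
  let χ : ContDiffBump (0 : ℝ) := ⟨ε / 2, ε, by positivity, by linarith⟩
  have hχ0 : χ 0 = 1 := χ.one_of_mem_closedBall (by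
    rw [Metric.mem_closedBall, dist_self]; exact χ.rIn_pos.le)
  have hχz : ∀ s, ε ≤ |s| → χ s = 0 := fun s hs => χ.zero_of_le_dist (by
    simpa [Real.dist_eq] using hs)
  set h : ℝ → ℝ := fun s => χ (s - a ^ n) + χ (s - b ^ n) with hh
  have hhc : ContDiff ℝ ∞ h := (χ.contDiff.comp (contDiff_id.sub contDiff_const)).add
    (χ.contDiff.comp (contDiff_id.sub contDiff_const))
  have hhz : ∀ s, s ≤ a ^ n / 2 → h s = 0 := by
    intro s hs
    simp only [hh]
    rw [hχz _ (by rw [abs_of_nonpos (by linarith)]; linarith),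
      hχz _ (by rw [abs_of_nonpos (by linarith)]; linarith), add_zero]
  have hhz' : ∀ s, b ^ n + ε ≤ s → h s = 0 := by
    intro s hs
    simp only [hh]
    rw [hχz _ (by rw [abs_of_nonneg (by linarith)]; linarith),
      hχz _ (by rw [abs_of_nonneg (by linarith)]; linarith), add_zero]
  have hhs : HasCompactSupport h := by
    refine HasCompactSupport.of_support_subset_isCompact
      (isCompact_Icc (a := a ^ n / 2) (b := b ^ n + ε)) fun s hs => ?_
    by_contra hcon
    rw [Set.mem_Icc, not_and_or, not_le, not_le] at hcon
    rcases hcon with hc | hc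
    · exact hs (hhz s hc.le)
    · exact hs (hhz' s hc.le)
  have hha : h (a ^ n) = 1 := by
    simp only [hh, sub_self, hχ0]
    rw [hχz _ (by rw [abs_of_nonpos (by linarith)]; linarith), add_zero]
  have hhb : h (b ^ n) = 1 := by
    simp only [hh, sub_self, hχ0]
    rw [hχz _ (by rw [abs_of_nonneg (by linarith)]; linarith), zero_add]
  -- With this choice `r' = q r * r` becomes the autonomous equation `s' = n h(s)` for `s = r ^ n`.
  set q : ℝ → ℝ := fun r => h (r ^ n) / r ^ n with hq
  have hq0 : q =ᶠ[𝓝 0] 0 := by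
    have hlim : Tendsto (fun r : ℝ => r ^ n) (𝓝 0) (𝓝 0) := by
      simpa [hn0] using (continuous_pow n).tendsto (0 : ℝ)
    filter_upwards [hlim.eventually (gt_mem_nhds (show 0 < a ^ n / 2 by positivity))] with r hr
    simp [hq, hhz _ hr.le]
  have hqc : ContDiff ℝ ∞ q := by
    rw [contDiff_iff_contDiffAt]
    intro r
    by_cases hr : r = 0
    · rw [hr]; exact contDiffAt_const.congr_of_eventuallyEq hq0
    · exact (hhc.comp (contDiff_id.pow n)).contDiffAt.div (contDiff_id.pow n).contDiffAt
        (pow_ne_zero _ hr)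
  have hqs : HasCompactSupport q := by
    refine HasCompactSupport.of_support_subset_isCompact
      (isCompact_closedBall (0 : ℝ) (b ^ n + ε + 1)) fun r hr => ?_
    by_contra hcon
    rw [mem_closedBall_zero_iff, not_le, Real.norm_eq_abs] at hcon
    apply hr
    have hbn : 0 < b ^ n := by positivity
    have h1 : b ^ n + ε ≤ |r ^ n| := by
      rw [abs_pow]
      calc b ^ n + ε ≤ |r| := by linarith
        _ ≤ |r| ^ n := le_self_pow₀ (by linarith) hn0
    rcases le_total 0 (r ^ n) with h2 | h2
    · rw [abs_of_nonneg h2] at h1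
      simp [hq, hhz' _ h1]
    · simp [hq, hhz _ (h2.trans (by positivity))]
  have hqr : ∀ r, r ≠ 0 → q r * r ^ n = h (r ^ n) := fun r hr =>
    div_mul_cancel₀ _ (pow_ne_zero _ hr)
  have hmul : ∀ r, 0 < r → h (r ^ n) = 1 → q r * r = (r ^ (n - 1))⁻¹ := by
    intro r hr h1
    have : r ^ n = r ^ (n - 1) * r := by rw [← pow_succ, Nat.sub_add_cancel hn]
    simp only [hq, h1]
    rw [this]
    field_simp
  refine ⟨q, hqc, hqs, fun h0 => notMem_tsupport_iff_eventuallyEq.2 hq0 h0, hmul a ha hha,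
    hmul b hb hhb, fun Φ hΦ t => ?_⟩
  have hχc : ContDiff ℝ ∞ fun s => (n : ℝ) * χ s := contDiff_const.mul χ.contDiff
  have hχs : HasCompactSupport fun s => (n : ℝ) * χ s := χ.hasCompactSupport.mul_left
  obtain ⟨Kχ, hKχ⟩ := lipschitz_of_contDiff_of_hasCompactSupport hχc hχs
  obtain ⟨Ψ, hΨ⟩ := exists_isLineFlow (hχc.of_le (by exact_mod_cast le_top)) hχs
  obtain ⟨Kh, hKh⟩ := lipschitz_of_contDiff_of_hasCompactSupport
    (f := fun s => (n : ℝ) * h s) (contDiff_const.mul hhc) hhs.mul_left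
  have hqrc : ContDiff ℝ ∞ fun r => q r * r := hqc.mul contDiff_id
  obtain ⟨Kq, hKq⟩ := lipschitz_of_contDiff_of_hasCompactSupport hqrc hqs.mul_right
  -- `-ε` and `ε` are rest points of `s' = n χ(s)`, and trajectories keep their order.
  have htrap : ∀ s, -ε < Ψ s 0 ∧ Ψ s 0 < ε := by
    intro s
    constructor
    · have := hΨ.lt hKχ (neg_lt_zero.2 hε0) s
      rwa [hΨ.apply_eq_self hKχ (by rw [hχz _ (by simp [abs_of_pos hε0]), mul_zero])] at this
    · have := hΨ.lt hKχ hε0 s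
      rwa [hΨ.apply_eq_self hKχ (r := ε) (by rw [hχz _ (le_abs_self ε), mul_zero])] at this
  have hΦpos : ∀ r, 0 < r → ∀ s, 0 < Φ s r := fun r hr s => radialFlow_pos hΦ hKq hr s
  have hpow : ∀ r, 0 < r → ∀ s, HasDerivAt (fun s => Φ s r ^ n) (n * h (Φ s r ^ n)) s := by
    intro r hr s
    refine ((hΦ.hasDerivAt s r).pow n).congr_deriv ?_
    rw [← hqr _ (hΦpos r hr s).ne', ← Nat.sub_add_cancel hn, pow_succ, Nat.add_sub_cancel]
    ring
  -- A translate of the single trajectory `Ψ s 0` solves the equation of `h`, because it never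
  -- enters the other bump. The same holds around `b ^ n`, so both powers change by the same amount
  -- at all times, not only to first order.
  have hA : ∀ s, HasDerivAt (fun s => a ^ n + Ψ s 0) (n * h (a ^ n + Ψ s 0)) s := by
    intro s
    refine ((hΨ.hasDerivAt s 0).const_add (a ^ n)).congr_deriv ?_
    simp only [hh, add_sub_cancel_left]
    rw [hχz (a ^ n + Ψ s 0 - b ^ n)
      (by rw [abs_of_nonpos (by linarith [(htrap s).2])]; linarith [(htrap s).2]), add_zero]
  have hB : ∀ s, HasDerivAt (fun s => b ^ n + Ψ s 0) (n * h (b ^ n + Ψ s 0)) s := by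
    intro s
    refine ((hΨ.hasDerivAt s 0).const_add (b ^ n)).congr_deriv ?_
    simp only [hh, add_sub_cancel_left]
    rw [hχz (b ^ n + Ψ s 0 - a ^ n)
      (by rw [abs_of_nonneg (by linarith [(htrap s).1])]; linarith [(htrap s).1]), zero_add]
  have eA : Φ t a ^ n = a ^ n + Ψ t 0 :=
    congrFun (solution_unique hKh (hpow a ha) hA (t₀ := 0) (by simp [hΦ.zero, hΨ.zero])) t
  have eB : Φ t b ^ n = b ^ n + Ψ t 0 :=
    congrFun (solution_unique hKh (hpow b hb) hB (t₀ := 0) (by simp [hΦ.zero, hΨ.zero])) t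
  rw [eA, eB]
  ring

theorem contDiff_radialField {n : ℕ} (x₀ : Space n) {q : ℝ → ℝ} (hq : ContDiff ℝ ∞ q)
    (hq0 : (0 : ℝ) ∉ tsupport q) :
    ContDiff ℝ ∞ (fun x : Space n => q ‖x - x₀‖ • (x - x₀)) :=
  (contDiff_radial x₀ hq hq0).smul (contDiff_id.sub contDiff_const)

/-- Along the volume-preserving radial flow the images are concentric annuli, for which `T` is
explicit; its derivative at time zero is strictly positive. -/
theorem not_isStationaryShape_annulus {n : ℕ} (hn : 2 ≤ n) (x₀ : Space n) {a b : ℝ} (ha : 0 < a)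
    (hab : a < b) : ¬ IsStationaryShape (annulus x₀ a b) := by
  intro hstat
  obtain ⟨q, hqc, hqs, hq0, hqa, hqb, hvol⟩ :=
    exists_volumePreserving_profile (n := n) (by omega) ha hab
  have hqrc : ContDiff ℝ ∞ fun r => q r * r := hqc.mul contDiff_id
  have hqrs : HasCompactSupport fun r => q r * r := hqs.mul_right
  obtain ⟨K, hK⟩ := lipschitz_of_contDiff_of_hasCompactSupport hqrc hqrs
  obtain ⟨Φ, hΦ⟩ := exists_isLineFlow (hqrc.of_le (by exact_mod_cast le_top)) hqrs
  have himg : ∀ t, radialFlow x₀ Φ t '' annulus x₀ a b = annulus x₀ (Φ t a) (Φ t b) :=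
    image_radialFlow_annulus hΦ hK ha
  have hpos : ∀ t, 0 < Φ t a := radialFlow_pos hΦ hK ha
  have hlt : ∀ t, Φ t a < Φ t b := hΦ.lt hK hab
  have hT := hstat _ _ (contDiff_radialField x₀ hqc hq0) (hasCompactSupport_radial x₀ hqs).smul_right
    (isFlowMap_radialFlow hΦ hK) (fun t => by
      rw [himg, volume_annulus (by omega) x₀ (hpos t) (hlt t),
        volume_annulus (by omega) x₀ ha hab, hvol Φ hΦ t])
  obtain ⟨d, hd, hderiv⟩ := exists_hasDerivAt_integral_slope_sq hn
    (α := fun t => Φ t a) (β := fun t => Φ t b)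
    (by
      have := hΦ.hasDerivAt 0 a
      rw [hΦ.zero, hqa] at this
      simpa only [hΦ.zero] using this)
    (by
      have := hΦ.hasDerivAt 0 b
      rw [hΦ.zero, hqb] at this
      simpa only [hΦ.zero] using this)
    hpos hlt
  have hT' : (fun t => T (radialFlow x₀ Φ t '' annulus x₀ a b)) = fun t =>
      -(1 / 2) * ((sphereMeasure n).real Set.univ *
        ∫ r in Φ t a..Φ t b, r ^ (n - 1) * slope n (Φ t a) (Φ t b) r ^ 2) := by
    ext t
    rw [himg, T_annulus hn x₀ (hpos t) (hlt t)]
  rw [hT'] at hT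
  have huniq := hT.unique ((hderiv.const_mul ((sphereMeasure n).real Set.univ)).const_mul (-(1 / 2)))
  have : Nontrivial (Fin n) := Fin.nontrivial_iff_two_le.2 hn
  have : Nonempty (Fin n) := ⟨⟨0, by omega⟩⟩
  have hω : 0 < (sphereMeasure n).real Set.univ :=
    ENNReal.toReal_pos (Measure.measure_univ_ne_zero.2 (Measure.toSphere_ne_zero _))
      (measure_ne_top _ _)
  nlinarith [mul_neg_of_pos_of_neg hω hd]

/-! ### Laplacian, normal and mean curvature in radial coordinates -/

theorem laplacian_eq_sum_fderiv {n : ℕ} (f : Space n → ℝ) (x : Space n) :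
    Laplacian.laplacian f x = ∑ i, fderiv ℝ (fderiv ℝ f) x (EuclideanSpace.basisFun (Fin n) ℝ i)
      (EuclideanSpace.basisFun (Fin n) ℝ i) := by
  rw [InnerProductSpace.laplacian_eq_iteratedFDeriv_orthonormalBasis f
    (EuclideanSpace.basisFun (Fin n) ℝ)]
  simp only [iteratedFDeriv_two_apply, Matrix.cons_val_zero, Matrix.cons_val_one]

theorem laplacian_eq_of_hasGradientAt {n : ℕ} {f : Space n → ℝ} {g : Space n → Space n}
    {x : Space n} {g' : Space n →L[ℝ] Space n} (hf : ∀ᶠ y in 𝓝 x, HasGradientAt f (g y) y)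
    (hg : HasFDerivAt g g' x) :
    Laplacian.laplacian f x = ∑ i, ⟪g' (EuclideanSpace.basisFun (Fin n) ℝ i),
      EuclideanSpace.basisFun (Fin n) ℝ i⟫_ℝ := by
  have h1 : fderiv ℝ f =ᶠ[𝓝 x] fun y => InnerProductSpace.toDual ℝ (Space n) (g y) := by
    filter_upwards [hf] with y hy using hy.hasFDerivAt.fderiv
  -- `toDual` is conjugate-linear; over `ℝ` it is repackaged as a linear map for the chain rule.
  let L : Space n →L[ℝ] StrongDual ℝ (Space n) := LinearMap.toContinuousLinearMap
    { toFun := fun v => InnerProductSpace.toDual ℝ (Space n) v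
      map_add' := fun v w => map_add _ v w
      map_smul' := fun c v => by simp }
  have h2 : HasFDerivAt (fun y => InnerProductSpace.toDual ℝ (Space n) (g y)) (L.comp g') x :=
    L.hasFDerivAt.comp x hg
  rw [laplacian_eq_sum_fderiv, h1.fderiv_eq, h2.fderiv]
  rfl

theorem laplacian_radial {n : ℕ} {x₀ x : Space n} (hx : x ≠ x₀) {ρ d : ℝ → ℝ} {d' : ℝ}
    (hρ : ∀ᶠ r in 𝓝 ‖x - x₀‖, HasDerivAt ρ (d r) r) (hd : HasDerivAt d d' ‖x - x₀‖) :
    Laplacian.laplacian (fun x : Space n => ρ ‖x - x₀‖) x =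
      d' + (n - 1) * d ‖x - x₀‖ / ‖x - x₀‖ := by
  have h0 : ‖x - x₀‖ ≠ 0 := norm_ne_zero_iff.2 (sub_ne_zero.2 hx)
  have hcont : ContinuousAt (fun x : Space n => ‖x - x₀‖) x := by fun_prop
  have h1 : ∀ᶠ y in 𝓝 x, HasGradientAt (fun x : Space n => ρ ‖x - x₀‖)
      ((d ‖y - x₀‖ / ‖y - x₀‖) • (y - x₀)) y := by
    filter_upwards [hcont.tendsto.eventually hρ, isOpen_ne.mem_nhds hx] with y hy hne
    exact hasGradientAt_radial hne hy
  have hκ := (hd.div (hasDerivAt_id _) h0).comp_hasFDerivAt x (hasGradientAt_norm_sub hx).hasFDerivAt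
  have h2 := hκ.smul ((hasFDerivAt_id x).sub_const x₀)
  rw [laplacian_eq_of_hasGradientAt h1 h2]
  have hsum : ∑ i : Fin n, (x i - x₀ i) ^ 2 = ‖x - x₀‖ ^ 2 := by
    simp [EuclideanSpace.norm_sq_eq]
  have : ∀ i : Fin n, ⟪((d ‖x - x₀‖ / ‖x - x₀‖) • ContinuousLinearMap.id ℝ (Space n) +
      (((d' * ‖x - x₀‖ - d ‖x - x₀‖) / ‖x - x₀‖ ^ 2) •
        (InnerProductSpace.toDual ℝ (Space n)) (‖x - x₀‖⁻¹ • (x - x₀))).smulRight (x - x₀))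
      (EuclideanSpace.basisFun (Fin n) ℝ i), EuclideanSpace.basisFun (Fin n) ℝ i⟫_ℝ =
      d ‖x - x₀‖ / ‖x - x₀‖ + ((d' * ‖x - x₀‖ - d ‖x - x₀‖) / ‖x - x₀‖ ^ 3) *
        (x i - x₀ i) ^ 2 := by
    intro i
    simp [inner_add_left, inner_smul_left, EuclideanSpace.inner_single_right]
    field_simp
  refine (Finset.sum_congr rfl fun i _ => ?_).trans ((Finset.sum_congr rfl fun i _ => this i).trans ?_)
  · simp
  · rw [Finset.sum_add_distrib, ← Finset.mul_sum, hsum]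
    simp
    field_simp
    ring

theorem laplacian_slope {n : ℕ} (hn : 1 ≤ n) {x₀ x : Space n} (hx : x ≠ x₀) {a b : ℝ} {ρ : ℝ → ℝ}
    (hρ : ∀ᶠ r in 𝓝 ‖x - x₀‖, HasDerivAt ρ (slope n a b r) r) :
    Laplacian.laplacian (fun x : Space n => ρ ‖x - x₀‖) x = -1 := by
  have h0 : 0 < ‖x - x₀‖ := norm_pos_iff.2 (sub_ne_zero.2 hx)
  have hn0 : (n : ℝ) ≠ 0 := by positivity
  obtain ⟨m, rfl⟩ : ∃ m, n = m + 1 := ⟨n - 1, by omega⟩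
  have hd : HasDerivAt (slope (m + 1) a b)
      ((-(m * slopeConst (m + 1) a b / ‖x - x₀‖ ^ (m + 1)) - 1) / (m + 1 : ℕ)) ‖x - x₀‖ := by
    have h := (((hasDerivAt_const ‖x - x₀‖ (slopeConst (m + 1) a b)).div
      (hasDerivAt_pow m ‖x - x₀‖) (by positivity)).sub (hasDerivAt_id _)).div_const
        ((m + 1 : ℕ) : ℝ)
    refine h.congr_deriv ?_
    congr 2
    -- The derivative of `r ^ m` contains the truncated exponent `m - 1`, so `m = 0` is treated
    -- separately.
    rcases m with _ | m
    · simp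
    · simp
      field_simp
      ring
  rw [laplacian_radial hx hρ hd, slope]
  simp only [Nat.add_sub_cancel]
  field_simp
  push_cast
  ring

theorem exists_radial_projection {n : ℕ} {x₀ x : Space n} (hx : x ≠ x₀) {c : ℝ} (hc : 0 ≤ c) :
    ∃ z : Space n, ‖z - x₀‖ = c ∧ dist x z = |‖x - x₀‖ - c| := by
  have h0 : 0 < ‖x - x₀‖ := norm_pos_iff.2 (sub_ne_zero.2 hx)
  refine ⟨x₀ + (c / ‖x - x₀‖) • (x - x₀), ?_, ?_⟩
  · rw [add_sub_cancel_left, norm_smul, Real.norm_eq_abs, abs_of_nonneg (by positivity),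
      div_mul_cancel₀ _ h0.ne']
  · have : x - (x₀ + (c / ‖x - x₀‖) • (x - x₀)) = (1 - c / ‖x - x₀‖) • (x - x₀) := by
      rw [sub_smul, one_smul]; abel
    rw [dist_eq_norm, this, norm_smul, Real.norm_eq_abs]
    nth_rewrite 2 [← abs_of_pos h0]
    rw [← abs_mul, sub_mul, one_mul, div_mul_cancel₀ _ h0.ne']

/-- The reverse triangle inequality bounds distances below by differences of radii, and the point of
radius `c` on the ray of `x` attains the bound. -/
theorem infDist_eq_of_radial {n : ℕ} {x₀ x : Space n} {s : Set (Space n)} (hx : x ≠ x₀) {c : ℝ}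
    (hc : 0 ≤ c) (hmem : ∀ z : Space n, ‖z - x₀‖ = c → z ∈ closure s)
    (hle : ∀ z ∈ s, |‖x - x₀‖ - c| ≤ |‖x - x₀‖ - ‖z - x₀‖|) :
    Metric.infDist x s = |‖x - x₀‖ - c| := by
  obtain ⟨z, hz, hd⟩ := exists_radial_projection hx hc
  apply le_antisymm
  · rw [← Metric.infDist_closure, ← hd]
    exact Metric.infDist_le_dist_of_mem (hmem z hz)
  · rw [Metric.le_infDist (closure_nonempty_iff.1 ⟨z, hmem z hz⟩)]
    intro y hy
    refine (hle y hy).trans ((abs_norm_sub_norm_le _ _).trans ?_)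
    rw [sub_sub_sub_cancel_right, dist_eq_norm]

/-- Beyond the middle radius the outer sphere is the nearer one. The formula holds on both sides of
that sphere, so it can be differentiated on the sphere itself. -/
theorem signedDistance_outer {n : ℕ} {x₀ x : Space n} {a b : ℝ} (ha : 0 < a) (hab : a < b)
    (hx : (a + b) / 2 < ‖x - x₀‖) : signedDistance (annulus x₀ a b) x = ‖x - x₀‖ - b := by
  have hb := ha.trans hab
  have hne : x ≠ x₀ := sub_ne_zero.1 (norm_pos_iff.1 (by linarith))
  rw [signedDistance]
  rcases le_total ‖x - x₀‖ b with h | h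
  · have h1 : Metric.infDist x (annulus x₀ a b) = 0 := Metric.infDist_zero_of_mem_closure (by
      rw [closure_annulus x₀ ha hab]; exact ⟨by linarith, h⟩)
    have h2 : Metric.infDist x (annulus x₀ a b)ᶜ = |‖x - x₀‖ - b| := by
      refine infDist_eq_of_radial hne hb.le (fun z hz => subset_closure ?_) fun z hz => ?_
      · exact fun hmem => absurd hmem.2 (by rw [hz]; exact lt_irrefl b)
      · rw [abs_of_nonpos (by linarith)]
        by_cases hza : a < ‖z - x₀‖
        · have : b ≤ ‖z - x₀‖ := not_lt.1 fun h => hz ⟨hza, h⟩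
          rw [abs_of_nonpos (by linarith)]
          linarith
        · rw [abs_of_nonneg (by linarith)]
          linarith
    rw [h1, h2, abs_of_nonpos (by linarith)]
    ring
  · have h1 : Metric.infDist x (annulus x₀ a b)ᶜ = 0 := Metric.infDist_zero_of_mem
      fun hmem => absurd hmem.2 (not_lt.2 h)
    have h2 : Metric.infDist x (annulus x₀ a b) = |‖x - x₀‖ - b| := by
      refine infDist_eq_of_radial hne hb.le (fun z hz => ?_) fun z hz => ?_
      · rw [closure_annulus x₀ ha hab]
        exact ⟨by rw [hz]; exact hab.le, hz.le⟩
      · rw [abs_of_nonneg (by linarith), abs_of_nonneg (by linarith [hz.2])]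
        linarith [hz.2]
    rw [h1, h2, abs_of_nonneg (by linarith)]
    ring

theorem signedDistance_inner {n : ℕ} {x₀ x : Space n} {a b : ℝ} (ha : 0 < a) (hab : a < b)
    (hne : x ≠ x₀) (hx : ‖x - x₀‖ < (a + b) / 2) :
    signedDistance (annulus x₀ a b) x = a - ‖x - x₀‖ := by
  rw [signedDistance]
  rcases le_total a ‖x - x₀‖ with h | h
  · have h1 : Metric.infDist x (annulus x₀ a b) = 0 := Metric.infDist_zero_of_mem_closure (by
      rw [closure_annulus x₀ ha hab]; exact ⟨h, by linarith⟩)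
    have h2 : Metric.infDist x (annulus x₀ a b)ᶜ = |‖x - x₀‖ - a| := by
      refine infDist_eq_of_radial hne ha.le (fun z hz => subset_closure ?_) fun z hz => ?_
      · exact fun hmem => absurd hmem.1 (by rw [hz]; exact lt_irrefl a)
      · rw [abs_of_nonneg (by linarith)]
        by_cases hza : a < ‖z - x₀‖
        · have : b ≤ ‖z - x₀‖ := not_lt.1 fun h => hz ⟨hza, h⟩
          rw [abs_of_nonpos (by linarith)]
          linarith
        · rw [abs_of_nonneg (by linarith)]
          linarith
    rw [h1, h2, abs_of_nonneg (by linarith)]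
    ring
  · have h1 : Metric.infDist x (annulus x₀ a b)ᶜ = 0 := Metric.infDist_zero_of_mem
      fun hmem => absurd hmem.1 (not_lt.2 h)
    have h2 : Metric.infDist x (annulus x₀ a b) = |‖x - x₀‖ - a| := by
      refine infDist_eq_of_radial hne ha.le (fun z hz => ?_) fun z hz => ?_
      · rw [closure_annulus x₀ ha hab]
        exact ⟨hz.ge, by rw [hz]; exact hab.le⟩
      · rw [abs_of_nonpos (by linarith), abs_of_nonpos (by linarith [hz.1])]
        linarith [hz.1]
    rw [h1, h2, abs_of_nonpos (by linarith)]
    ring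

theorem signedDistance_eventuallyEq_outer {n : ℕ} {x₀ p : Space n} {a b : ℝ} (ha : 0 < a)
    (hab : a < b) (hp : ‖p - x₀‖ = b) :
    signedDistance (annulus x₀ a b) =ᶠ[𝓝 p] fun x => ‖x - x₀‖ - b := by
  have hcont : ContinuousAt (fun x : Space n => ‖x - x₀‖) p := by fun_prop
  filter_upwards [hcont.eventually (lt_mem_nhds (show (a + b) / 2 < ‖p - x₀‖ by linarith))]
    with x hx using signedDistance_outer ha hab hx

theorem signedDistance_eventuallyEq_inner {n : ℕ} {x₀ p : Space n} {a b : ℝ} (ha : 0 < a)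
    (hab : a < b) (hp : ‖p - x₀‖ = a) :
    signedDistance (annulus x₀ a b) =ᶠ[𝓝 p] fun x => a - ‖x - x₀‖ := by
  have hcont : ContinuousAt (fun x : Space n => ‖x - x₀‖) p := by fun_prop
  have hne : p ≠ x₀ := sub_ne_zero.1 (norm_pos_iff.1 (by linarith))
  filter_upwards [hcont.eventually (gt_mem_nhds (show ‖p - x₀‖ < (a + b) / 2 by linarith)),
    isOpen_ne.mem_nhds hne] with x hx hxne using signedDistance_inner ha hab hxne hx

theorem outerNormal_outer {n : ℕ} {x₀ p : Space n} {a b : ℝ} (ha : 0 < a)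
    (hab : a < b) (hp : ‖p - x₀‖ = b) : outerNormal (annulus x₀ a b) p = b⁻¹ • (p - x₀) := by
  have hne : p ≠ x₀ := sub_ne_zero.1 (norm_pos_iff.1 (by linarith))
  have h := hasGradientAt_radial (ρ := fun r => r - b) hne ((hasDerivAt_id _).sub_const b)
  rw [hp, one_div] at h
  rw [outerNormal, gradient, (signedDistance_eventuallyEq_outer ha hab hp).fderiv_eq]
  exact h.gradient

theorem outerNormal_inner {n : ℕ} {x₀ p : Space n} {a b : ℝ} (ha : 0 < a)
    (hab : a < b) (hp : ‖p - x₀‖ = a) : outerNormal (annulus x₀ a b) p = -(a⁻¹ • (p - x₀)) := by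
  have hne : p ≠ x₀ := sub_ne_zero.1 (norm_pos_iff.1 (by linarith))
  have h := hasGradientAt_radial (ρ := fun r => a - r) hne ((hasDerivAt_id _).const_sub a)
  rw [hp, neg_div, neg_smul, one_div] at h
  rw [outerNormal, gradient, (signedDistance_eventuallyEq_inner ha hab hp).fderiv_eq]
  exact h.gradient

theorem meanCurvature_outer {n : ℕ} {x₀ p : Space n} {a b : ℝ} (ha : 0 < a)
    (hab : a < b) (hp : ‖p - x₀‖ = b) : meanCurvature (annulus x₀ a b) p = (n - 1) / b := by
  have hne : p ≠ x₀ := sub_ne_zero.1 (norm_pos_iff.1 (by linarith))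
  rw [meanCurvature,
    (InnerProductSpace.laplacian_congr_nhds
      (signedDistance_eventuallyEq_outer ha hab hp)).eq_of_nhds,
    laplacian_radial (ρ := fun r => r - b) (d := fun _ => 1) hne
      (Eventually.of_forall fun r => (hasDerivAt_id r).sub_const b) (hasDerivAt_const _ _), hp]
  ring

theorem meanCurvature_inner {n : ℕ} {x₀ p : Space n} {a b : ℝ} (ha : 0 < a)
    (hab : a < b) (hp : ‖p - x₀‖ = a) : meanCurvature (annulus x₀ a b) p = -((n - 1) / a) := by
  have hne : p ≠ x₀ := sub_ne_zero.1 (norm_pos_iff.1 (by linarith))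
  rw [meanCurvature,
    (InnerProductSpace.laplacian_congr_nhds
      (signedDistance_eventuallyEq_inner ha hab hp)).eq_of_nhds,
    laplacian_radial (ρ := fun r => a - r) (d := fun _ => -1) hne
      (Eventually.of_forall fun r => (hasDerivAt_id r).const_sub a) (hasDerivAt_const _ _), hp]
  ring

theorem isNeumannSolution_profile {n : ℕ} (hn : 2 ≤ n) (x₀ : Space n) {a b : ℝ} (ha : 0 < a)
    (hab : a < b) {ρ : ℝ → ℝ} (hρ : ContDiff ℝ ∞ ρ) (hρ0 : (0 : ℝ) ∉ tsupport ρ)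
    (hρd : ∀ r ∈ Set.Icc a b, HasDerivAt ρ (slope n a b r) r)
    (hρm : a ^ (n - 1) * ρ a + b ^ (n - 1) * ρ b = 0) :
    IsNeumannSolution (annulus x₀ a b) (fun x => ρ ‖x - x₀‖) (∇ fun x : Space n => ρ ‖x - x₀‖)
      (slope n a b b) := by
  have hwc : ContDiff ℝ ∞ (fun x : Space n => ρ ‖x - x₀‖) := contDiff_radial x₀ hρ hρ0
  have hwc1 : ContDiff ℝ 1 (fun x : Space n => ρ ‖x - x₀‖) := hwc.of_le (by exact_mod_cast le_top)
  refine ⟨by exact_mod_cast (contDiff_infty.1 hwc 2).contDiffOn, hwc.continuous.continuousOn,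
    fun _ _ => rfl, (continuous_gradient hwc1).continuousOn, fun x hx => ?_, fun p hp => ?_,
    integral_profile_surfaceMeasure hn x₀ ha hab hρ.continuous hρm⟩
  · have hne : x ≠ x₀ := sub_ne_zero.1 (norm_pos_iff.1 (ha.trans hx.1))
    rw [laplacian_slope (by omega) hne (a := a) (b := b)
      (by filter_upwards [Icc_mem_nhds hx.1 hx.2] with r hr using hρd r hr), neg_neg]
  · rw [gradient_profile ha hab hρd (frontier_subset_closure hp), slopeField]
    rw [frontier_annulus x₀ ha hab] at hp
    rcases hp with hp | hp
    · rw [mem_sphere_iff_norm] at hp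
      rw [outerNormal_inner ha hab hp, hp, inner_neg_right, inner_smul_left, inner_smul_right,
        real_inner_self_eq_norm_sq, hp, slope_left n ha hab, conj_trivial]
      field_simp
    · rw [mem_sphere_iff_norm] at hp
      have hb := ha.trans hab
      rw [outerNormal_outer ha hab hp, hp, inner_smul_left, inner_smul_right,
        real_inner_self_eq_norm_sq, hp, conj_trivial]
      field_simp

/-! ### Uniqueness for the Neumann problem -/

theorem integral_fderiv_apply_eq_zero {n : ℕ} {F : Space n → ℝ} (hF : ContDiff ℝ 1 F)
    (hs : HasCompactSupport F) (v : Space n) : ∫ x, fderiv ℝ F x v = 0 := by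
  have hc : Continuous fun x => fderiv ℝ F x v :=
    (hF.continuous_fderiv one_ne_zero).clm_apply continuous_const
  have hi : Integrable (fun x => fderiv ℝ F x v) :=
    hc.integrable_of_hasCompactSupport (hs.fderiv_apply ℝ v)
  have := integral_mul_fderiv_eq_neg_fderiv_mul_of_integrable (μ := volume) (f := fun _ => (1 : ℝ))
    (g := F) (v := v) (by simp) (by simpa using hi)
    (by simpa using hF.continuous.integrable_of_hasCompactSupport hs)
    (fun x _ => differentiableAt_const _) (fun x _ => hF.differentiable one_ne_zero x)
  simpa using this

/-- Testing the Laplace equation for `v` against `ζ v`. -/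
theorem integral_cutoff_mul_harmonic {n : ℕ} {Ω : Set (Space n)} (hΩ : IsOpen Ω)
    {v : Space n → ℝ} (hv : ContDiffOn ℝ 2 v Ω) (hΔ : ∀ x ∈ Ω, Laplacian.laplacian v x = 0)
    {ζ : Space n → ℝ} (hζ : ContDiff ℝ 1 ζ) (hs : HasCompactSupport ζ) (hsub : tsupport ζ ⊆ Ω) :
    ∫ x in Ω, (ζ x * ‖∇ v x‖ ^ 2 + v x * ⟪∇ ζ x, ∇ v x⟫_ℝ) = 0 := by
  set e := EuclideanSpace.basisFun (Fin n) ℝ with he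
  -- The components of `ζ v ∇v`, a `C¹` field of compact support. Its divergence has integral zero,
  -- and where `Δv = 0` it equals the integrand.
  set F : Fin n → Space n → ℝ := fun i x => ζ x * (v x * fderiv ℝ v x (e i))
  have hv2 : ∀ x ∈ Ω, ContDiffAt ℝ 2 v x := fun x hx => hv.contDiffAt (hΩ.mem_nhds hx)
  have hdv : ∀ x ∈ Ω, ContDiffAt ℝ 1 (fderiv ℝ v) x := fun x hx =>
    (hv2 x hx).fderiv_right (by norm_num)
  have hzero : ∀ x ∉ Ω, ∑ i, fderiv ℝ (F i) x (e i) = 0 := by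
    intro x hx
    refine Finset.sum_eq_zero fun i _ => ?_
    have : x ∉ tsupport (F i) := fun h => hx (hsub (tsupport_mul_subset_left h))
    rw [(notMem_tsupport_iff_eventuallyEq.1 this).fderiv_eq]
    simp
  have hFsub : ∀ i, tsupport (F i) ⊆ tsupport ζ := fun i => tsupport_mul_subset_left
  have hFc : ∀ i, ContDiff ℝ 1 (F i) := by
    intro i
    rw [contDiff_iff_contDiffAt]
    intro x
    by_cases hx : x ∉ tsupport (F i)
    · exact contDiffAt_const.congr_of_eventuallyEq (notMem_tsupport_iff_eventuallyEq.1 hx)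
    have hxΩ := hsub (hFsub i (not_not.1 hx))
    exact hζ.contDiffAt.mul (((hv2 x hxΩ).of_le (by norm_num)).mul
      ((hdv x hxΩ).clm_apply contDiffAt_const))
  have hFs : ∀ i, HasCompactSupport (F i) := fun i => hs.mul_right
  have hsum : ∑ i, ∫ x, fderiv ℝ (F i) x (e i) = 0 :=
    Finset.sum_eq_zero fun i _ => integral_fderiv_apply_eq_zero (hFc i) (hFs i) (e i)
  rw [← integral_finsetSum] at hsum
  swap
  · intro i _
    exact (((hFc i).continuous_fderiv one_ne_zero).clm_apply
      continuous_const).integrable_of_hasCompactSupport ((hFs i).fderiv_apply ℝ (e i))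
  rw [← hsum]
  refine (setIntegral_congr_fun hΩ.measurableSet fun x hx => ?_).trans
    (setIntegral_eq_integral_of_forall_compl_eq_zero hzero)
  · 
    have hζd : HasFDerivAt ζ (fderiv ℝ ζ x) x := (hζ.differentiable one_ne_zero x).hasFDerivAt
    have hvd : HasFDerivAt v (fderiv ℝ v x) x :=
      ((hv2 x hx).differentiableAt two_ne_zero).hasFDerivAt
    have hvdd : HasFDerivAt (fderiv ℝ v) (fderiv ℝ (fderiv ℝ v) x) x :=
      ((hdv x hx).differentiableAt one_ne_zero).hasFDerivAt
    have hterm : ∀ i, fderiv ℝ (F i) x (e i) =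
        ζ x * fderiv ℝ v x (e i) ^ 2 + v x * (fderiv ℝ ζ x (e i) * fderiv ℝ v x (e i)) +
          ζ x * v x * fderiv ℝ (fderiv ℝ v) x (e i) (e i) := by
      intro i
      have h : HasFDerivAt (F i) _ x :=
        hζd.mul (hvd.mul (hvdd.clm_apply (hasFDerivAt_const (e i) x)))
      rw [h.fderiv]
      simp
      ring
    have hinner : ∀ (w : Space n) (i : Fin n), w i = ⟪e i, w⟫_ℝ := by
      intro w i
      simp [he, EuclideanSpace.inner_single_left]
    rw [Finset.sum_congr rfl fun i _ => hterm i, Finset.sum_add_distrib, ← Finset.mul_sum,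
      he, ← laplacian_eq_sum_fderiv, hΔ x hx, mul_zero, add_zero, Finset.sum_add_distrib,
      ← Finset.mul_sum, ← Finset.mul_sum, ← he]
    congr 2
    · rw [EuclideanSpace.real_norm_sq_eq]
      exact Finset.sum_congr rfl fun i _ => by rw [hinner, inner_gradient]
    · rw [PiLp.inner_apply]
      refine Finset.sum_congr rfl fun i _ => ?_
      rw [hinner, hinner, inner_gradient, inner_gradient]
      simp [mul_comm]

theorem exists_primitive_of_integral_eq_zero {g : ℝ → ℝ} {a b : ℝ} (hab : a < b)
    (hg : ContDiff ℝ ∞ g) (hs : HasCompactSupport g) (hsub : tsupport g ⊆ Set.Ioo a b)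
    (h0 : ∫ r, g r = 0) :
    ∃ ψ : ℝ → ℝ, ContDiff ℝ ∞ ψ ∧ HasCompactSupport ψ ∧ tsupport ψ ⊆ Set.Ioo a b ∧
      deriv ψ = g := by
  -- The midpoint is inserted only so that the compact set is nonempty and has extreme points `c`,
  -- `d`; the primitive vanishes off `[c, d]`, to the right because `g` has integral zero.
  have hK : IsCompact (insert ((a + b) / 2) (tsupport g)) := hs.isCompact.insert _
  have hKsub : insert ((a + b) / 2) (tsupport g) ⊆ Set.Ioo a b :=
    Set.insert_subset ⟨by linarith, by linarith⟩ hsub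
  obtain ⟨c, hc, hcl⟩ := hK.exists_isLeast (Set.insert_nonempty _ _)
  obtain ⟨d, hd, hdl⟩ := hK.exists_isGreatest (Set.insert_nonempty _ _)
  have hgc : ∀ s, g s ≠ 0 → c ≤ s ∧ s ≤ d := fun s hs =>
    have : s ∈ insert ((a + b) / 2) (tsupport g) := Or.inr (subset_tsupport g hs)
    ⟨hcl this, hdl this⟩
  have hderiv : ∀ r, HasDerivAt (fun r => ∫ s in a..r, g s) (g r) r := fun r =>
    intervalIntegral.integral_hasDerivAt_right (hg.continuous.intervalIntegrable _ _)
      (hg.continuous.stronglyMeasurableAtFilter _ _) hg.continuous.continuousAt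
  have hd' : deriv (fun r => ∫ s in a..r, g s) = g := funext fun r => (hderiv r).deriv
  have hsupp : Function.support (fun r => ∫ s in a..r, g s) ⊆ Set.Icc c d := by
    intro r hr
    by_contra hmem
    apply hr
    rcases lt_or_ge r c with h | h
    · refine intervalIntegral.integral_zero_ae (Eventually.of_forall fun s hs => ?_)
      by_contra hne
      have h1 := (hgc s hne).1
      have h2 : s ≤ max a r := hs.2
      exact absurd (h1.trans h2) (not_le.2 (max_lt (hKsub hc).1 h))
    · have hr' : d < r := not_le.1 fun h' => hmem ⟨h, h'⟩
      change ∫ s in a..r, g s = 0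
      rw [intervalIntegral.integral_eq_integral_of_support_subset, h0]
      exact fun s hs => ⟨(hKsub hc).1.trans_le (hgc s hs).1, (hgc s hs).2.trans hr'.le⟩
  refine ⟨_, ?_, HasCompactSupport.of_support_subset_isCompact isCompact_Icc hsupp,
    (closure_minimal hsupp isClosed_Icc).trans
      (Set.Icc_subset_Ioo (hKsub hc).1 (hKsub hd).2), hd'⟩
  rw [contDiff_infty_iff_deriv, hd']
  exact ⟨fun r => (hderiv r).differentiableAt, hg⟩

/-- A du Bois-Reymond lemma. -/
theorem sub_eq_integral_of_weak_deriv {P Q : ℝ → ℝ} {a b : ℝ} (hab : a < b)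
    (hP : ContinuousOn P (Set.Icc a b)) (hQ : ContinuousOn Q (Set.Icc a b))
    (h : ∀ ψ : ℝ → ℝ, ContDiff ℝ ∞ ψ → HasCompactSupport ψ → tsupport ψ ⊆ Set.Ioo a b →
      ∫ r in Set.Ioo a b, (ψ r * P r + deriv ψ r * Q r) = 0) :
    Q b - Q a = ∫ r in a..b, P r := by
  set P' := Set.IccExtend hab.le ((Set.Icc a b).domRestrict P) with hP'
  have hPc : Continuous P' := hP.domRestrict.Icc_extend'
  have hPe : ∀ r ∈ Set.Icc a b, P' r = P r := fun r hr => Set.IccExtend_of_mem _ _ hr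
  -- After an integration by parts the hypothesis says that `S` has weak derivative zero, so `S`
  -- must be constant.
  set S : ℝ → ℝ := fun r => Q r - ∫ s in a..r, P' s with hS
  have hRd : ∀ r, HasDerivAt (fun r => ∫ s in a..r, P' s) (P' r) r := fun r =>
    intervalIntegral.integral_hasDerivAt_right (hPc.intervalIntegrable _ _)
      (hPc.stronglyMeasurableAtFilter _ _) hPc.continuousAt
  have hRc : Continuous fun r => ∫ s in a..r, P' s :=
    continuous_iff_continuousAt.2 fun r => (hRd r).continuousAt
  have hSc : ContinuousOn S (Set.Icc a b) := hQ.sub hRc.continuousOn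
  have hint : ∀ {f : ℝ → ℝ}, ContinuousOn f (Set.Icc a b) → IntegrableOn f (Set.Ioo a b) :=
    fun hf => hf.integrableOn_Icc.mono_set Set.Ioo_subset_Icc_self
  have hψS : ∀ ψ : ℝ → ℝ, ContDiff ℝ ∞ ψ → HasCompactSupport ψ → tsupport ψ ⊆ Set.Ioo a b →
      ∫ r in Set.Ioo a b, deriv ψ r * S r = 0 := by
    intro ψ hψ hψs hψsub
    have hψa : ∀ r ∉ Set.Ioo a b, ψ r = 0 := fun r hr =>
      image_eq_zero_of_notMem_tsupport fun h => hr (hψsub h)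
    have hψc := hψ.continuous
    have hψ'c : Continuous (deriv ψ) := hψ.continuous_deriv (by simp)
    have hparts : ∫ r in Set.Ioo a b, (deriv ψ r * (∫ s in a..r, P' s) + ψ r * P' r) = 0 := by
      rw [← integral_Ioc_eq_integral_Ioo, ← intervalIntegral.integral_of_le hab.le,
        intervalIntegral.integral_eq_sub_of_hasDerivAt
          (f := fun r => ψ r * ∫ s in a..r, P' s)
          (fun r _ => ((hψ.differentiable (by simp)) r).hasDerivAt.mul (hRd r))
          (((hψ'c.mul hRc).add (hψc.mul hPc)).intervalIntegrable _ _),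
        hψa a (by simp), hψa b (by simp)]
      simp
    have hdiff := congrArg₂ (· - ·) (h ψ hψ hψs hψsub) hparts
    simp only [sub_zero] at hdiff
    have hi1 : IntegrableOn (fun r => ψ r * P r + deriv ψ r * Q r) (Set.Ioo a b) :=
      hint ((hψc.continuousOn.mul hP).add (hψ'c.continuousOn.mul hQ))
    have hi2 : IntegrableOn (fun r => deriv ψ r * (∫ s in a..r, P' s) + ψ r * P' r)
        (Set.Ioo a b) := hint ((hψ'c.mul hRc).add (hψc.mul hPc)).continuousOn
    rw [← integral_sub hi1 hi2] at hdiff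
    rw [← hdiff]
    refine setIntegral_congr_fun measurableSet_Ioo fun r hr => ?_
    simp only [hPe r (Set.Ioo_subset_Icc_self hr), hS]
    ring
  -- Subtracting `(∫ g) β` gives any test function `g` mean zero and hence a compactly supported
  -- primitive. The constant value of `S` is then its `β`-weighted mean.
  let β : ContDiffBump ((a + b) / 2) :=
    ⟨(b - a) / 8, (b - a) / 4, by linarith, by linarith⟩
  have hβsub : tsupport (β.normed volume) ⊆ Set.Ioo a b := by
    rw [β.tsupport_normed_eq, Real.closedBall_eq_Icc]
    refine Set.Icc_subset_Ioo ?_ ?_ <;> simp only [β] <;> linarith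
  have hβc : Continuous (β.normed volume) := β.continuous_normed
  set C := ∫ r in Set.Ioo a b, β.normed volume r * S r with hC
  have hae : ∀ᵐ r, r ∈ Set.Ioo a b → S r - C = 0 := by
    refine isOpen_Ioo.ae_eq_zero_of_integral_contDiff_smul_eq_zero
      ((hint (hSc.sub continuousOn_const)).locallyIntegrableOn) fun g hg hgs hgsub => ?_
    have hgi : Integrable g := hg.continuous.integrable_of_hasCompactSupport hgs
    have hβi : Integrable (β.normed volume) :=
      hβc.integrable_of_hasCompactSupport β.hasCompactSupport_normed
    set I := ∫ r, g r with hI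
    have hts : tsupport (fun r => g r - I * β.normed volume r) ⊆ Set.Ioo a b := by
      refine (tsupport_sub _ _).trans (Set.union_subset hgsub ?_)
      exact (tsupport_mul_subset_right).trans hβsub
    obtain ⟨ψ, h1, h2, h3, h4⟩ := exists_primitive_of_integral_eq_zero hab
      (g := fun r => g r - I * β.normed volume r) (hg.sub (contDiff_const.mul β.contDiff_normed))
      (hgs.sub (β.hasCompactSupport_normed.mul_left)) hts (by
        rw [integral_sub hgi (hβi.const_mul _), integral_const_mul, β.integral_normed]
        simp [hI])
    have h5 := hψS ψ h1 h2 h3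
    have hgS : IntegrableOn (fun r => g r * S r) (Set.Ioo a b) := hint (hg.continuous.continuousOn.mul hSc)
    have hβS : IntegrableOn (fun r => β.normed volume r * S r) (Set.Ioo a b) := hint (hβc.continuousOn.mul hSc)
    simp only [h4, sub_mul, mul_assoc] at h5
    rw [integral_sub hgS (hβS.const_mul _), integral_const_mul, ← hC] at h5
    have hIset : ∫ r in Set.Ioo a b, g r = I :=
      setIntegral_eq_integral_of_forall_compl_eq_zero fun r hr =>
        image_eq_zero_of_notMem_tsupport fun h => hr (hgsub h)
    have hwhole : ∫ r, g r • (S r - C) = ∫ r in Set.Ioo a b, (g r * S r - g r * C) := by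
      simp only [smul_eq_mul, ← mul_sub]
      refine (setIntegral_eq_integral_of_forall_compl_eq_zero fun r hr => ?_).symm
      rw [image_eq_zero_of_notMem_tsupport fun h => hr (hgsub h), zero_mul]
    rw [hwhole, integral_sub hgS (hgi.integrableOn.mul_const C), integral_mul_const, hIset]
    exact h5
  -- Continuity up to the ends carries the almost-everywhere identity to `a` and `b`, where it is
  -- needed.
  have hEq : Set.EqOn S (fun _ => C) (Set.Icc a b) := by
    refine Measure.eqOn_Icc_of_ae_eq volume hab.ne ?_ hSc continuousOn_const
    rw [← restrict_Ioo_eq_restrict_Icc]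
    filter_upwards [ae_restrict_of_ae hae, ae_restrict_mem measurableSet_Ioo] with r hr hr'
      using sub_eq_zero.1 (hr hr')
  have h1 := hEq (Set.left_mem_Icc.2 hab.le)
  have h2 := hEq (Set.right_mem_Icc.2 hab.le)
  simp only [hS, intervalIntegral.integral_same, sub_zero] at h1 h2
  have h3 : ∫ r in a..b, P r = ∫ r in a..b, P' r :=
    intervalIntegral.integral_congr fun r hr => (hPe r (by rwa [Set.uIcc_of_le hab.le] at hr)).symm
  rw [h3, h1]
  linarith

theorem continuousOn_sphereIntegral {n : ℕ} (x₀ : Space n) {a b : ℝ} (ha : 0 < a) (hab : a < b)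
    {f : Metric.sphere (0 : Space n) 1 → Space n → ℝ}
    (hf : ContinuousOn (fun p : Metric.sphere (0 : Space n) 1 × Space n => f p.1 p.2)
      (Set.univ ×ˢ closure (annulus x₀ a b))) :
    ContinuousOn (fun r : ℝ => ∫ θ, f θ (x₀ + r • (θ : Space n)) ∂(sphereMeasure n))
      (Set.Icc a b) := by
  have hc : ContinuousOn (fun p : ℝ × Metric.sphere (0 : Space n) 1 =>
      f p.2 (x₀ + p.1 • (p.2 : Space n))) (Set.Icc a b ×ˢ Set.univ) :=
    hf.comp (f := fun p : ℝ × Metric.sphere (0 : Space n) 1 => (p.2, x₀ + p.1 • (p.2 : Space n)))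
      (by fun_prop)
      fun p hp => ⟨trivial, add_smul_mem_closure_annulus x₀ ha hab hp.1 p.2⟩
  have := continuousOn_integral_of_compact_support (μ := sphereMeasure n) isCompact_univ
    (f := fun (r : ℝ) (θ : Metric.sphere (0 : Space n) 1) => f θ (x₀ + r • (θ : Space n))) hc
    (fun _ θ _ h => absurd trivial h)
  exact this

theorem isPreconnected_annulus {n : ℕ} (hn : 2 ≤ n) (x₀ : Space n) {a b : ℝ} (ha : 0 < a) :
    IsPreconnected (annulus x₀ a b) := by
  have hrank : 1 < Module.rank ℝ (Space n) := by
    rw [← Module.finrank_eq_rank]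
    simp
    exact_mod_cast hn
  have h := ((isPreconnected_sphere hrank (0 : Space n) 1).prod
    (isPreconnected_Ioo (a := a) (b := b))).image
    (fun p : Space n × ℝ => x₀ + p.2 • p.1) (by fun_prop)
  convert h using 1
  ext x
  constructor
  · intro hx
    have h0 : 0 < ‖x - x₀‖ := ha.trans hx.1
    refine ⟨(‖x - x₀‖⁻¹ • (x - x₀), ‖x - x₀‖), ⟨?_, hx⟩, ?_⟩
    · simp [norm_smul, h0.ne']
    · simp [smul_smul, h0.ne']
  · rintro ⟨p, ⟨hp1, hp2⟩, rfl⟩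
    exact add_smul_mem_annulus x₀ ha hp2 ⟨p.1, hp1⟩

/-- A harmonic function on the annulus with constant normal derivative and zero boundary mean
vanishes. -/
theorem eq_zero_of_harmonic_neumann {n : ℕ} (hn : 2 ≤ n) (x₀ : Space n) {a b : ℝ} (ha : 0 < a)
    (hab : a < b) {v : Space n → ℝ} {V : Space n → Space n} {δ : ℝ}
    (hv : ContDiffOn ℝ 2 v (annulus x₀ a b)) (hvc : ContinuousOn v (closure (annulus x₀ a b)))
    (hV : ∀ x ∈ annulus x₀ a b, V x = ∇ v x) (hVc : ContinuousOn V (closure (annulus x₀ a b)))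
    (hΔ : ∀ x ∈ annulus x₀ a b, Laplacian.laplacian v x = 0)
    (hδ : ∀ p ∈ frontier (annulus x₀ a b), ⟪V p, outerNormal (annulus x₀ a b) p⟫_ℝ = δ)
    (hm : ∫ x, v x ∂(surfaceMeasure (annulus x₀ a b)) = 0) :
    ∀ x ∈ closure (annulus x₀ a b), v x = 0 ∧ V x = 0 := by
  have hb := ha.trans hab
  have hΩ := isOpen_annulus x₀ a b
  obtain ⟨κ, hκ, hσ⟩ := exists_integral_surfaceMeasure_annulus hn
  have hmean : a ^ (n - 1) * ∫ θ, v (x₀ + a • (θ : Space n)) ∂(sphereMeasure n) +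
      b ^ (n - 1) * ∫ θ, v (x₀ + b • (θ : Space n)) ∂(sphereMeasure n) = 0 := by
    have := (hσ x₀ a b ha hab v hvc).symm.trans hm
    exact (mul_eq_zero.1 this).resolve_left hκ.ne'
  set D : ℝ → ℝ := fun r => ∫ θ, ‖V (x₀ + r • (θ : Space n))‖ ^ 2 ∂(sphereMeasure n) with hD
  set M : ℝ → ℝ := fun r => ∫ θ : Metric.sphere (0 : Space n) 1, v (x₀ + r • (θ : Space n)) *
    ⟪(θ : Space n), V (x₀ + r • (θ : Space n))⟫_ℝ ∂(sphereMeasure n) with hM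
  have hsnd : Set.MapsTo (Prod.snd : Metric.sphere (0 : Space n) 1 × Space n → Space n)
    (Set.univ ×ˢ closure (annulus x₀ a b)) (closure (annulus x₀ a b)) := fun p hp => hp.2
  have hVsnd := hVc.comp continuousOn_snd hsnd
  have hvsnd := hvc.comp continuousOn_snd hsnd
  have hDc : ContinuousOn D (Set.Icc a b) :=
    continuousOn_sphereIntegral x₀ ha hab (f := fun _ x => ‖V x‖ ^ 2) (hVsnd.norm.pow 2)
  have hMc : ContinuousOn M (Set.Icc a b) :=
    continuousOn_sphereIntegral x₀ ha hab (f := fun θ x => v x * ⟪(θ : Space n), V x⟫_ℝ)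
      (hvsnd.mul (ContinuousOn.inner (by fun_prop) hVsnd))
  have hpow : ContinuousOn (fun r : ℝ => r ^ (n - 1)) (Set.Icc a b) := by fun_prop
  -- In weak form, `r ^ (n - 1) M` has derivative `r ^ (n - 1) D`. Radial cut-offs keep the test
  -- inside the annulus, since `v` is only `C¹` up to the boundary.
  have hweak : ∀ ψ : ℝ → ℝ, ContDiff ℝ ∞ ψ → HasCompactSupport ψ → tsupport ψ ⊆ Set.Ioo a b →
      ∫ r in Set.Ioo a b, (ψ r * (r ^ (n - 1) * D r) + deriv ψ r * (r ^ (n - 1) * M r)) = 0 := by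
    intro ψ hψ hψs hψsub
    have hψ0 : (0 : ℝ) ∉ tsupport ψ := fun h => ha.not_gt (hψsub h).1
    have hζ : ContDiff ℝ 1 (fun x : Space n => ψ ‖x - x₀‖) :=
      (contDiff_radial x₀ hψ hψ0).of_le (by exact_mod_cast le_top)
    have h := integral_cutoff_mul_harmonic hΩ hv hΔ hζ (hasCompactSupport_radial x₀ hψs)
      ((tsupport_radial_subset x₀ ψ).trans fun x hx => hψsub hx)
    have hψ'c : Continuous (deriv ψ) := hψ.continuous_deriv (by simp)
    set f : Space n → ℝ := fun x => ψ ‖x - x₀‖ * ‖V x‖ ^ 2 +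
      v x * (deriv ψ ‖x - x₀‖ / ‖x - x₀‖ * ⟪x - x₀, V x⟫_ℝ) with hf
    have hfc : ContinuousOn f (closure (annulus x₀ a b)) := by
      have hne : ∀ x ∈ closure (annulus x₀ a b), ‖x - x₀‖ ≠ 0 := fun x hx => by
        rw [closure_annulus x₀ ha hab] at hx
        exact (ha.trans_le hx.1).ne'
      refine (ContinuousOn.mul ?_ (hVc.norm.pow 2)).add (hvc.mul (ContinuousOn.mul
        (ContinuousOn.div ?_ (by fun_prop) hne) (ContinuousOn.inner (by fun_prop) hVc)))
      · exact (hψ.continuous.comp (by fun_prop)).continuousOn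
      · exact (hψ'c.comp (by fun_prop)).continuousOn
    have h1 : ∫ x in annulus x₀ a b, f x = 0 := by
      rw [← h]
      refine setIntegral_congr_fun hΩ.measurableSet fun x hx => ?_
      have hne : x ≠ x₀ := sub_ne_zero.1 (norm_pos_iff.1 (ha.trans hx.1))
      simp only [hf, hV x hx]
      rw [(hasGradientAt_radial hne ((hψ.differentiable (by simp)) _).hasDerivAt).gradient,
        inner_smul_left, conj_trivial]
    rw [setIntegral_annulus (by omega) x₀ ha, integral_prod_symm _ (integrable_polar ha hab hfc)]
      at h1
    rw [← h1]
    refine setIntegral_congr_fun measurableSet_Ioo fun r hr => ?_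
    have hr0 := ha.trans hr.1
    have hmem : ∀ θ : Metric.sphere (0 : Space n) 1,
        x₀ + r • (θ : Space n) ∈ closure (annulus x₀ a b) := fun θ =>
      add_smul_mem_closure_annulus x₀ ha hab (Set.Ioo_subset_Icc_self hr) θ
    have hVθ : Continuous fun θ : Metric.sphere (0 : Space n) 1 => V (x₀ + r • (θ : Space n)) :=
      hVc.comp_continuous (by fun_prop) hmem
    have hvθ : Continuous fun θ : Metric.sphere (0 : Space n) 1 => v (x₀ + r • (θ : Space n)) :=
      hvc.comp_continuous (by fun_prop) hmem
    have hi1 : Integrable (fun θ : Metric.sphere (0 : Space n) 1 =>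
        ‖V (x₀ + r • (θ : Space n))‖ ^ 2) (sphereMeasure n) :=
      (hVθ.norm.pow 2).integrable_of_hasCompactSupport (HasCompactSupport.of_compactSpace _)
    have hi2 : Integrable (fun θ : Metric.sphere (0 : Space n) 1 => v (x₀ + r • (θ : Space n)) *
        ⟪(θ : Space n), V (x₀ + r • (θ : Space n))⟫_ℝ) (sphereMeasure n) :=
      (hvθ.mul (continuous_subtype_val.inner hVθ)).integrable_of_hasCompactSupport
        (HasCompactSupport.of_compactSpace _)
    simp only [hD, hM]
    rw [← integral_const_mul, ← integral_const_mul, ← integral_const_mul, ← integral_const_mul,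
      ← integral_add ((hi1.const_mul _).const_mul _) ((hi2.const_mul _).const_mul _)]
    refine integral_congr_ae (Eventually.of_forall fun θ => ?_)
    simp only [hf, add_sub_cancel_left, norm_smul_sphere hr0.le, inner_smul_left, conj_trivial]
    field_simp
  have hkey := sub_eq_integral_of_weak_deriv hab (hpow.mul hDc) (hpow.mul hMc) hweak
  have hMb : M b = δ * ∫ θ, v (x₀ + b • (θ : Space n)) ∂(sphereMeasure n) := by
    rw [← integral_const_mul]
    refine integral_congr_ae (Eventually.of_forall fun θ => ?_)
    have hp : ‖x₀ + b • (θ : Space n) - x₀‖ = b := by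
      rw [add_sub_cancel_left, norm_smul_sphere hb.le]
    have := hδ (x₀ + b • (θ : Space n)) (by
      rw [frontier_annulus x₀ ha hab]; exact Or.inr (mem_sphere_iff_norm.2 hp))
    rw [outerNormal_outer ha hab hp, add_sub_cancel_left, smul_smul, inv_mul_cancel₀ hb.ne',
      one_smul, real_inner_comm] at this
    simp only [this, mul_comm]
  have hMa : M a = -δ * ∫ θ, v (x₀ + a • (θ : Space n)) ∂(sphereMeasure n) := by
    rw [← integral_const_mul]
    refine integral_congr_ae (Eventually.of_forall fun θ => ?_)
    have hp : ‖x₀ + a • (θ : Space n) - x₀‖ = a := by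
      rw [add_sub_cancel_left, norm_smul_sphere ha.le]
    have := hδ (x₀ + a • (θ : Space n)) (by
      rw [frontier_annulus x₀ ha hab]; exact Or.inl (mem_sphere_iff_norm.2 hp))
    rw [outerNormal_inner ha hab hp, add_sub_cancel_left, smul_smul, inv_mul_cancel₀ ha.ne',
      one_smul, inner_neg_right, real_inner_comm] at this
    simp only [← this, mul_comm, neg_neg]
  -- The endpoint terms combine to `δ` times the polar boundary bracket of `v`, because the outward
  -- normals have opposite radial signs.
  have hzero : ∫ r in a..b, r ^ (n - 1) * D r = 0 := by
    simp only [Pi.mul_apply] at hkey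
    rw [← hkey, hMa, hMb]
    linear_combination δ * hmean
  have hDnn : ∀ r, 0 ≤ D r := fun r => integral_nonneg fun θ => by positivity
  have hD0 : ∀ r ∈ Set.Ioo a b, D r = 0 := by
    intro r hr
    rw [intervalIntegral.integral_of_le hab.le, integral_Ioc_eq_integral_Ioo,
      setIntegral_eq_zero_iff_of_nonneg_ae] at hzero
    · have h1 := Measure.eqOn_Ioo_of_ae_eq volume hzero
        ((hpow.mul hDc).mono Set.Ioo_subset_Icc_self) continuousOn_const hr
      exact (mul_eq_zero.1 h1).resolve_left (pow_pos (ha.trans hr.1) _).ne'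
    · filter_upwards [ae_restrict_mem measurableSet_Ioo] with s hs
        using mul_nonneg (pow_pos (ha.trans hs.1) _).le (hDnn s)
    · exact (hpow.mul hDc).integrableOn_Icc.mono_set Set.Ioo_subset_Icc_self
  have hn0 : Nontrivial (Space n) := by
    have : Nontrivial (Fin n) := Fin.nontrivial_iff_two_le.2 hn
    infer_instance
  have hVzero : ∀ x ∈ annulus x₀ a b, V x = 0 := by
    intro x hx
    have h0 : 0 < ‖x - x₀‖ := ha.trans hx.1
    have hcont : Continuous fun θ : Metric.sphere (0 : Space n) 1 =>
        ‖V (x₀ + ‖x - x₀‖ • (θ : Space n))‖ ^ 2 :=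
      (hVc.comp_continuous (by fun_prop) fun θ => add_smul_mem_closure_annulus x₀ ha hab
        (Set.Ioo_subset_Icc_self hx) θ).norm.pow 2
    have h1 := hD0 ‖x - x₀‖ hx
    rw [hD, integral_eq_zero_iff_of_nonneg (fun θ => by positivity)
      (hcont.integrable_of_hasCompactSupport (HasCompactSupport.of_compactSpace _))] at h1
    have h2 := congrFun ((Continuous.ae_eq_iff_eq (sphereMeasure n) hcont continuous_zero).1 h1) ⟨‖x - x₀‖⁻¹ • (x - x₀), by simp [norm_smul, h0.ne']⟩
    simpa [smul_smul, h0.ne'] using h2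
  have hsub : annulus x₀ a b ⊆ closure (annulus x₀ a b) := subset_closure
  have hVcl : ∀ x ∈ closure (annulus x₀ a b), V x = 0 :=
    Set.EqOn.of_subset_closure (g := fun _ => (0 : Space n)) hVzero hVc continuousOn_const
      hsub subset_rfl
  have hfd : ∀ x ∈ annulus x₀ a b, fderiv ℝ v x = 0 := by
    intro x hx
    rw [← toDual_gradient, ← hV x hx, hVzero x hx, map_zero]
  obtain ⟨k, hk⟩ := hΩ.exists_is_const_of_fderiv_eq_zero (isPreconnected_annulus hn x₀ ha)
    (hv.differentiableOn two_ne_zero) hfd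
  have hkcl : ∀ x ∈ closure (annulus x₀ a b), v x = k :=
    Set.EqOn.of_subset_closure (g := fun _ => k) hk hvc continuousOn_const hsub subset_rfl
  -- Vanishing gradient leaves a constant, which the zero boundary mean forces to be zero.
  have hk0 : k = 0 := by
    have hsa : ∀ r ∈ Set.Icc a b, ∫ θ, v (x₀ + r • (θ : Space n)) ∂(sphereMeasure n) =
        (sphereMeasure n).real Set.univ * k := by
      intro r hr
      simp_rw [hkcl _ (add_smul_mem_closure_annulus x₀ ha hab hr _)]
      simp
    rw [hsa a ⟨le_rfl, hab.le⟩, hsa b ⟨hab.le, le_rfl⟩] at hmean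
    have hpos : 0 < (sphereMeasure n).real Set.univ := by
      have : Nonempty (Metric.sphere (0 : Space n) 1) :=
        (NormedSpace.sphere_nonempty.2 zero_le_one).to_subtype
      exact ENNReal.toReal_pos (isOpen_univ.measure_pos _ Set.univ_nonempty).ne'
        (measure_ne_top _ _)
    have : (a ^ (n - 1) + b ^ (n - 1)) * ((sphereMeasure n).real Set.univ * k) = 0 := by
      linarith
    have hab' : a ^ (n - 1) + b ^ (n - 1) ≠ 0 := by positivity
    exact (mul_eq_zero.1 ((mul_eq_zero.1 this).resolve_left hab')).resolve_left hpos.ne'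
  exact fun x hx => ⟨(hkcl x hx).trans hk0, hVcl x hx⟩

/-- The two constants need not agree beforehand: the difference has constant normal derivative `c -
d`, which is all that the energy argument needs. -/
theorem IsNeumannSolution.eq {n : ℕ} (hn : 2 ≤ n) {x₀ : Space n} {a b : ℝ} (ha : 0 < a)
    (hab : a < b) {u w : Space n → ℝ} {Du Dw : Space n → Space n} {c d : ℝ}
    (hu : IsNeumannSolution (annulus x₀ a b) u Du c)
    (hw : IsNeumannSolution (annulus x₀ a b) w Dw d) :
    ∀ x ∈ closure (annulus x₀ a b), u x = w x ∧ Du x = Dw x := by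
  have hΩ := isOpen_annulus x₀ a b
  have := isFiniteMeasure_surfaceMeasure_annulus hn x₀ ha hab
  have hint : ∀ {f : Space n → ℝ}, ContinuousOn f (closure (annulus x₀ a b)) →
      Integrable f (surfaceMeasure (annulus x₀ a b)) := by
    intro f hf
    obtain ⟨C, hC⟩ := (isCompact_closure_annulus x₀ a b).exists_bound_of_continuousOn hf
    have hmeas : MeasurableSet (frontier (annulus x₀ a b)) := isClosed_frontier.measurableSet
    refine Integrable.of_bound
      ((hf.mono frontier_subset_closure).aestronglyMeasurable hmeas) C ?_
    filter_upwards [ae_restrict_mem hmeas] with x hx using hC x (frontier_subset_closure hx)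
  have h := eq_zero_of_harmonic_neumann hn x₀ ha hab (v := u - w) (V := Du - Dw) (δ := c - d)
    (hu.contDiffOn.sub hw.contDiffOn) (hu.continuousOn.sub hw.continuousOn)
    (fun x hx => ?_) (hu.continuousOn_gradient.sub hw.continuousOn_gradient) (fun x hx => ?_)
    (fun p hp => ?_) ?_
  · exact fun x hx => ⟨sub_eq_zero.1 (h x hx).1, sub_eq_zero.1 (h x hx).2⟩
  · have h1 := (hu.contDiffOn.contDiffAt (hΩ.mem_nhds hx)).differentiableAt two_ne_zero
    have h2 := (hw.contDiffOn.contDiffAt (hΩ.mem_nhds hx)).differentiableAt two_ne_zero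
    rw [Pi.sub_apply, hu.gradient_eq x hx, hw.gradient_eq x hx, gradient, gradient, gradient,
      fderiv_sub h1 h2, map_sub]
  · have h1 := hu.contDiffOn.contDiffAt (hΩ.mem_nhds hx)
    have h2 := hw.contDiffOn.contDiffAt (hΩ.mem_nhds hx)
    rw [h1.laplacian_sub h2]
    linarith [hu.neg_laplacian x hx, hw.neg_laplacian x hx]
  · rw [Pi.sub_apply, inner_sub_left, hu.normal_derivative p hp, hw.normal_derivative p hp]
  · simp only [Pi.sub_apply]
    rw [integral_sub (hint hu.continuousOn) (hint hw.continuousOn), hu.boundary_mean,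
      hw.boundary_mean, sub_zero]

theorem not_stationarityCondition {n : ℕ} (hn : 2 ≤ n) {b : ℝ} (hb : 1 < b)
    {u : Space n → ℝ} {Du : Space n → Space n} {ρ : ℝ → ℝ}
    (hρd : ∀ r ∈ Set.Icc 1 b, HasDerivAt ρ (slope n 1 b r) r)
    (hρm : 1 ^ (n - 1) * ρ 1 + b ^ (n - 1) * ρ b = 0)
    (hu : ∀ x ∈ closure (annulus (0 : Space n) 1 b), u x = ρ ‖x‖ ∧ Du x = slopeField n 0 1 b x) :
    ¬ StationarityCondition (annulus 0 1 b) u Du (slope n 1 b b) := by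
  rintro ⟨K, hK⟩
  have hb0 : 0 < b := zero_lt_one.trans hb
  have hnR : (2 : ℝ) ≤ n := by exact_mod_cast hn
  have hneg : slope n 1 b b < 0 := slope_right_neg (by omega) zero_lt_one hb
  have : Nontrivial (Space n) := by
    have : Nontrivial (Fin n) := Fin.nontrivial_iff_two_le.2 hn
    infer_instance
  obtain ⟨e, he⟩ := exists_norm_eq (Space n) zero_le_one
  have hbe : ‖b • e‖ = b := by rw [norm_smul, he, mul_one, Real.norm_of_nonneg hb0.le]
  have hfe : e ∈ frontier (annulus (0 : Space n) 1 b) := by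
    rw [frontier_annulus 0 zero_lt_one hb]
    exact Or.inl (mem_sphere_zero_iff_norm.2 he)
  have hfbe : b • e ∈ frontier (annulus (0 : Space n) 1 b) := by
    rw [frontier_annulus 0 zero_lt_one hb]
    exact Or.inr (mem_sphere_zero_iff_norm.2 hbe)
  have h1 := hK e hfe
  have h2 := hK (b • e) hfbe
  rw [(hu e (frontier_subset_closure hfe)).1, (hu e (frontier_subset_closure hfe)).2,
    meanCurvature_inner zero_lt_one hb (by rw [sub_zero, he]), he, norm_slopeField 1 b
      (norm_pos_iff.1 (he.symm ▸ zero_lt_one)), sub_zero, he, sq_abs, slope_left n zero_lt_one hb]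
    at h1
  rw [(hu _ (frontier_subset_closure hfbe)).1, (hu _ (frontier_subset_closure hfbe)).2,
    meanCurvature_outer zero_lt_one hb (by rw [sub_zero, hbe]), hbe, norm_slopeField 1 b
      (norm_pos_iff.1 (hbe.symm ▸ hb0)), sub_zero, hbe, sq_abs] at h2
  have hlt : ρ b < ρ 1 := by
    have hcont : ContinuousOn (slope n 1 b) (Set.uIcc 1 b) := by
      rw [Set.uIcc_of_le hb.le]
      exact (contDiffOn_slope n 1 b).continuousOn.mono fun r hr => zero_lt_one.trans_le hr.1
    have h3 := intervalIntegral.integral_eq_sub_of_hasDerivAt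
      (by rwa [Set.uIcc_of_le hb.le]) hcont.intervalIntegrable
    have h4 : ∫ r in (1 : ℝ)..b, slope n 1 b r =
        (slopeConst n 1 b * (∫ r in (1 : ℝ)..b, (r ^ (n - 1))⁻¹) - (b ^ 2 - 1 ^ 2) / 2) / n := by
      rw [← intervalIntegral.integral_const_mul, ← integral_id, ← intervalIntegral.integral_sub
        ((intervalIntegrable_inv_pow (n - 1) zero_lt_one hb0).const_mul _)
        intervalIntegral.intervalIntegrable_id, ← intervalIntegral.integral_div]
      rfl
    have h5 := slopeConst_mul_integral_lt hn zero_lt_one hb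
    have h6 : (slopeConst n 1 b * (∫ r in (1 : ℝ)..b, (r ^ (n - 1))⁻¹) - (b ^ 2 - 1 ^ 2) / 2) / n
        < 0 := div_neg_of_neg_of_pos (by linarith) (by linarith)
    linarith
  set c := slope n 1 b b
  have hB : 1 < b ^ (n - 1) := one_lt_pow₀ hb (by omega)
  set B := b ^ (n - 1)
  rw [one_pow, one_mul] at hρm
  have hρ1 : ρ 1 = -(B * ρ b) := by linarith
  have hρb : ρ b < 0 := by nlinarith
  rw [hρ1] at h1
  -- The terms `½ c²` cancel, and `ρ 1 = -B ρ b` eliminates the inner value. Both factors are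
  -- negative: `ρ b < 0` from `ρ b < ρ 1`, and the second since `c < 0` and `1 / b < 1 < B`.
  have h3 : ρ b * (c * (n - 1) * (B - 1 / b) - (1 + B)) = 0 := by
    linear_combination h2 - h1
  have hb1 : 1 / b < 1 := (div_lt_one hb0).2 hb
  have h4 : c * (n - 1) * (B - 1 / b) - (1 + B) < 0 := by
    have : c * (n - 1) < 0 := mul_neg_of_neg_of_pos hneg (by linarith)
    have : c * (n - 1) * (B - 1 / b) < 0 := mul_neg_of_neg_of_pos this (by linarith)
    linarith
  exact (mul_pos_of_neg_of_neg hρb h4).ne' h3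

theorem IsNeumannSolution.normalDerivative_eq {n : ℕ} (hn : 2 ≤ n) {x₀ : Space n} {a b : ℝ}
    (ha : 0 < a) (hab : a < b) {u w : Space n → ℝ} {Du Dw : Space n → Space n} {c d : ℝ}
    (hu : IsNeumannSolution (annulus x₀ a b) u Du c)
    (hw : IsNeumannSolution (annulus x₀ a b) w Dw d) : c = d := by
  have : Nontrivial (Space n) := by
    have : Nontrivial (Fin n) := Fin.nontrivial_iff_two_le.2 hn
    infer_instance
  obtain ⟨p, hp⟩ := (NormedSpace.sphere_nonempty (x := x₀)).2 ha.le
  have hpf : p ∈ frontier (annulus x₀ a b) := by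
    rw [frontier_annulus x₀ ha hab]
    exact Or.inl hp
  rw [← hu.normal_derivative p hpf, ← hw.normal_derivative p hpf,
    (hu.eq hn ha hab hw p (frontier_subset_closure hpf)).2]

end NeumannTorsion

end

theorem mainTheorem5 (n : ℕ) (hn : 2 ≤ n) :
    (∀ (x₀ : NeumannTorsion.Space n) (a b : ℝ), 0 < a → a < b →
      ¬ NeumannTorsion.IsStationaryShape (NeumannTorsion.annulus x₀ a b)) ∧
    (∀ b : ℝ, 1 < b →
      (∃ (u : NeumannTorsion.Space n → ℝ) (Du : NeumannTorsion.Space n → NeumannTorsion.Space n)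
        (c : ℝ), NeumannTorsion.IsNeumannSolution (NeumannTorsion.annulus 0 1 b) u Du c) ∧
      (∀ (u : NeumannTorsion.Space n → ℝ) (Du : NeumannTorsion.Space n → NeumannTorsion.Space n)
        (c : ℝ), NeumannTorsion.IsNeumannSolution (NeumannTorsion.annulus 0 1 b) u Du c →
        (∃ w : ℝ → ℝ, ∀ x ∈ closure (NeumannTorsion.annulus (0 : NeumannTorsion.Space n) 1 b),
          u x = w ‖x‖) ∧
        ¬ NeumannTorsion.StationarityCondition (NeumannTorsion.annulus 0 1 b) u Du c)) := by
  refine ⟨fun x₀ a b ha hab => NeumannTorsion.not_isStationaryShape_annulus hn x₀ ha hab,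
    fun b hb => ?_⟩
  obtain ⟨ρ, hρ, -, hρ0, hρd, hρm⟩ := NeumannTorsion.exists_profile (n := n) zero_lt_one hb
  have hw := NeumannTorsion.isNeumannSolution_profile hn 0 zero_lt_one hb hρ hρ0 hρd hρm
  refine ⟨⟨_, _, _, hw⟩, fun u Du c hu => ?_⟩
  have heq := hu.eq hn zero_lt_one hb hw
  simp only [sub_zero] at heq
  refine ⟨⟨ρ, fun x hx => (heq x hx).1⟩, ?_⟩
  rw [hu.normalDerivative_eq hn zero_lt_one hb hw]
  refine NeumannTorsion.not_stationarityCondition hn hb hρd hρm fun x hx =>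
    ⟨(heq x hx).1, (heq x hx).2.trans ?_⟩
  rw [← NeumannTorsion.gradient_profile zero_lt_one hb hρd hx]
  simp only [sub_zero]
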